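/- **Theorem.** Let $Q=\{R_1,\dots,R_k\}$ be an acyclic natural join over an attribute set $V$ with $|V|=n$: each $R_i$ is a finite set of tuples over its schema $\mathrm{schema}(R_i)\subseteq V$, $V=\bigcup_i\mathrm{schema}(R_i)$, and there is a tree on the relations such that, for every attribute, the relations containing it form a connected subtree. Let $p_i:R_i\to[0,1]$ be weight functions, let $N=\sum_i|R_i|$, and let $$\mathrm{Join}(Q)=\{u \text{ tuple over } V : u[\mathrm{schema}(R_i)]\in R_i \text{ for all } i\},\qquad p(u)=\prod_{i=1}^k p_i(u[\mathrm{schema}(R_i)]),\qquad \mu_\Psi=\sum_{u\in \mathrm{Join}(Q)}p(u).$$ A subset sampling query asks for a random set $X\subseteq\mathrm{Join}(Q)$ with $$\Pr[X=Y]=\prod_{u\in Y}p(u)\prod_{u\in\mathrm{Join}(Q)\setminus Y}(1-p(u))\qquad (Y\subseteq \mathrm{Join}(Q)),$$ where the answers to distinct queries must be independent. Work on a real RAM, on which a memory access, an arithmetic operation or comparison of real numbers, rounding down, a logarithm or exponential, and drawing a uniform random number from $[0,1]$ take constant time; attribute values and weights occupy one memory cell each. Then there is an index that can be built in $O(N\log^{k-1}N)$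 time and $O(N\log^{k-1}N)$ space (for $N\ge2$), using which each subset sampling query can be answered in $O(1+\mu_\Psi\log N)$ expected time. Here $\log=\log_2$ (with the convention that $\mu_\Psi\log N=0$ for $N=0$), the algorithms may depend on the schemas of $Q$ (data complexity), and the constants in the $O$-bounds depend only on $n$ and $k$. -/

import Mathlib

/-! ## Natural joins with tuple weights -/

namespace SubsetSamplingJoin

open MeasureTheory

/-- The schema graph of a natural join of `k` relations `R_0, …, R_{k-1}` over the `n` attributes
`Fin n`: the `i`-th relation has schema `schema i`. Every attribute occurs in some schema, that is,
`attset(Q) = ⋃ i, schema i` is all of `Fin n`. Schemas may coincide or be empty. -/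
structure JoinSchema (n k : ℕ) where
  schema : Fin k → Finset (Fin n)
  cover : ∀ a, ∃ i, a ∈ schema i

variable {n k : ℕ}

/-- The schema is acyclic: it has a join tree, a tree on the relations such that for each attribute
the relations containing it form a connected subtree. -/
def JoinSchema.Acyclic (S : JoinSchema n k) : Prop :=
  ∃ T : SimpleGraph (Fin k), T.IsTree ∧
    ∀ a : Fin n, (T.induce {i : Fin k | a ∈ S.schema i}).Connected

/-- A tuple over a set `U` of attributes. Values are what a memory cell can hold: reals. -/
abbrev Tup (U : Finset (Fin n)) : Type := {a : Fin n // a ∈ U} → ℝ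

/-- The projection `u[U]` of a tuple `u` over all attributes. -/
def proj (U : Finset (Fin n)) (u : Fin n → ℝ) : Tup U := fun a => u a.1

/-- A weighted join instance: each relation is a finite set of tuples over its schema, listed without
repetition in an arbitrary order, together with a weight in `[0, 1]` for each of its tuples (the
values of `wt i` outside of the relation play no role). -/
structure Instance (S : JoinSchema n k) where
  rel : (i : Fin k) → List (Tup (S.schema i))
  nodup : ∀ i, (rel i).Nodup
  wt : (i : Fin k) → Tup (S.schema i) → ℝ
  wt_mem : ∀ i, ∀ u ∈ rel i, wt i u ∈ Set.Icc (0 : ℝ) 1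

namespace Instance

variable {S : JoinSchema n k} (I : Instance S)

/-- The input size `N`, the total number of tuples. -/
def size : ℕ := ∑ i, (I.rel i).length

/-- The join result, as a set of tuples over `attset(Q)`. -/
def joinSet : Set (Fin n → ℝ) := {u | ∀ i, proj (S.schema i) u ∈ I.rel i}

theorem joinSet_finite : I.joinSet.Finite := by
  classical
  have hfin : {f : ∀ i, Tup (S.schema i) | ∀ i, f i ∈ {t | t ∈ I.rel i}}.Finite :=
    Set.Finite.pi' fun i => (I.rel i).finite_toSet
  refine Set.Finite.of_injOn (f := fun u i => proj (S.schema i) u) ?_ ?_ hfin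
  · intro u hu i
    exact hu i
  · intro u _ v _ huv
    funext a
    obtain ⟨i, hi⟩ := S.cover a
    exact congrFun (congrFun huv i) ⟨a, hi⟩

/-- The join result `Join(Q)`. -/
noncomputable def join : Finset (Fin n → ℝ) := I.joinSet_finite.toFinset

/-- The weight of a join result: the product of the weights of its constituent tuples. -/
noncomputable def weight (u : Fin n → ℝ) : ℝ := ∏ i, I.wt i (proj (S.schema i) u)

/-- The expected size `μ_Ψ` of a subset sample of the join result. -/
noncomputable def mu : ℝ := ∑ u ∈ I.join, I.weight u

open Classical in
/-- The probability with which a subset sample of the join result equals `Y ⊆ Join(Q)`, when each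
`u` is included independently with probability `weight u`. -/
noncomputable def sampleProb (Y : Finset (Fin n → ℝ)) : ℝ :=
  (∏ u ∈ Y, I.weight u) * ∏ u ∈ I.join \ Y, (1 - I.weight u)

/-- One row of a relation as it is stored: the values in increasing order of the attributes, followed
by the weight. -/
noncomputable def row (i : Fin k) (u : Tup (S.schema i)) : List ℝ :=
  List.ofFn (fun j : Fin (S.schema i).card => u ((S.schema i).orderIsoOfFin rfl j)) ++ [I.wt i u]

/-- The input as a sequence of memory cells: the sizes of the `k` relations, then all rows of the
first relation, all rows of the second relation, and so on. -/
noncomputable def input : List ℝ :=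
  List.ofFn (fun i => ((I.rel i).length : ℝ)) ++
    (List.finRange k).flatMap fun i => (I.rel i).flatMap (I.row i)

end Instance

/-! ## The real RAM with random numbers

Programs are written in a small structured language. There are registers `0, 1, 2, …` (a program
mentions finitely many of them) and an unbounded memory, whose cells are addressed indirectly. All
registers and cells hold real numbers. Time is counted in elementary steps: one unit for each node of
each expression or test that is evaluated, and one more for the command that uses it. -/

/-- Binary arithmetic. -/
inductive BinOp
  | add | sub | mul | div

/-- Unary operations: rounding down, natural logarithm, exponential. -/
inductive UnOp
  | floor | log | exp

/-- Arithmetic expressions over the registers; the only constants are integers. -/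
inductive Expr
  | const (c : ℤ)
  | reg (r : ℕ)
  | un (o : UnOp) (e : Expr)
  | bin (o : BinOp) (e₁ e₂ : Expr)

/-- Tests. -/
inductive Test
  | le (e₁ e₂ : Expr)
  | not (b : Test)
  | and (b₁ b₂ : Test)

/-- Programs. -/
inductive Cmd
  /-- do nothing -/
  | skip
  /-- set register `r` to the value of `e` -/
  | set (r : ℕ) (e : Expr)
  /-- read the memory cell with address `a` into register `r` -/
  | load (r : ℕ) (a : Expr)
  /-- write the value of `e` into the memory cell with address `a` -/
  | store (a e : Expr)
  /-- put a fresh random number, uniform on `[0, 1]`, into register `r` -/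
  | rand (r : ℕ)
  /-- append a record, consisting of the values of `es`, to the output -/
  | emit (es : List Expr)
  | seq (c₁ c₂ : Cmd)
  | ite (b : Test) (c₁ c₂ : Cmd)
  | while (b : Test) (c : Cmd)

/-- An infinite supply of random numbers, drawn in this order. -/
abbrev Tape : Type := ℕ → unitInterval

/-- A state of the machine. The last two fields keep account: `time` is the time spent so far, and
all cells in use (those of the input and those read or written so far) have addresses `< top`. -/
structure State where
  reg : ℕ → ℝ
  mem : ℕ → ℝ
  tape : Tape
  out : List (List ℝ)
  time : ℕ
  top : ℕ

/-- As for Lean's real functions, `x / 0 = 0`. -/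
noncomputable def BinOp.eval : BinOp → ℝ → ℝ → ℝ
  | add, x, y => x + y
  | sub, x, y => x - y
  | mul, x, y => x * y
  | div, x, y => x / y

/-- As for Lean's real functions, `log x = log |x|` and `log 0 = 0`. -/
noncomputable def UnOp.eval : UnOp → ℝ → ℝ
  | floor, x => (⌊x⌋ : ℝ)
  | log, x => Real.log x
  | exp, x => Real.exp x

noncomputable def Expr.eval (ρ : ℕ → ℝ) : Expr → ℝ
  | const c => c
  | reg r => ρ r
  | un o e => o.eval (e.eval ρ)
  | bin o e₁ e₂ => o.eval (e₁.eval ρ) (e₂.eval ρ)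

/-- The address denoted by an expression; negative and fractional values are rounded. -/
noncomputable def Expr.addr (ρ : ℕ → ℝ) (e : Expr) : ℕ := ⌊e.eval ρ⌋₊

def Expr.cost : Expr → ℕ
  | const _ => 1
  | reg _ => 1
  | un _ e => 1 + e.cost
  | bin _ e₁ e₂ => 1 + e₁.cost + e₂.cost

def Test.holds (ρ : ℕ → ℝ) : Test → Prop
  | le e₁ e₂ => e₁.eval ρ ≤ e₂.eval ρ
  | not b => ¬ b.holds ρ
  | and b₁ b₂ => b₁.holds ρ ∧ b₂.holds ρ

def Test.cost : Test → ℕ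
  | le e₁ e₂ => 1 + e₁.cost + e₂.cost
  | not b => 1 + b.cost
  | and b₁ b₂ => 1 + b₁.cost + b₂.cost

namespace State

/-- Let `t` units of time pass. -/
def tick (s : State) (t : ℕ) : State := { s with time := s.time + t }

def setReg (s : State) (r : ℕ) (x : ℝ) : State := { s with reg := Function.update s.reg r x }

def load (s : State) (r a : ℕ) : State :=
  { s with reg := Function.update s.reg r (s.mem a), top := max s.top (a + 1) }

def store (s : State) (a : ℕ) (x : ℝ) : State :=
  { s with mem := Function.update s.mem a x, top := max s.top (a + 1) }

def rand (s : State) (r : ℕ) : State :=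
  { s with reg := Function.update s.reg r (s.tape 0 : ℝ), tape := fun i => s.tape (i + 1) }

def emit (s : State) (x : List ℝ) : State := { s with out := s.out ++ [x] }

/-- The state in which a new query starts: everything stored so far remains, the output and the
clock are reset, and new random numbers are supplied. -/
def fresh (s : State) (τ : Tape) : State := { s with tape := τ, out := [], time := 0 }

end State

open Classical in
/-- Execution of a program with a bound on the recursion depth; `none` if the bound is exceeded. -/
noncomputable def Cmd.exec : ℕ → Cmd → State → Option State
  | 0, _, _ => none
  | _ + 1, skip, s => some (s.tick 1)
  | _ + 1, set r e, s => some ((s.setReg r (e.eval s.reg)).tick (1 + e.cost))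
  | _ + 1, load r a, s => some ((s.load r (a.addr s.reg)).tick (1 + a.cost))
  | _ + 1, store a e, s =>
      some ((s.store (a.addr s.reg) (e.eval s.reg)).tick (1 + a.cost + e.cost))
  | _ + 1, rand r, s => some ((s.rand r).tick 1)
  | _ + 1, emit es, s =>
      some ((s.emit (es.map fun e => e.eval s.reg)).tick (1 + (es.map Expr.cost).sum))
  | f + 1, seq c₁ c₂, s => (Cmd.exec f c₁ s).bind (Cmd.exec f c₂)
  | f + 1, ite b c₁ c₂, s =>
      if b.holds s.reg then Cmd.exec f c₁ (s.tick b.cost) else Cmd.exec f c₂ (s.tick b.cost)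
  | f + 1, .while b c, s =>
      if b.holds s.reg then (Cmd.exec f c (s.tick b.cost)).bind (Cmd.exec f (.while b c))
      else some (s.tick b.cost)

open Classical in
/-- The final state of the program `c` started in `s`, `none` if it does not terminate. -/
noncomputable def Cmd.run (c : Cmd) (s : State) : Option State :=
  if h : ∃ f, (c.exec f s).isSome then c.exec (Nat.find h) s else none

/-! ## Building an index and querying it -/

/-- The state in which the construction of the index starts: the input is in the first memory cells,
all other cells and registers are `0`. -/
noncomputable def Instance.initial {S : JoinSchema n k} (I : Instance S) (τ : Tape) : State where
  reg := fun _ => 0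
  mem := fun a => I.input.getD a 0
  tape := τ
  out := []
  time := 0
  top := I.input.length

/-- Independent uniform random numbers on `[0, 1]`. -/
noncomputable def tapeMeasure : Measure Tape :=
  Measure.infinitePi fun _ : ℕ => (volume : Measure unitInterval)

instance : IsProbabilityMeasure tapeMeasure := by
  unfold tapeMeasure
  infer_instance

/-- Random numbers for a sequence of queries: the `i`-th query draws from `ω i`. -/
noncomputable def sessionMeasure : Measure (ℕ → Tape) :=
  Measure.infinitePi fun _ : ℕ => tapeMeasure

/-- The state after the first `i` queries in succession, where `D` is the state that the construction
of the index has left; `none` if one of these queries does not terminate. -/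
noncomputable def session (query : Cmd) (D : State) (ω : ℕ → Tape) : ℕ → Option State
  | 0 => some D
  | i + 1 => (session query D ω i).bind fun s => query.run (s.fresh (ω i))

/-- The `i`-th query (counted from `0`) terminates and returns the set `Y`: its output lists the
elements of `Y`, each exactly once, in some order. -/
def Returns (query : Cmd) (D : State) (ω : ℕ → Tape) (i : ℕ) (Y : Finset (Fin n → ℝ)) : Prop :=
  ∃ s, session query D ω (i + 1) = some s ∧
    ∃ l : List (Fin n → ℝ), l.Nodup ∧ (∀ u, u ∈ l ↔ u ∈ Y) ∧ s.out = l.map List.ofFn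

/-- The running time of the `i`-th query, `∞` if it does not terminate. -/
noncomputable def queryTime (query : Cmd) (D : State) (ω : ℕ → Tape) (i : ℕ) : ENNReal :=
  match session query D ω (i + 1) with
  | some s => (s.time : ENNReal)
  | none => ⊤

end SubsetSamplingJoin

namespace SubsetSamplingJoin

/-! ### Total correctness of programs -/

theorem Cmd.exec_succ : ∀ (f : ℕ) (c : Cmd) (s s' : State),
    c.exec f s = some s' → c.exec (f + 1) s = some s' := by
  intro f
  induction f with
  | zero => intro c s s' h; simp [Cmd.exec] at h
  | succ f ih =>
    intro c s s' h
    match c, h with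
    | .seq c₁ c₂, h =>
      simp only [Cmd.exec, Option.bind_eq_some_iff] at h ⊢
      obtain ⟨u, h1, h2⟩ := h
      exact ⟨u, ih _ _ _ h1, ih _ _ _ h2⟩
    | .ite b c₁ c₂, h =>
      rw [Cmd.exec] at h ⊢
      split_ifs at h ⊢
      · exact ih _ _ _ h
      · exact ih _ _ _ h
    | .while b c, h =>
      rw [Cmd.exec] at h ⊢
      split_ifs at h ⊢
      · simp only [Option.bind_eq_some_iff] at h ⊢
        obtain ⟨u, h1, h2⟩ := h
        exact ⟨u, ih _ _ _ h1, ih _ _ _ h2⟩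
      · exact h
    | .skip, h => simpa only [Cmd.exec] using h
    | .set _ _, h => simpa only [Cmd.exec] using h
    | .load _ _, h => simpa only [Cmd.exec] using h
    | .store _ _, h => simpa only [Cmd.exec] using h
    | .rand _, h => simpa only [Cmd.exec] using h
    | .emit _, h => simpa only [Cmd.exec] using h

theorem Cmd.exec_mono {f g : ℕ} (hfg : f ≤ g) {c : Cmd} {s s' : State}
    (h : c.exec f s = some s') : c.exec g s = some s' := by
  induction g, hfg using Nat.le_induction with
  | base => exact h
  | succ g _ ih => exact Cmd.exec_succ _ _ _ _ ih

/-- The program `c` started in `s` terminates in a state that satisfies `Q`. -/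
def wp (c : Cmd) (s : State) (Q : State → Prop) : Prop :=
  ∃ f s', c.exec f s = some s' ∧ Q s'

theorem Cmd.run_eq_of_exec {f : ℕ} {c : Cmd} {s s' : State} (h : c.exec f s = some s') :
    c.run s = some s' := by
  classical
  have hex : ∃ f, (c.exec f s).isSome := ⟨f, by simp [h]⟩
  rw [Cmd.run, dif_pos hex]
  obtain ⟨t, ht⟩ := Option.isSome_iff_exists.1 (Nat.find_spec hex)
  have := Cmd.exec_mono (Nat.find_min' hex (by simp [h] : (c.exec f s).isSome)) ht
  rw [ht, ← this, h]

theorem wp.run {c : Cmd} {s : State} {Q : State → Prop} (h : wp c s Q) :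
    ∃ s', c.run s = some s' ∧ Q s' := by
  obtain ⟨f, s', h1, h2⟩ := h
  exact ⟨s', Cmd.run_eq_of_exec h1, h2⟩

theorem wp.mono {c : Cmd} {s : State} {Q Q' : State → Prop} (h : wp c s Q)
    (hQ : ∀ s', Q s' → Q' s') : wp c s Q' := by
  obtain ⟨f, s', h1, h2⟩ := h
  exact ⟨f, s', h1, hQ _ h2⟩

theorem wp_skip {s : State} {Q : State → Prop} (h : Q (s.tick 1)) : wp .skip s Q :=
  ⟨1, _, rfl, h⟩

theorem wp_set {r e} {s : State} {Q : State → Prop}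
    (h : Q ((s.setReg r (e.eval s.reg)).tick (1 + e.cost))) : wp (.set r e) s Q :=
  ⟨1, _, rfl, h⟩

theorem wp_load {r a} {s : State} {Q : State → Prop}
    (h : Q ((s.load r (a.addr s.reg)).tick (1 + a.cost))) : wp (.load r a) s Q :=
  ⟨1, _, rfl, h⟩

theorem wp_store {a e} {s : State} {Q : State → Prop}
    (h : Q ((s.store (a.addr s.reg) (e.eval s.reg)).tick (1 + a.cost + e.cost))) :
    wp (.store a e) s Q :=
  ⟨1, _, rfl, h⟩

theorem wp_rand {r} {s : State} {Q : State → Prop}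
    (h : Q ((s.rand r).tick 1)) : wp (.rand r) s Q :=
  ⟨1, _, rfl, h⟩

theorem wp_emit {es : List Expr} {s : State} {Q : State → Prop}
    (h : Q ((s.emit (es.map fun e => e.eval s.reg)).tick (1 + (es.map Expr.cost).sum))) :
    wp (.emit es) s Q :=
  ⟨1, _, rfl, h⟩

theorem wp_seq {c₁ c₂ : Cmd} {s : State} {Q : State → Prop}
    (h : wp c₁ s fun s' => wp c₂ s' Q) : wp (.seq c₁ c₂) s Q := by
  obtain ⟨f, t, h1, g, u, h2, hQ⟩ := h
  refine ⟨max f g + 1, u, ?_, hQ⟩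
  simp only [Cmd.exec, Option.bind_eq_some_iff]
  exact ⟨t, Cmd.exec_mono (le_max_left _ _) h1, Cmd.exec_mono (le_max_right _ _) h2⟩

theorem wp_ite {b : Test} {c₁ c₂ : Cmd} {s : State} {Q : State → Prop}
    (h₁ : b.holds s.reg → wp c₁ (s.tick b.cost) Q)
    (h₂ : ¬ b.holds s.reg → wp c₂ (s.tick b.cost) Q) : wp (.ite b c₁ c₂) s Q := by
  by_cases hb : b.holds s.reg
  · obtain ⟨f, t, h, hQ⟩ := h₁ hb
    exact ⟨f + 1, t, by rw [Cmd.exec, if_pos hb, h], hQ⟩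
  · obtain ⟨f, t, h, hQ⟩ := h₂ hb
    exact ⟨f + 1, t, by rw [Cmd.exec, if_neg hb, h], hQ⟩

theorem wp_while {b : Test} {c : Cmd} {s : State} {Q : State → Prop}
    (h₁ : b.holds s.reg → wp c (s.tick b.cost) fun s' => wp (.while b c) s' Q)
    (h₂ : ¬ b.holds s.reg → Q (s.tick b.cost)) : wp (.while b c) s Q := by
  by_cases hb : b.holds s.reg
  · obtain ⟨f, t, h, g, u, h2, hQ⟩ := h₁ hb
    refine ⟨max f g + 1, u, ?_, hQ⟩
    rw [Cmd.exec, if_pos hb]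
    simp only [Option.bind_eq_some_iff]
    exact ⟨t, Cmd.exec_mono (le_max_left _ _) h, Cmd.exec_mono (le_max_right _ _) h2⟩
  · exact ⟨1, _, by rw [Cmd.exec, if_neg hb], h₂ hb⟩

/-! ### Notation for expressions -/

instance : Add Expr := ⟨.bin .add⟩
instance : Sub Expr := ⟨.bin .sub⟩
instance : Mul Expr := ⟨.bin .mul⟩
instance : Div Expr := ⟨.bin .div⟩

@[simp] theorem Expr.eval_const (ρ : ℕ → ℝ) (c : ℤ) : (Expr.const c).eval ρ = c := rfl
@[simp] theorem Expr.eval_reg (ρ : ℕ → ℝ) (r : ℕ) : (Expr.reg r).eval ρ = ρ r := rfl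
@[simp] theorem Expr.eval_floor (ρ : ℕ → ℝ) (e : Expr) :
    (Expr.un .floor e).eval ρ = (⌊e.eval ρ⌋ : ℝ) := rfl
@[simp] theorem Expr.eval_log (ρ : ℕ → ℝ) (e : Expr) :
    (Expr.un .log e).eval ρ = Real.log (e.eval ρ) := rfl
@[simp] theorem Expr.eval_exp (ρ : ℕ → ℝ) (e : Expr) :
    (Expr.un .exp e).eval ρ = Real.exp (e.eval ρ) := rfl
@[simp] theorem Expr.eval_add (ρ : ℕ → ℝ) (a b : Expr) :
    (a + b).eval ρ = a.eval ρ + b.eval ρ := rfl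
@[simp] theorem Expr.eval_sub (ρ : ℕ → ℝ) (a b : Expr) :
    (a - b).eval ρ = a.eval ρ - b.eval ρ := rfl
@[simp] theorem Expr.eval_mul (ρ : ℕ → ℝ) (a b : Expr) :
    (a * b).eval ρ = a.eval ρ * b.eval ρ := rfl
@[simp] theorem Expr.eval_div (ρ : ℕ → ℝ) (a b : Expr) :
    (a / b).eval ρ = a.eval ρ / b.eval ρ := rfl
@[simp] theorem Expr.cost_const (c : ℤ) : (Expr.const c).cost = 1 := rfl
@[simp] theorem Expr.cost_reg (r : ℕ) : (Expr.reg r).cost = 1 := rfl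
@[simp] theorem Expr.cost_un (o : UnOp) (a : Expr) : (Expr.un o a).cost = 1 + a.cost := rfl
@[simp] theorem Expr.cost_add (a b : Expr) : (a + b).cost = 1 + a.cost + b.cost := rfl
@[simp] theorem Expr.cost_sub (a b : Expr) : (a - b).cost = 1 + a.cost + b.cost := rfl
@[simp] theorem Expr.cost_mul (a b : Expr) : (a * b).cost = 1 + a.cost + b.cost := rfl
@[simp] theorem Expr.cost_div (a b : Expr) : (a / b).cost = 1 + a.cost + b.cost := rfl
@[simp] theorem Test.holds_le (ρ : ℕ → ℝ) (a b : Expr) :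
    (Test.le a b).holds ρ ↔ a.eval ρ ≤ b.eval ρ := Iff.rfl
@[simp] theorem Test.holds_not (ρ : ℕ → ℝ) (b : Test) : b.not.holds ρ ↔ ¬ b.holds ρ := Iff.rfl
@[simp] theorem Test.holds_and (ρ : ℕ → ℝ) (b c : Test) :
    (b.and c).holds ρ ↔ b.holds ρ ∧ c.holds ρ := Iff.rfl
@[simp] theorem Test.cost_le (a b : Expr) : (Test.le a b).cost = 1 + a.cost + b.cost := rfl
@[simp] theorem Test.cost_not (b : Test) : b.not.cost = 1 + b.cost := rfl
@[simp] theorem Test.cost_and (b c : Test) : (b.and c).cost = 1 + b.cost + c.cost := rfl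

theorem Expr.addr_eq {ρ : ℕ → ℝ} {e : Expr} {j : ℕ} (h : e.eval ρ = j) : e.addr ρ = j := by
  rw [Expr.addr, h, Nat.floor_natCast]

/-- The sequential composition of a list of programs. -/
def Cmd.block : List Cmd → Cmd
  | [] => .skip
  | c :: cs => .seq c (Cmd.block cs)

theorem wp_block_nil {s : State} {Q : State → Prop} (h : Q (s.tick 1)) :
    wp (.block []) s Q := wp_skip h

theorem wp_block_cons {c : Cmd} {cs : List Cmd} {s : State} {Q : State → Prop}
    (h : wp c s fun s' => wp (.block cs) s' Q) : wp (.block (c :: cs)) s Q := wp_seq h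

/-- `for r = 0, …, (register m) - 1 do c`. -/
def Cmd.for (r m : ℕ) (c : Cmd) : Cmd :=
  .seq (.set r (.const 0))
    (.while (.not (.le (.reg m) (.reg r))) (.seq c (.set r (.reg r + .const 1))))

theorem wp_for {r m : ℕ} {c : Cmd} {s : State} {Q : State → Prop} (P : ℕ → State → Prop)
    (M B : ℕ) (htick : ∀ j s t, P j s → P j (s.tick t))
    (hstart : P 0 (s.setReg r 0)) (hM : (s.setReg r 0).reg m = M)
    (hstep : ∀ j < M, ∀ s, P j s → s.reg r = j → s.reg m = M →
      wp c s fun s' => s'.reg r = j ∧ (s'.setReg r (j + 1 : ℕ)).reg m = M ∧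
        P (j + 1) (s'.setReg r (j + 1 : ℕ)) ∧ s'.time ≤ s.time + B)
    (hend : ∀ s', P M s' → s'.time ≤ s.time + M * (B + 8) + 6 → Q s') :
    wp (.for r m c) s Q := by
  have key : ∀ d j, j + d = M → ∀ u, P j u → u.reg r = j → u.reg m = M →
      u.time ≤ s.time + j * (B + 8) + 2 →
      wp (.while (.not (.le (.reg m) (.reg r))) (.seq c (.set r (.reg r + .const 1)))) u Q := by
    intro d
    induction d with
    | zero =>
      intro j hj u hP hr hm ht
      obtain rfl : j = M := by omega
      refine wp_while (fun h => absurd ?_ h) (fun _ => hend _ (htick _ _ _ hP) ?_)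
      · simp [hr, hm]
      · simp only [State.tick, Test.cost_le, Test.cost_not, Expr.cost_reg]; omega
    | succ d ih =>
      intro j hj u hP hr hm ht
      refine wp_while (fun _ => wp_seq ?_) (fun h => absurd ?_ h)
      · refine (hstep j (by omega) _ (htick _ _ _ hP) hr hm).mono fun s' hs' => wp_set ?_
        obtain ⟨h1, h2, h3, h4⟩ := hs'
        have he : (Expr.reg r + Expr.const 1).eval s'.reg = ((j + 1 : ℕ) : ℝ) := by
          simp [h1]
        rw [he]
        refine ih (j + 1) (by omega) _ (htick _ _ _ h3) ?_ h2 ?_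
        · simp [State.tick, State.setReg]
        · simp only [State.tick, State.setReg, Test.cost_le, Test.cost_not, Expr.cost_add, Expr.cost_reg, Expr.cost_const] at h4 ⊢
          have : (j + 1) * (B + 8) = j * (B + 8) + B + 8 := by ring
          omega
      · have : (j : ℝ) < M := by exact_mod_cast (by omega : j < M)
        simpa [hr, hm] using this
  refine wp_seq (wp_set (key M 0 (by omega) _ ?_ ?_ ?_ ?_))
  · simpa using htick _ _ _ hstart
  · simp [State.tick, State.setReg]
  · simpa [State.tick] using hM
  · simp [State.tick, State.setReg]

end SubsetSamplingJoin

namespace SubsetSamplingJoin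

/-! ### Join trees as orders with the running intersection property -/

theorem exists_running_intersection_list {A : Type*} :
    ∀ (m : ℕ) (V : Type) [Finite V] (G : SimpleGraph V) (sch : V → Set A), Nat.card V = m →
      G.IsTree → (∀ a, (G.induce {v | a ∈ sch v}).Preconnected) →
      ∃ l : List V, l.Nodup ∧ (∀ v, v ∈ l) ∧ ∀ (i : ℕ) (hi : i < l.length), 0 < i →
        ∃ p, ∃ hp : p < i, ∀ a ∈ sch l[i], ∀ (j : ℕ) (hj : j < i), a ∈ sch l[j] → a ∈ sch l[p] := by
  intro m
  induction m with
  | zero =>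
    intro V _ G sch hm hG
    have := hG.connected.nonempty
    exact absurd hm Nat.card_pos.ne'
  | succ m ih =>
    intro V _ G sch hm hG ha
    classical
    rcases subsingleton_or_nontrivial V with hV | hV
    · obtain ⟨v⟩ := hG.connected.nonempty
      refine ⟨[v], by simp, fun w => by simp [Subsingleton.elim w v], fun i hi h0 => ?_⟩
      simp at hi
      omega
    · have := Fintype.ofFinite V
      obtain ⟨v, hv⟩ := hG.exists_vert_degree_one_of_nontrivial
      obtain ⟨u, huv, hu⟩ := SimpleGraph.degree_eq_one_iff_existsUnique_adj.1 hv
      have hsub : ∀ w w', G.Adj v w → G.Adj v w' → w = w' := fun w w' h h' =>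
        (hu w h).trans (hu w' h').symm
      have hcard : Nat.card ({v}ᶜ : Set V) = m := by
        rw [Nat.card_eq_fintype_card, Fintype.card_compl_set, ← Nat.card_eq_fintype_card, hm]
        simp
      obtain ⟨l, hl1, hl2, hl3⟩ := ih ({v}ᶜ : Set V) (G.induce {v}ᶜ) (fun w => sch w.1) hcard
        ⟨hG.connected.induce_compl_singleton_of_degree_eq_one hv, hG.isAcyclic.induce _⟩ (by
          intro a
          have h1 : ((G.induce {w | a ∈ sch w}).induce {x | x.1 ≠ v}).Preconnected := by
            refine (ha a).induce_of_degree_eq_one ?_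
            rintro ⟨x, hx⟩ hxv ⟨y, hy⟩ h1 ⟨z, hz⟩ h2
            simp only [Set.mem_ofPred_eq, not_not] at hxv
            subst hxv
            exact Subtype.ext (hsub y z h1 h2)
          let f : ((G.induce {w | a ∈ sch w}).induce {x | x.1 ≠ v}) →g
              ((G.induce {v}ᶜ).induce {w : ({v}ᶜ : Set V) | a ∈ sch w.1}) :=
            ⟨fun x => ⟨⟨x.1.1, x.2⟩, x.1.2⟩, fun h => h⟩
          exact h1.map (f := f) fun y => ⟨⟨⟨y.1.1, y.2⟩, y.1.2⟩, rfl⟩)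
      have hlen : ∀ i (hi : i < l.length), (l.map Subtype.val ++ [v])[i]'(by simp; omega)
          = (l[i] : V) := by
        intro i hi
        rw [List.getElem_append_left (by simpa using hi), List.getElem_map]
      refine ⟨l.map Subtype.val ++ [v], ?_, ?_, ?_⟩
      · rw [List.nodup_append]
        refine ⟨hl1.map Subtype.val_injective, by simp, ?_⟩
        intro x hx y hy
        obtain ⟨w, _, rfl⟩ := List.mem_map.1 hx
        rw [List.mem_singleton.1 hy]
        exact w.2
      · intro w
        by_cases hw : w = v
        · simp [hw]
        · simp only [List.mem_append, List.mem_map]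
          exact Or.inl ⟨⟨w, hw⟩, hl2 _, rfl⟩
      · intro i hi h0
        have hi' : i ≤ l.length := by simp at hi; omega
        rcases hi'.lt_or_eq with hi' | hi'
        · obtain ⟨p, hp, h⟩ := hl3 i hi' h0
          refine ⟨p, hp, fun a hai j hj haj => ?_⟩
          rw [hlen i hi'] at hai
          rw [hlen j (by omega)] at haj
          rw [hlen p (by omega)]
          exact h a hai j hj haj
        · have huv' : u ∈ ({v}ᶜ : Set V) := fun h => G.ne_of_adj huv (Set.mem_singleton_iff.1 h).symm
          obtain ⟨p, hp, hpu⟩ := List.getElem_of_mem (hl2 ⟨u, huv'⟩)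
          refine ⟨p, by omega, fun a hai j hj haj => ?_⟩
          rw [hlen j (by omega)] at haj
          rw [hlen p hp, hpu]
          have hv' : (l.map Subtype.val ++ [v])[i] = v := by
            rw [List.getElem_append_right (by simp [hi'])]
            simp
          rw [hv'] at hai
          obtain ⟨w⟩ := (ha a) ⟨v, hai⟩ ⟨(l[j]'(by omega)).1, haj⟩
          have hne : ¬ w.Nil := by
            intro h
            have := h.eq
            exact (l[j]'(by omega)).2 (congrArg Subtype.val this).symm
          have h1 := w.adj_snd hne
          have h2 : G.Adj v w.snd.1 := h1
          have h3 : w.snd.1 = u := hsub _ _ h2 huv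
          change a ∈ sch u
          rw [← h3]
          exact w.snd.2

theorem JoinSchema.Acyclic.exists_order {n k : ℕ} {S : JoinSchema n k} (hS : S.Acyclic) :
    ∃ (σ : ℕ → Fin k) (par : ℕ → ℕ), 0 < k ∧ (∀ i < k, ∀ j < k, σ i = σ j → i = j) ∧
      (∀ r, ∃ i < k, σ i = r) ∧ (∀ i, 0 < i → i < k → par i < i) ∧
      ∀ i, 0 < i → i < k → ∀ a ∈ S.schema (σ i), ∀ j < i, a ∈ S.schema (σ j) →
        a ∈ S.schema (σ (par i)) := by
  obtain ⟨T, hT, hc⟩ := hS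
  obtain ⟨l, h1, h2, h3⟩ := exists_running_intersection_list k (Fin k) T
    (fun i => (S.schema i : Set (Fin n))) (by simp) hT (fun a => (hc a).preconnected)
  obtain ⟨r⟩ := hT.connected.nonempty
  have hlen : l.length = k := by
    have h4 : l.toFinset = Finset.univ := by ext v; simp [h2 v]
    rw [← List.toFinset_card_of_nodup h1, h4]
    simp
  choose! p hp using fun i => fun hi : i < l.length => fun h0 : 0 < i => h3 i hi h0
  have hg : ∀ i (hi : i < k), l.getD i r = l[i]'(by omega) := fun i hi => by
    rw [List.getD_eq_getElem]
  refine ⟨fun i => l.getD i r, p, r.pos, ?_, ?_, ?_, ?_⟩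
  · intro i hi j hj hij
    simp only [hg i hi, hg j hj] at hij
    exact (List.Nodup.getElem_inj_iff h1).1 hij
  · intro v
    obtain ⟨i, hi, h⟩ := List.getElem_of_mem (h2 v)
    exact ⟨i, by omega, by simp only [hg i (by omega), h]⟩
  · intro i h0 hi
    exact (hp i (by omega) h0).1
  · intro i h0 hi a ha j hj haj
    obtain ⟨hp1, hp2⟩ := hp i (by omega) h0
    simp only [hg i hi, hg j (by omega)] at ha haj
    simp only [hg (p i) (by omega)]
    exact hp2 a ha j hj haj

end SubsetSamplingJoin

namespace SubsetSamplingJoin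
open MeasureTheory
open scoped ENNReal

/-! ### The random tape -/

/-- The tape with first number `u` and further numbers `τ`. -/
def Tape.cons (u : unitInterval) (τ : Tape) : Tape
  | 0 => u
  | i + 1 => τ i

/-- The tape without its first number. -/
def Tape.tail (τ : Tape) : Tape := fun i => τ (i + 1)

theorem Tape.measurable_tail : Measurable Tape.tail :=
  measurable_pi_lambda _ fun i => measurable_pi_apply (i + 1)

theorem Tape.measurable_cons :
    Measurable fun x : unitInterval × Tape => Tape.cons x.1 x.2 := by
  refine measurable_pi_lambda _ fun i => ?_
  cases i with
  | zero => exact measurable_fst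
  | succ i => exact (measurable_pi_apply i).comp measurable_snd

theorem Tape.map_cons :
    ((volume : Measure unitInterval).prod tapeMeasure).map (fun x => Tape.cons x.1 x.2)
      = tapeMeasure := by
  refine Measure.eq_infinitePi _ fun s t ht => ?_
  have hinj : Set.InjOn Nat.succ (Nat.succ ⁻¹' (s : Set ℕ)) := Nat.succ_injective.injOn
  have hpre : (fun x : unitInterval × Tape => Tape.cons x.1 x.2) ⁻¹' Set.pi s t =
      (if 0 ∈ s then t 0 else Set.univ) ×ˢ
        Set.pi (s.preimage Nat.succ hinj : Set ℕ) (fun i => t (i + 1)) := by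
    ext ⟨u, τ⟩
    simp only [Set.mem_preimage, Set.mem_pi, Finset.mem_coe, Set.mem_prod, Finset.mem_preimage]
    constructor
    · intro h
      refine ⟨?_, fun i hi => h (i + 1) hi⟩
      split_ifs with h0
      · exact h 0 h0
      · trivial
    · rintro ⟨h0, h⟩ i hi
      cases i with
      | zero => rw [if_pos hi] at h0; exact h0
      | succ i => exact h i hi
  rw [Measure.map_apply Tape.measurable_cons
    (MeasurableSet.pi s.countable_toSet fun i _ => ht i), hpre, Measure.prod_prod, tapeMeasure,
    Measure.infinitePi_pi _ fun i _ => ht _]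
  classical
  have h1 := Finset.prod_preimage' Nat.succ s hinj (fun i => (volume : Measure unitInterval) (t i))
  rw [show (∏ i ∈ s.preimage Nat.succ hinj, (volume : Measure unitInterval) (t (i + 1))) = _
    from h1]
  have h2 : s.filter (· ∈ Set.range Nat.succ) = s.erase 0 := by
    ext i
    cases i <;> simp
  rw [h2]
  split_ifs with h0
  · rw [Finset.mul_prod_erase s (fun i => (volume : Measure unitInterval) (t i)) h0]
  · rw [Finset.erase_eq_of_notMem h0]
    simp

theorem lintegral_tape {f : Tape → ℝ≥0∞} (hf : Measurable f) :
    ∫⁻ τ, f τ ∂tapeMeasure = ∫⁻ u, ∫⁻ τ, f (Tape.cons u τ) ∂tapeMeasure := by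
  conv_lhs => rw [← Tape.map_cons]
  rw [lintegral_map hf Tape.measurable_cons, lintegral_prod (fun x => f (Tape.cons x.1 x.2))
    (hf.comp Tape.measurable_cons).aemeasurable]

theorem tapeMeasure_apply {A : Set Tape} (hA : MeasurableSet A) :
    tapeMeasure A = ∫⁻ u, tapeMeasure {τ | Tape.cons u τ ∈ A} := by
  conv_lhs => rw [← Tape.map_cons]
  rw [Measure.map_apply Tape.measurable_cons hA, Measure.prod_apply (Tape.measurable_cons hA)]
  rfl

/-! ### Truncated exponential steps -/

/-- The step length: exponentially distributed with rate `2`, but at most `1/2`. -/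
noncomputable def stepLen (u : unitInterval) : ℝ := min (-Real.log u / 2) (1 / 2)

theorem measurable_stepLen : Measurable stepLen := by
  unfold stepLen
  fun_prop

theorem stepLen_nonneg (u : unitInterval) : 0 ≤ stepLen u := by
  have := Real.log_nonpos u.2.1 u.2.2
  exact le_min (by linarith) (by norm_num)

theorem stepLen_le (u : unitInterval) : stepLen u ≤ 1 / 2 := min_le_right _ _

theorem volume_le_stepLen {a : ℝ} (h0 : 0 ≤ a) (h1 : a ≤ 1 / 2) :
    volume {u : unitInterval | a ≤ stepLen u} = ENNReal.ofReal (Real.exp (-(2 * a))) := by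
  have he : Real.exp (-(2 * a)) ≤ 1 := Real.exp_le_one_iff.2 (by linarith)
  let e : unitInterval := ⟨Real.exp (-(2 * a)), (Real.exp_pos _).le, he⟩
  have h : {u : unitInterval | a ≤ stepLen u} =ᵐ[volume] Set.Iic e := by
    have h0 : ∀ᵐ u : unitInterval, u ≠ 0 := by
      rw [ae_iff]
      simp
    filter_upwards [h0] with u hu
    have hu' : (0 : ℝ) < u := lt_of_le_of_ne u.2.1 fun h => hu (Subtype.ext h.symm)
    have : (a ≤ stepLen u) = (u ≤ e) := by
      rw [stepLen, le_min_iff, eq_iff_iff, ← Subtype.coe_le_coe, ← Real.log_le_iff_le_exp hu']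
      exact ⟨fun h => by linarith [h.1], fun h => ⟨by linarith, h1⟩⟩
    exact this
  rw [measure_congr h, unitInterval.volume_Iic]

theorem measurableSet_le_stepLen (a : ℝ) : MeasurableSet {u : unitInterval | a ≤ stepLen u} :=
  measurableSet_le measurable_const measurable_stepLen

theorem volume_le_stepLen_lt {a b : ℝ} (h0 : 0 ≤ a) (hab : a ≤ b) (h1 : b ≤ 1 / 2) :
    volume {u : unitInterval | a ≤ stepLen u ∧ stepLen u < b} =
      ENNReal.ofReal (Real.exp (-(2 * a)) - Real.exp (-(2 * b))) := by
  have : {u : unitInterval | a ≤ stepLen u ∧ stepLen u < b} =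
      {u | a ≤ stepLen u} \ {u | b ≤ stepLen u} := by
    ext u
    simp
  have hsub : {u : unitInterval | b ≤ stepLen u} ⊆ {u | a ≤ stepLen u} :=
    fun u (hu : b ≤ stepLen u) => hab.trans hu
  rw [this, measure_sdiff hsub (measurableSet_le_stepLen b).nullMeasurableSet
    (measure_ne_top _ _), volume_le_stepLen h0 (hab.trans h1), volume_le_stepLen (h0.trans hab) h1,
    ENNReal.ofReal_sub _ (Real.exp_pos _).le]

/-! ### The sampling process on a list of weighted elements -/

section Sampling

variable {α : Type*} (p : α → ℝ)

/-- The probability to keep an element of weight `p`, at offset `a` from the last stop, when it is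
hit. -/
noncomputable def keepProb (a p : ℝ) : ℝ :=
  if a + p ≤ 1 / 2 then p / (1 - Real.exp (-(2 * p))) else p

/-- The elements that are hit by the sampling process, with a mark on those that are kept. The elements
occupy consecutive intervals as long as their weights; `a` is the offset from the last stop, `z` the
current step length. -/
noncomputable def hits : List α → ℝ → ℝ → Tape → List (α × Prop)
  | [], _, _, _ => []
  | u :: l, a, z, τ =>
    open Classical in
    if z < a + p u then
      (u, (τ 0 : ℝ) ≤ keepProb a (p u)) :: hits l 0 (stepLen (τ 1)) τ.tail.tail
    else hits l (a + p u) z τ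

open Classical in
/-- The elements kept. -/
noncomputable def kept (h : List (α × Prop)) : List α := (h.filter (·.2)).map Prod.fst

theorem kept_cons (u : α) (b : Prop) (h : List (α × Prop)) [Decidable b] :
    kept ((u, b) :: h) = if b then u :: kept h else kept h := by
  unfold kept
  by_cases hb : b <;> simp [hb]

theorem kept_hits_sublist (l : List α) : ∀ a z τ, (kept (hits p l a z τ)).Sublist l := by
  classical
  induction l with
  | nil => intro a z τ; simp [hits, kept]
  | cons u l ih =>
    intro a z τ
    rw [hits]
    split_ifs with h
    · rw [kept_cons]
      split_ifs
      · exact (ih _ _ _).cons_cons u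
      · exact (ih _ _ _).cons u
    · exact (ih _ _ _).cons u

theorem measurable_hits (l : List α) (a : ℝ) :
    Measurable[_, ⊤] fun x : ℝ × Tape => hits p l a x.1 x.2 := by
  classical
  let _ : MeasurableSpace (List (α × Prop)) := ⊤
  induction l generalizing a with
  | nil => exact measurable_const
  | cons u l ih =>
    simp only [hits]
    refine Measurable.ite (measurableSet_lt measurable_fst measurable_const) ?_ (ih _)
    have h1 : Measurable fun x : ℝ × Tape => hits p l 0 (stepLen (x.2 1)) x.2.tail.tail :=
      (ih 0).comp ((measurable_stepLen.comp ((measurable_pi_apply 1).comp measurable_snd)).prodMk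
        ((Tape.measurable_tail.comp Tape.measurable_tail).comp measurable_snd))
    have h2 : (fun x : ℝ × Tape => (u, (x.2 0 : ℝ) ≤ keepProb a (p u)) ::
          hits p l 0 (stepLen (x.2 1)) x.2.tail.tail) =
        fun x => if (x.2 0 : ℝ) ≤ keepProb a (p u)
          then (u, True) :: hits p l 0 (stepLen (x.2 1)) x.2.tail.tail
          else (u, False) :: hits p l 0 (stepLen (x.2 1)) x.2.tail.tail := by
      funext x
      split_ifs with h <;> simp [h]
    rw [h2]
    refine Measurable.ite (measurableSet_le ?_ measurable_const) ?_ ?_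
    · exact measurable_subtype_coe.comp ((measurable_pi_apply 0).comp measurable_snd)
    · exact (measurable_from_top (f := fun h => (u, True) :: h)).comp h1
    · exact (measurable_from_top (f := fun h => (u, False) :: h)).comp h1

/-- The process from the start of a list. -/
noncomputable def process (l : List α) (τ : Tape) : List (α × Prop) :=
  hits p l 0 (stepLen (τ 0)) τ.tail

theorem hits_cons_of_lt {u : α} {l : List α} {a z : ℝ} {τ : Tape} (h : z < a + p u) :
    hits p (u :: l) a z τ =
      (u, (τ 0 : ℝ) ≤ keepProb a (p u)) :: process p l τ.tail := by
  rw [hits, if_pos h]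
  rfl

theorem hits_cons_of_le {u : α} {l : List α} {a z : ℝ} {τ : Tape} (h : a + p u ≤ z) :
    hits p (u :: l) a z τ = hits p l (a + p u) z τ := by
  rw [hits, if_neg h.not_gt]

theorem measurable_process (l : List α) :
    Measurable[_, ⊤] (process p l) := by
  let _ : MeasurableSpace (List (α × Prop)) := ⊤
  exact (measurable_hits p l 0).comp
    ((measurable_stepLen.comp (measurable_pi_apply 0)).prodMk Tape.measurable_tail)

theorem measurableSet_process (l : List α) (P : List (α × Prop) → Prop) :
    MeasurableSet {τ | P (process p l τ)} :=
  measurable_process p l (t := {h | P h}) trivial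

end Sampling

end SubsetSamplingJoin

namespace SubsetSamplingJoin
open MeasureTheory
open scoped ENNReal

section Sampling

variable {α : Type*} (p : α → ℝ)

theorem tapeMeasure_process (l : List α) (P : List (α × Prop) → Prop) :
    tapeMeasure {τ | P (process p l τ)} =
      ∫⁻ u, {u : unitInterval | 0 ≤ stepLen u}.indicator
        (fun u => tapeMeasure {τ | P (hits p l 0 (stepLen u) τ)}) u := by
  rw [tapeMeasure_apply (measurableSet_process p l P)]
  refine lintegral_congr fun u => ?_
  rw [Set.indicator_of_mem (show u ∈ {u : unitInterval | 0 ≤ stepLen u} from stepLen_nonneg u)]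
  rfl

theorem lintegral_process (l : List α) (f : List (α × Prop) → ℝ≥0∞) :
    ∫⁻ τ, f (process p l τ) ∂tapeMeasure =
      ∫⁻ u, {u : unitInterval | 0 ≤ stepLen u}.indicator
        (fun u => ∫⁻ τ, f (hits p l 0 (stepLen u) τ) ∂tapeMeasure) u := by
  let _ : MeasurableSpace (List (α × Prop)) := ⊤
  rw [lintegral_tape (f := fun τ => f (process p l τ))
    ((measurable_from_top (f := f)).comp (measurable_process p l))]
  refine lintegral_congr fun u => ?_
  rw [Set.indicator_of_mem (show u ∈ {u : unitInterval | 0 ≤ stepLen u} from stepLen_nonneg u)]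
  rfl

theorem keepProb_of_le {a p : ℝ} (h : a + p ≤ 1 / 2) :
    keepProb a p = p / (1 - Real.exp (-(2 * p))) := if_pos h

theorem keepProb_of_gt {a p : ℝ} (h : 1 / 2 < a + p) : keepProb a p = p := if_neg h.not_ge

theorem le_one_sub_exp {p : ℝ} (h0 : 0 ≤ p) (h1 : p ≤ 1 / 2) : p ≤ 1 - Real.exp (-(2 * p)) := by
  have h2 := Real.add_one_le_exp (2 * p)
  have h3 : Real.exp (-(2 * p)) * Real.exp (2 * p) = 1 := by rw [← Real.exp_add]; simp
  have h4 := Real.exp_pos (-(2 * p))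
  nlinarith [mul_nonneg h0 (by linarith : (0 : ℝ) ≤ 1 - 2 * p),
    mul_le_mul_of_nonneg_left h2 h4.le]

theorem keepProb_mul {a p : ℝ} (h0 : 0 ≤ p) (ha : 0 ≤ a) (h : a + p ≤ 1 / 2) :
    keepProb a p * (1 - Real.exp (-(2 * p))) = p := by
  rw [keepProb_of_le h]
  rcases h0.eq_or_lt with rfl | hp
  · simp
  · have := le_one_sub_exp h0 (by linarith)
    exact div_mul_cancel₀ _ (by linarith)

theorem keepProb_mem {a p : ℝ} (h0 : 0 ≤ p) (h1 : p ≤ 1) (ha : 0 ≤ a) :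
    keepProb a p ∈ Set.Icc (0 : ℝ) 1 := by
  by_cases h : a + p ≤ 1 / 2
  · have := le_one_sub_exp h0 (by linarith)
    rw [keepProb_of_le h]
    exact ⟨div_nonneg h0 (by linarith), div_le_one_of_le₀ this (by linarith)⟩
  · rw [keepProb_of_gt (not_le.1 h)]
    exact ⟨h0, h1⟩

open Classical in
theorem tapeMeasure_hit {u : α} {l : List α} {t : ℝ} {Y : α → Prop} (ht : t ∈ Set.Icc (0 : ℝ) 1)
    (hu : u ∉ l) :
    tapeMeasure {τ | kept ((u, (τ 0 : ℝ) ≤ t) :: process p l τ.tail) = (u :: l).filter Y} =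
      ENNReal.ofReal (if Y u then t else 1 - t) *
        tapeMeasure {τ | kept (process p l τ) = l.filter Y} := by
  have hmeas : MeasurableSet
      {τ : Tape | kept ((u, (τ 0 : ℝ) ≤ t) :: process p l τ.tail) = (u :: l).filter Y} := by
    have : {τ : Tape | kept ((u, (τ 0 : ℝ) ≤ t) :: process p l τ.tail) = (u :: l).filter Y} =
        {τ : Tape | (τ 0 : ℝ) ≤ t}.ite
          {τ | u :: kept (process p l τ.tail) = (u :: l).filter Y}
          {τ | kept (process p l τ.tail) = (u :: l).filter Y} := by
      ext τ
      by_cases h : (τ 0 : ℝ) ≤ t <;> simp [Set.ite, kept_cons, h]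
    rw [this]
    refine MeasurableSet.ite ?_ ?_ ?_
    · exact measurableSet_le (measurable_subtype_coe.comp (measurable_pi_apply 0)) measurable_const
    · exact (measurableSet_process p l fun h => u :: kept h = (u :: l).filter Y).preimage
        Tape.measurable_tail
    · exact (measurableSet_process p l fun h => kept h = (u :: l).filter Y).preimage
        Tape.measurable_tail
  rw [tapeMeasure_apply hmeas]
  have hV : ∀ V : unitInterval, tapeMeasure {τ | Tape.cons V τ ∈
      {τ : Tape | kept ((u, (τ 0 : ℝ) ≤ t) :: process p l τ.tail) = (u :: l).filter Y}} =
      {V : unitInterval | (V : ℝ) ≤ t ↔ Y u}.indicator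
        (fun _ => tapeMeasure {τ | kept (process p l τ) = l.filter Y}) V := by
    intro V
    have h1 : {τ | Tape.cons V τ ∈
        {τ : Tape | kept ((u, (τ 0 : ℝ) ≤ t) :: process p l τ.tail) = (u :: l).filter Y}} =
        {τ | kept ((u, (V : ℝ) ≤ t) :: process p l τ) = (u :: l).filter Y} := rfl
    rw [h1]
    have hne : ∀ τ, kept (process p l τ) ≠ u :: l.filter Y := by
      intro τ h
      have := (kept_hits_sublist p l 0 (stepLen (τ 0)) τ.tail).subset
      exact hu (this (by rw [show kept (hits p l 0 (stepLen (τ 0)) τ.tail) = _ from h]; simp))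
    have hne' : ∀ τ, u :: kept (process p l τ) ≠ l.filter Y := by
      intro τ h
      exact hu (List.mem_of_mem_filter (by rw [← h]; simp : u ∈ l.filter Y))
    by_cases h2 : (V : ℝ) ≤ t <;> by_cases h3 : Y u
    · rw [Set.indicator_of_mem (show V ∈ {V : unitInterval | (V : ℝ) ≤ t ↔ Y u} by simp [h2, h3])]
      simp [kept_cons, h2, h3]
    · rw [Set.indicator_of_notMem
        (show V ∉ {V : unitInterval | (V : ℝ) ≤ t ↔ Y u} by simp [h2, h3])]
      simp [kept_cons, h2, h3, hne']
    · rw [Set.indicator_of_notMem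
        (show V ∉ {V : unitInterval | (V : ℝ) ≤ t ↔ Y u} by simp [h2, h3])]
      simp [kept_cons, h2, h3, hne]
    · rw [Set.indicator_of_mem (show V ∈ {V : unitInterval | (V : ℝ) ≤ t ↔ Y u} from
        iff_of_false h2 h3)]
      simp [kept_cons, h2, h3]
  rw [lintegral_congr hV]
  have hm : MeasurableSet {V : unitInterval | (V : ℝ) ≤ t ↔ Y u} := by
    by_cases h3 : Y u
    · simpa [h3] using measurableSet_le measurable_subtype_coe measurable_const
    · simpa [h3] using measurableSet_lt measurable_const measurable_subtype_coe
  rw [lintegral_indicator_const hm, mul_comm]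
  congr 1
  by_cases h3 : Y u
  · rw [if_pos h3]
    have : {V : unitInterval | (V : ℝ) ≤ t ↔ Y u} = Set.Iic ⟨t, ht⟩ := by
      ext V
      simp [h3, ← Subtype.coe_le_coe]
    rw [this, unitInterval.volume_Iic]
  · rw [if_neg h3]
    have : {V : unitInterval | (V : ℝ) ≤ t ↔ Y u} = Set.Ioi ⟨t, ht⟩ := by
      ext V
      simp [h3, ← Subtype.coe_lt_coe]
    rw [this, unitInterval.volume_Ioi]

/-- Splitting the integral over the step lengths `≥ a` at `a + q`. -/
theorem lintegral_step_light {a q : ℝ} (ha : 0 ≤ a) (hq : 0 ≤ q) (h : a + q ≤ 1 / 2)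
    {f g : unitInterval → ℝ≥0∞} {c : ℝ≥0∞} (hc : ∀ u, stepLen u < a + q → f u = c)
    (hg : ∀ u, a + q ≤ stepLen u → f u = g u) :
    ∫⁻ u, {u : unitInterval | a ≤ stepLen u}.indicator f u =
      ENNReal.ofReal (Real.exp (-(2 * a)) - Real.exp (-(2 * (a + q)))) * c +
        ∫⁻ u, {u : unitInterval | a + q ≤ stepLen u}.indicator g u := by
  have hm : MeasurableSet {u : unitInterval | a ≤ stepLen u ∧ stepLen u < a + q} :=
    (measurableSet_le_stepLen a).inter (measurableSet_lt measurable_stepLen measurable_const)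
  rw [← volume_le_stepLen_lt ha (by linarith) h, mul_comm, ← lintegral_indicator_const hm,
    ← lintegral_add_left (measurable_const.indicator hm)]
  refine lintegral_congr fun u => ?_
  by_cases h1 : a + q ≤ stepLen u
  · rw [Set.indicator_of_mem (show u ∈ {u : unitInterval | a ≤ stepLen u} by
        change a ≤ stepLen u; linarith),
      Set.indicator_of_notMem (fun h2 => absurd h2.2 h1.not_gt),
      Set.indicator_of_mem (show u ∈ {u : unitInterval | a + q ≤ stepLen u} from h1), hg u h1,
      zero_add]
  · rw [Set.indicator_of_notMem (fun h2 => h1 h2 : u ∉ {u : unitInterval | a + q ≤ stepLen u}),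
      add_zero]
    by_cases h2 : a ≤ stepLen u
    · rw [Set.indicator_of_mem (show u ∈ {u : unitInterval | a ≤ stepLen u} from h2),
        Set.indicator_of_mem (show u ∈ {u : unitInterval | a ≤ stepLen u ∧ stepLen u < a + q} from
          ⟨h2, not_le.1 h1⟩), hc u (not_le.1 h1)]
    · rw [Set.indicator_of_notMem (fun h3 => h2 h3 : u ∉ {u : unitInterval | a ≤ stepLen u}),
        Set.indicator_of_notMem fun h3 => h2 h3.1]

theorem lintegral_step_const {a : ℝ} (ha : 0 ≤ a) (h : a ≤ 1 / 2)
    {f : unitInterval → ℝ≥0∞} {c : ℝ≥0∞} (hc : ∀ u, f u = c) :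
    ∫⁻ u, {u : unitInterval | a ≤ stepLen u}.indicator f u =
      ENNReal.ofReal (Real.exp (-(2 * a))) * c := by
  rw [funext hc, lintegral_indicator_const (measurableSet_le_stepLen a), volume_le_stepLen ha h,
    mul_comm]

open Classical in
theorem lintegral_hits_law (Y : α → Prop) (l : List α) (hl : l.Nodup)
    (hp : ∀ u ∈ l, p u ∈ Set.Icc (0 : ℝ) 1) : ∀ a, 0 ≤ a → a ≤ 1 / 2 →
    ∫⁻ u, {u : unitInterval | a ≤ stepLen u}.indicator
      (fun u => tapeMeasure {τ | kept (hits p l a (stepLen u) τ) = l.filter Y}) u =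
    ENNReal.ofReal (Real.exp (-(2 * a)) * (l.map fun u => if Y u then p u else 1 - p u).prod) := by
  induction l with
  | nil =>
    intro a ha h
    rw [lintegral_step_const ha h (c := 1)]
    · simp
    · intro u
      simp [hits, kept]
  | cons u l ih =>
    intro a ha h
    obtain ⟨hul, hl⟩ := List.nodup_cons.1 hl
    have hp' : ∀ v ∈ l, p v ∈ Set.Icc (0 : ℝ) 1 := fun v hv => hp v (List.mem_cons_of_mem _ hv)
    obtain ⟨hp0, hp1⟩ := hp u List.mem_cons_self
    specialize ih hl hp'
    set π : ℝ := (l.map fun u => if Y u then p u else 1 - p u).prod with hπ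
    have hπ0 : 0 ≤ π := by
      refine List.prod_nonneg fun x hx => ?_
      obtain ⟨v, hv, rfl⟩ := List.mem_map.1 hx
      obtain ⟨h0, h1⟩ := hp' v hv
      split_ifs <;> linarith
    have hstart : tapeMeasure {τ | kept (process p l τ) = l.filter Y} = ENNReal.ofReal π := by
      rw [tapeMeasure_process p l (fun h => kept h = l.filter Y), ih 0 le_rfl (by norm_num)]
      simp
    have hk := keepProb_mem hp0 hp1 ha
    have hhit := tapeMeasure_hit (p := p) (Y := Y) hk hul
    rw [hstart] at hhit
    rw [List.map_cons, List.prod_cons, ← hπ]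
    rcases le_or_gt (a + p u) (1 / 2) with hap | hap
    · rw [lintegral_step_light ha hp0 hap (c := ENNReal.ofReal (if Y u then keepProb a (p u)
        else 1 - keepProb a (p u)) * ENNReal.ofReal π)
        (g := fun v => if Y u then 0 else
          tapeMeasure {τ | kept (hits p l (a + p u) (stepLen v) τ) = l.filter Y})]
      · have hexp : Real.exp (-(2 * (a + p u))) = Real.exp (-(2 * a)) * Real.exp (-(2 * p u)) := by
          rw [← Real.exp_add]; ring_nf
        have hmul := keepProb_mul hp0 ha hap
        have h1 := le_one_sub_exp hp0 (by linarith)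
        have he := Real.exp_pos (-(2 * a))
        have hsub : 0 ≤ Real.exp (-(2 * a)) - Real.exp (-(2 * (a + p u))) := by
          rw [hexp]; nlinarith
        by_cases hY : Y u
        · simp only [hY, if_true]
          rw [← ENNReal.ofReal_mul hk.1, ← ENNReal.ofReal_mul hsub]
          simp only [Set.indicator_zero, lintegral_zero, add_zero]
          congr 1
          rw [hexp]
          linear_combination (Real.exp (-(2 * a)) * π) * hmul
        · simp only [hY, if_false]
          rw [ih _ (by linarith) hap, ← ENNReal.ofReal_mul (by linarith [hk.2]),
            ← ENNReal.ofReal_mul hsub, ← ENNReal.ofReal_add]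
          · congr 1
            rw [hexp]
            linear_combination -(Real.exp (-(2 * a)) * π) * hmul
          · exact mul_nonneg hsub (mul_nonneg (by linarith [hk.2]) hπ0)
          · exact mul_nonneg (Real.exp_pos _).le hπ0
      · intro v hv
        rw [← hhit]
        simp only [hits_cons_of_lt p hv]
      · intro v hv
        simp only [hits_cons_of_le p hv]
        by_cases hY : Y u
        · simp only [hY, if_true]
          have : {τ | kept (hits p l (a + p u) (stepLen v) τ) = (u :: l).filter Y} = ∅ := by
            refine Set.eq_empty_of_forall_notMem fun τ (hτ : _ = _) => hul ?_
            refine (kept_hits_sublist p l (a + p u) (stepLen v) τ).subset ?_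
            rw [hτ]
            simp [hY]
          rw [this, measure_empty]
        · simp only [hY, if_false]
          simp [hY]
    · rw [lintegral_step_const ha h (c := ENNReal.ofReal (if Y u then keepProb a (p u)
        else 1 - keepProb a (p u)) * ENNReal.ofReal π)]
      · rw [keepProb_of_gt hap] at *
        rw [← ENNReal.ofReal_mul (by split_ifs <;> linarith),
          ← ENNReal.ofReal_mul (Real.exp_pos _).le]
      · intro v
        rw [← hhit]
        simp only [hits_cons_of_lt p (lt_of_le_of_lt (stepLen_le v) hap)]

open Classical in
/-- The process keeps each element independently with the probability given by its weight. -/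
theorem tapeMeasure_process_kept (Y : α → Prop) (l : List α) (hl : l.Nodup)
    (hp : ∀ u ∈ l, p u ∈ Set.Icc (0 : ℝ) 1) :
    tapeMeasure {τ | kept (process p l τ) = l.filter Y} =
      ENNReal.ofReal (l.map fun u => if Y u then p u else 1 - p u).prod := by
  rw [tapeMeasure_process p l (fun h => kept h = l.filter Y),
    lintegral_hits_law p Y l hl hp 0 le_rfl (by norm_num)]
  simp

theorem lintegral_hits_length_le (l : List α) (hp : ∀ u ∈ l, p u ∈ Set.Icc (0 : ℝ) 1) :
    ∀ a, 0 ≤ a → a ≤ 1 / 2 →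
    ∫⁻ u, {u : unitInterval | a ≤ stepLen u}.indicator
      (fun u => ∫⁻ τ, ((hits p l a (stepLen u) τ).length : ℝ≥0∞) ∂tapeMeasure) u ≤
    ENNReal.ofReal (Real.exp (-(2 * a)) * (4 * (l.map p).sum + 2 * a)) := by
  induction l with
  | nil => intro a _ _; simp [hits]
  | cons u l ih =>
    intro a ha h
    have hp' : ∀ v ∈ l, p v ∈ Set.Icc (0 : ℝ) 1 := fun v hv => hp v (List.mem_cons_of_mem _ hv)
    obtain ⟨hp0, hp1⟩ := hp u List.mem_cons_self
    specialize ih hp'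
    rw [List.map_cons, List.sum_cons]
    set σ : ℝ := (l.map p).sum with hσ
    have hσ0 : 0 ≤ σ := by
      refine List.sum_nonneg fun x hx => ?_
      obtain ⟨v, hv, rfl⟩ := List.mem_map.1 hx
      exact (hp' v hv).1
    have hhit : ∀ z, z < a + p u →
        ∫⁻ τ, ((hits p (u :: l) a z τ).length : ℝ≥0∞) ∂tapeMeasure =
          ∫⁻ τ, ((process p l τ).length : ℝ≥0∞) ∂tapeMeasure + 1 := by
      intro z hz
      let _ : MeasurableSpace (List (α × Prop)) := ⊤
      have hm : Measurable fun τ => ((process p l τ).length : ℝ≥0∞) :=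
        (measurable_from_top (f := fun h : List (α × Prop) => (h.length : ℝ≥0∞))).comp
          (measurable_process p l)
      simp only [hits_cons_of_lt p hz, List.length_cons, Nat.cast_add, Nat.cast_one]
      rw [lintegral_add_right _ measurable_const,
        lintegral_tape (f := fun τ => ((process p l τ.tail).length : ℝ≥0∞))
          (hm.comp Tape.measurable_tail)]
      simp only [lintegral_const, measure_univ, mul_one]
      simp only [show ∀ u τ, (Tape.cons u τ).tail = τ from fun _ _ => rfl]
      simp
    have hstart : ∫⁻ τ, ((process p l τ).length : ℝ≥0∞) ∂tapeMeasure + 1 ≤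
        ENNReal.ofReal (4 * σ + 1) := by
      rw [lintegral_process p l (fun h => (h.length : ℝ≥0∞)),
        ENNReal.ofReal_add (by linarith) zero_le_one, ENNReal.ofReal_one]
      gcongr
      simpa using ih 0 le_rfl (by norm_num)
    have he := Real.exp_pos (-(2 * a))
    rcases le_or_gt (a + p u) (1 / 2) with hap | hap
    · rw [lintegral_step_light ha hp0 hap (fun v hv => hhit _ hv)
        (g := fun v => ∫⁻ τ, ((hits p l (a + p u) (stepLen v) τ).length : ℝ≥0∞) ∂tapeMeasure)
        (fun v hv => by simp only [hits_cons_of_le p hv])]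
      have hexp : Real.exp (-(2 * (a + p u))) = Real.exp (-(2 * a)) * Real.exp (-(2 * p u)) := by
        rw [← Real.exp_add]; ring_nf
      have h1 := le_one_sub_exp hp0 (by linarith)
      have hsub : 0 ≤ Real.exp (-(2 * a)) - Real.exp (-(2 * (a + p u))) := by
        rw [hexp]; nlinarith
      refine (add_le_add (mul_le_mul_right hstart _) (ih _ (by linarith) hap)).trans ?_
      rw [← ENNReal.ofReal_mul hsub, ← ENNReal.ofReal_add
        (mul_nonneg hsub (by linarith)) (mul_nonneg (Real.exp_pos _).le (by linarith))]
      refine ENNReal.ofReal_le_ofReal ?_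
      rw [hexp]
      have h2 := Real.add_one_le_exp (-(2 * p u))
      have h3 := Real.exp_pos (-(2 * p u))
      have : Real.exp (-(2 * a)) * (4 * (p u + σ) + 2 * a) -
          ((Real.exp (-(2 * a)) - Real.exp (-(2 * a)) * Real.exp (-(2 * p u))) * (4 * σ + 1) +
          Real.exp (-(2 * a)) * Real.exp (-(2 * p u)) * (4 * σ + 2 * (a + p u))) =
          Real.exp (-(2 * a)) * (4 * p u + 2 * a - (1 - Real.exp (-(2 * p u))) -
            Real.exp (-(2 * p u)) * (2 * (a + p u))) := by ring
      have h4 : 0 ≤ 4 * p u + 2 * a - (1 - Real.exp (-(2 * p u))) -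
            Real.exp (-(2 * p u)) * (2 * (a + p u)) := by
        have h5 : Real.exp (-(2 * p u)) ≤ 1 := by linarith
        nlinarith [mul_nonneg (by linarith : (0:ℝ) ≤ 1 - Real.exp (-(2 * p u)))
          (by linarith : 0 ≤ 2 * (a + p u))]
      nlinarith [mul_nonneg he.le h4]
    · rw [lintegral_step_const ha h
        (fun v => hhit _ (lt_of_le_of_lt (stepLen_le v) hap))]
      refine (mul_le_mul_right hstart _).trans ?_
      rw [← ENNReal.ofReal_mul he.le]
      refine ENNReal.ofReal_le_ofReal (mul_le_mul_of_nonneg_left ?_ he.le)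
      linarith

/-- The expected number of hits is at most four times the total weight. -/
theorem lintegral_process_length_le (l : List α) (hp : ∀ u ∈ l, p u ∈ Set.Icc (0 : ℝ) 1) :
    ∫⁻ τ, ((process p l τ).length : ℝ≥0∞) ∂tapeMeasure ≤ ENNReal.ofReal (4 * (l.map p).sum) := by
  rw [lintegral_process p l (fun h => (h.length : ℝ≥0∞))]
  simpa using lintegral_hits_length_le p l hp 0 le_rfl (by norm_num)

end Sampling

end SubsetSamplingJoin

namespace SubsetSamplingJoin

/-! ### Join plans, their data, and the index -/

/-- The schemas in an order with the running intersection property, with the positions of their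
attributes in the rows of the input. -/
structure Plan (n k : ℕ) where
  sch : ℕ → Finset (Fin n)
  par : ℕ → ℕ
  src : ℕ → ℕ
  col : ℕ → Fin n → ℕ
  src_lt : ∀ i < k, src i < k
  col_lt : ∀ i, ∀ a ∈ sch i, col i a < (sch i).card
  par_lt : ∀ i, 0 < i → i < k → par i < i
  rip : ∀ i, 0 < i → i < k → ∀ a ∈ sch i, ∀ j < i, a ∈ sch j → a ∈ sch (par i)
  cover : ∀ a, ∃ i < k, a ∈ sch i

variable {n k : ℕ}

namespace Plan

variable (P : Plan n k)

/-- The number of cells of a row. -/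
def width (i : ℕ) : ℕ := (P.sch i).card + 1

open Classical in
/-- The attributes of earlier stages. -/
noncomputable def bound (i : ℕ) : Finset (Fin n) := {a | ∃ j < i, a ∈ P.sch j}

open Classical in
/-- The attributes that a stage shares with earlier stages. -/
noncomputable def key (i : ℕ) : List (Fin n) := (P.sch i ∩ P.bound i).toList

/-- The children of a stage in the join tree. -/
def ch (i : ℕ) : Finset ℕ := (Finset.range k).filter fun c => 0 < c ∧ P.par c = i

/-- The roots of the part of the join tree that consists of the stages from `i` on. -/
def pend (i : ℕ) : Finset ℕ := (Finset.range k).filter fun c => i ≤ c ∧ (c = 0 ∨ P.par c < i)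

variable {P}

theorem mem_key {i : ℕ} {a : Fin n} : a ∈ P.key i ↔ a ∈ P.sch i ∧ ∃ j < i, a ∈ P.sch j := by
  simp [key, bound]

theorem mem_ch {i c : ℕ} : c ∈ P.ch i ↔ c < k ∧ 0 < c ∧ P.par c = i := by
  simp [ch]

theorem lt_of_mem_ch {i c : ℕ} (h : c ∈ P.ch i) : i < c := by
  obtain ⟨h1, h2, rfl⟩ := mem_ch.1 h
  exact P.par_lt c h2 h1

theorem mem_pend {i c : ℕ} : c ∈ P.pend i ↔ c < k ∧ i ≤ c ∧ (c = 0 ∨ P.par c < i) := by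
  simp [pend]

theorem self_mem_pend {i : ℕ} (hi : i < k) : i ∈ P.pend i := by
  refine mem_pend.2 ⟨hi, le_rfl, ?_⟩
  rcases Nat.eq_zero_or_pos i with h | h
  · exact Or.inl h
  · exact Or.inr (P.par_lt i h hi)

theorem key_subset {c : ℕ} (hc : c < k) (h0 : 0 < c) {a : Fin n} (ha : a ∈ P.key c) :
    a ∈ P.sch (P.par c) := by
  obtain ⟨h1, j, h2, h3⟩ := mem_key.1 ha
  exact P.rip c h0 hc a h1 j h2 h3

theorem pend_succ {i : ℕ} : P.pend (i + 1) = (P.pend i).erase i ∪ P.ch i := by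
  ext c
  simp only [mem_pend, Finset.mem_union, Finset.mem_erase, mem_ch]
  constructor
  · rintro ⟨h1, h2, h3⟩
    rcases h3 with h3 | h3
    · omega
    · by_cases h4 : P.par c = i
      · exact Or.inr ⟨h1, by omega, h4⟩
      · exact Or.inl ⟨by omega, h1, by omega, Or.inr (by omega)⟩
  · rintro (⟨h1, h2, h3, h4⟩ | ⟨h1, h2, h3⟩)
    · exact ⟨h2, by omega, by omega⟩
    · have := P.par_lt c h2 h1
      exact ⟨h1, by omega, by omega⟩

theorem disjoint_pend_ch {i : ℕ} : Disjoint ((P.pend i).erase i) (P.ch i) := by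
  rw [Finset.disjoint_left]
  intro c h1 h2
  simp only [mem_pend, Finset.mem_erase, mem_ch] at h1 h2
  omega

end Plan

/-- The rows of the relations of a plan and their weights, and the layout of the input. -/
structure Data (P : Plan n k) where
  m : ℕ → ℕ
  val : ℕ → ℕ → Fin n → ℝ
  wt : ℕ → (Fin n → ℝ) → ℝ
  base : ℕ
  off : ℕ → ℕ
  inp : ℕ → ℝ
  wt_congr : ∀ i u v, (∀ a ∈ P.sch i, u a = v a) → wt i u = wt i v
  wt_mem : ∀ i < k, ∀ t < m i, wt i (val i t) ∈ Set.Icc (0 : ℝ) 1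
  val_inj : ∀ i < k, ∀ t < m i, ∀ t' < m i, (∀ a ∈ P.sch i, val i t a = val i t' a) → t = t'
  le_base : k ≤ base
  off_le : ∀ i < k, off i + m i * P.width i ≤ base
  inp_size : ∀ i < k, inp (P.src i) = m i
  inp_val : ∀ i < k, ∀ t < m i, ∀ a ∈ P.sch i, inp (off i + t * P.width i + P.col i a) = val i t a
  inp_wt : ∀ i < k, ∀ t < m i, inp (off i + t * P.width i + (P.sch i).card) = wt i (val i t)

/-- The arrays of the index: for each stage, the order of the rows and the prefix sums. -/
structure Index where
  perm : ℕ → ℕ → ℕ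
  pre : ℕ → ℕ → ℝ

theorem lt_card_filter_range_iff {p : ℕ → Prop} [DecidablePred p] :
    ∀ {m : ℕ}, (∀ q q', q ≤ q' → q' < m → p q' → p q) → ∀ q < m,
      (q < ((Finset.range m).filter p).card ↔ p q) := by
  intro m
  induction m with
  | zero => intro _ q hq; omega
  | succ m ih =>
    intro hp q hq
    by_cases hm : p m
    · have : (Finset.range (m + 1)).filter p = Finset.range (m + 1) :=
        Finset.filter_true_of_mem fun x hx =>
          hp x m (by simpa [Nat.lt_succ_iff] using hx) (by omega) hm
      rw [this, Finset.card_range]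
      exact iff_of_true hq (hp q m (by omega) (by omega) hm)
    · rw [Finset.range_add_one, Finset.filter_insert, if_neg hm]
      rcases (Nat.lt_succ_iff.1 hq).lt_or_eq with h | rfl
      · exact ih (fun q q' h1 h2 => hp q q' h1 (by omega)) q h
      · refine iff_of_false ?_ hm
        have := (Finset.card_filter_le (Finset.range q) p)
        rw [Finset.card_range] at this
        omega

namespace Data

variable {P : Plan n k} (D : Data P) (X : Index)

/-- The assignment `v`, overwritten with the values of row `t` of stage `i`. -/
def ext (i : ℕ) (v : Fin n → ℝ) (t : ℕ) : Fin n → ℝ :=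
  fun a => if a ∈ P.sch i then D.val i t a else v a

variable (P) in
/-- The values of the key attributes of stage `i`. -/
noncomputable def _root_.SubsetSamplingJoin.Plan.keyOf (i : ℕ) (v : Fin n → ℝ) : List ℝ :=
  (P.key i).map v

/-- The number of rows with a smaller key. -/
noncomputable def lo (i : ℕ) (v : Fin n → ℝ) : ℕ :=
  ((Finset.range (D.m i)).filter fun q => P.keyOf i (D.val i (X.perm i q)) < P.keyOf i v).card

/-- The number of rows with a smaller or equal key. -/
noncomputable def hi (i : ℕ) (v : Fin n → ℝ) : ℕ :=
  ((Finset.range (D.m i)).filter fun q => P.keyOf i (D.val i (X.perm i q)) ≤ P.keyOf i v).card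

/-- The total weight of the group of rows that match `v`. -/
noncomputable def grp (i : ℕ) (v : Fin n → ℝ) : ℝ := X.pre i (D.hi X i v) - X.pre i (D.lo X i v)

/-- `perm i` lists the rows of stage `i` in increasing order of their keys. -/
structure Sorted (i : ℕ) : Prop where
  maps : ∀ q < D.m i, X.perm i q < D.m i
  inj : ∀ q < D.m i, ∀ q' < D.m i, X.perm i q = X.perm i q' → q = q'
  mono : ∀ q q', q ≤ q' → q' < D.m i →
    P.keyOf i (D.val i (X.perm i q)) ≤ P.keyOf i (D.val i (X.perm i q'))

/-- The arrays of stage `i` are correct. -/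
structure Stage (i : ℕ) : Prop extends D.Sorted X i where
  zero : X.pre i 0 = 0
  succ : ∀ q < D.m i, X.pre i (q + 1) = X.pre i q +
    D.wt i (D.val i (X.perm i q)) * ∏ c ∈ P.ch i, D.grp X c (D.val i (X.perm i q))

variable {D X}

theorem lo_le_hi (i : ℕ) (v : Fin n → ℝ) : D.lo X i v ≤ D.hi X i v :=
  Finset.card_le_card fun q hq => by
    simp only [Finset.mem_filter] at hq ⊢
    exact ⟨hq.1, hq.2.le⟩

theorem hi_le (i : ℕ) (v : Fin n → ℝ) : D.hi X i v ≤ D.m i :=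
  (Finset.card_filter_le _ _).trans (by simp)

theorem Sorted.lt_lo_iff {i : ℕ} (h : D.Sorted X i) (v : Fin n → ℝ) {q : ℕ} (hq : q < D.m i) :
    q < D.lo X i v ↔ P.keyOf i (D.val i (X.perm i q)) < P.keyOf i v :=
  lt_card_filter_range_iff (p := fun q => P.keyOf i (D.val i (X.perm i q)) < P.keyOf i v)
    (fun q q' h1 h2 h3 => (h.mono q q' h1 h2).trans_lt h3) q hq

theorem Sorted.lt_hi_iff {i : ℕ} (h : D.Sorted X i) (v : Fin n → ℝ) {q : ℕ} (hq : q < D.m i) :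
    q < D.hi X i v ↔ P.keyOf i (D.val i (X.perm i q)) ≤ P.keyOf i v :=
  lt_card_filter_range_iff (p := fun q => P.keyOf i (D.val i (X.perm i q)) ≤ P.keyOf i v)
    (fun q q' h1 h2 h3 => (h.mono q q' h1 h2).trans h3) q hq

/-- The rows of a group are those that agree on the key. -/
theorem Sorted.mem_group_iff {i : ℕ} (h : D.Sorted X i) (v : Fin n → ℝ) {q : ℕ} (hq : q < D.m i) :
    (D.lo X i v ≤ q ∧ q < D.hi X i v) ↔ ∀ a ∈ P.key i, D.val i (X.perm i q) a = v a := by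
  rw [h.lt_hi_iff v hq, ← not_lt, h.lt_lo_iff v hq, ← List.map_inj_left]
  exact ⟨fun h => le_antisymm h.2 (not_lt.1 h.1), fun h => ⟨not_lt.2 h.ge, h.le⟩⟩

theorem Sorted.exists_perm_eq {i : ℕ} (h : D.Sorted X i) {t : ℕ} (ht : t < D.m i) :
    ∃ q < D.m i, X.perm i q = t := by
  have := Finset.surj_on_of_inj_on_of_card_le (s := Finset.range (D.m i))
    (t := Finset.range (D.m i)) (fun q _ => X.perm i q)
    (fun q hq => Finset.mem_range.2 (h.maps q (Finset.mem_range.1 hq)))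
    (fun q q' hq hq' => h.inj q (Finset.mem_range.1 hq) q' (Finset.mem_range.1 hq')) le_rfl t
    (Finset.mem_range.2 ht)
  obtain ⟨q, hq, h⟩ := this
  exact ⟨q, Finset.mem_range.1 hq, h.symm⟩

theorem grp_congr {i : ℕ} {v w : Fin n → ℝ} (h : ∀ a ∈ P.key i, v a = w a) :
    D.grp X i v = D.grp X i w := by
  have : P.keyOf i v = P.keyOf i w := List.map_inj_left.2 h
  simp only [grp, lo, hi, this]

theorem ext_of_mem {i t : ℕ} {v : Fin n → ℝ} {a : Fin n} (h : a ∈ P.sch i) :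
    D.ext i v t a = D.val i t a := if_pos h

theorem ext_of_bound {i q : ℕ} {v : Fin n → ℝ} (hs : D.Sorted X i)
    (h1 : D.lo X i v ≤ q) (h2 : q < D.hi X i v) {j : ℕ} (hj : j < i) {a : Fin n}
    (ha : a ∈ P.sch j) : D.ext i v (X.perm i q) a = v a := by
  unfold ext
  split_ifs with h
  · exact (hs.mem_group_iff v (h2.trans_le (hi_le i v))).1 ⟨h1, h2⟩ a
      (Plan.mem_key.2 ⟨h, j, hj, ha⟩)
  · rfl

variable (D X)

/-- The join results that extend the assignment `v` chosen by the stages before `i`; here `d` is the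
number of the remaining stages. -/
noncomputable def leaves : ℕ → ℕ → (Fin n → ℝ) → List (Fin n → ℝ)
  | 0, _, v => [v]
  | d + 1, i, v => (List.range' (D.lo X i v) (D.hi X i v - D.lo X i v)).flatMap
      fun q => leaves d (i + 1) (D.ext i v (X.perm i q))

/-- The weight of a join result. -/
noncomputable def weight (u : Fin n → ℝ) : ℝ := ∏ j ∈ Finset.range k, D.wt j u

/-- The total weight of the join results that extend `v`. -/
noncomputable def tot (i : ℕ) (v : Fin n → ℝ) : ℝ :=
  (∏ j ∈ Finset.range i, D.wt j v) * ∏ c ∈ P.pend i, D.grp X c v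

/-- The factor of `tot` that does not depend on the choice of stage `i`. -/
noncomputable def rest (i : ℕ) (v : Fin n → ℝ) : ℝ :=
  (∏ j ∈ Finset.range i, D.wt j v) * ∏ c ∈ (P.pend i).erase i, D.grp X c v

variable {D X}

theorem tot_eq {i : ℕ} (hi : i < k) (v : Fin n → ℝ) :
    D.tot X i v = D.rest X i v * D.grp X i v := by
  rw [tot, rest, mul_assoc, Finset.prod_erase_mul _ _ (Plan.self_mem_pend hi)]

theorem tot_ext {i q : ℕ} {v : Fin n → ℝ} (hs : D.Stage X i)
    (h1 : D.lo X i v ≤ q) (h2 : q < D.hi X i v) :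
    D.tot X (i + 1) (D.ext i v (X.perm i q)) =
      D.rest X i v * (X.pre i (q + 1) - X.pre i q) := by
  have hq := h2.trans_le (hi_le i v)
  rw [hs.succ q hq, tot, rest, Plan.pend_succ, Finset.prod_union Plan.disjoint_pend_ch,
    Finset.prod_range_succ]
  have e1 : ∏ j ∈ Finset.range i, D.wt j (D.ext i v (X.perm i q)) =
      ∏ j ∈ Finset.range i, D.wt j v :=
    Finset.prod_congr rfl fun j hj => D.wt_congr _ _ _ fun a ha =>
      ext_of_bound hs.toSorted h1 h2 (Finset.mem_range.1 hj) ha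
  have e2 : D.wt i (D.ext i v (X.perm i q)) = D.wt i (D.val i (X.perm i q)) :=
    D.wt_congr _ _ _ fun a ha => ext_of_mem ha
  have e3 : ∏ c ∈ (P.pend i).erase i, D.grp X c (D.ext i v (X.perm i q)) =
      ∏ c ∈ (P.pend i).erase i, D.grp X c v := by
    refine Finset.prod_congr rfl fun c hc => grp_congr fun a ha => ?_
    obtain ⟨hci, hc⟩ := Finset.mem_erase.1 hc
    obtain ⟨hck, hic, hc⟩ := Plan.mem_pend.1 hc
    have h0 : 0 < c := by omega
    exact ext_of_bound hs.toSorted h1 h2 (hc.resolve_left h0.ne')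
      (Plan.key_subset hck h0 ha)
  have e4 : ∏ c ∈ P.ch i, D.grp X c (D.ext i v (X.perm i q)) =
      ∏ c ∈ P.ch i, D.grp X c (D.val i (X.perm i q)) := by
    refine Finset.prod_congr rfl fun c hc => grp_congr fun a ha => ?_
    obtain ⟨hck, h0, hc⟩ := Plan.mem_ch.1 hc
    exact ext_of_mem (hc ▸ Plan.key_subset hck h0 ha)
  rw [e1, e2, e3, e4]
  ring

theorem sum_flatMap_range' {β : Type*} (f : β → ℝ) (g : ℕ → List β) (F : ℕ → ℝ) (c : ℝ) :
    ∀ (len lo : ℕ), (∀ q, lo ≤ q → q < lo + len → ((g q).map f).sum = c * (F (q + 1) - F q)) →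
      (((List.range' lo len).flatMap g).map f).sum = c * (F (lo + len) - F lo) := by
  intro len
  induction len with
  | zero => intro lo _; simp
  | succ len ih =>
    intro lo h
    rw [List.range'_succ, List.flatMap_cons, List.map_append, List.sum_append,
      h lo le_rfl (by omega), ih (lo + 1) fun q h1 h2 => h q (by omega) (by omega)]
    rw [show lo + 1 + len = lo + (len + 1) by omega]
    ring

theorem sum_leaves (hX : ∀ i < k, D.Stage X i) :
    ∀ (d i : ℕ), i + d = k → ∀ v, ((D.leaves X d i v).map D.weight).sum = D.tot X i v := by
  intro d
  induction d with
  | zero =>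
    intro i hi v
    obtain rfl : i = k := by omega
    have : P.pend i = ∅ := by
      ext c
      simp only [Plan.mem_pend, Finset.notMem_empty, iff_false]
      omega
    simp [leaves, tot, this, weight]
  | succ d ih =>
    intro i hi v
    have hle := D.lo_le_hi (X := X) i v
    rw [leaves, sum_flatMap_range' D.weight _ (X.pre i) (D.rest X i v), tot_eq (by omega), grp,
      Nat.add_sub_cancel' hle]
    intro q h1 h2
    rw [ih (i + 1) (by omega), tot_ext (hX i (by omega)) h1 (by omega)]

/-- The position of the results that extend the choice of the `q`-th row at stage `i`. -/
theorem leaves_split (hX : ∀ i < k, D.Stage X i) {d i q : ℕ} (hi : i + (d + 1) = k)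
    {v : Fin n → ℝ} (h1 : D.lo X i v ≤ q) (h2 : q < D.hi X i v) :
    ∃ L₁ L₂, D.leaves X (d + 1) i v =
        L₁ ++ D.leaves X d (i + 1) (D.ext i v (X.perm i q)) ++ L₂ ∧
      (L₁.map D.weight).sum = D.rest X i v * (X.pre i q - X.pre i (D.lo X i v)) := by
  refine ⟨(List.range' (D.lo X i v) (q - D.lo X i v)).flatMap
      fun q => D.leaves X d (i + 1) (D.ext i v (X.perm i q)),
    (List.range' (q + 1) (D.hi X i v - (q + 1))).flatMap
      fun q => D.leaves X d (i + 1) (D.ext i v (X.perm i q)), ?_, ?_⟩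
  · have : List.range' (D.lo X i v) (D.hi X i v - D.lo X i v) =
        List.range' (D.lo X i v) (q - D.lo X i v) ++
          (q :: List.range' (q + 1) (D.hi X i v - (q + 1))) := by
      rw [← List.range'_succ, show D.hi X i v - D.lo X i v =
        (q - D.lo X i v) + (D.hi X i v - (q + 1) + 1) by omega, ← List.range'_append_1,
        Nat.add_sub_cancel' h1]
    rw [leaves, this, List.flatMap_append, List.flatMap_cons, List.append_assoc]
  · rw [sum_flatMap_range' D.weight _ (X.pre i) (D.rest X i v), Nat.add_sub_cancel' h1]
    intro q' h3 h4
    rw [sum_leaves hX d (i + 1) (by omega), tot_ext (hX i (by omega)) h3 (by omega)]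

theorem mem_leaves (hX : ∀ i < k, D.Stage X i) :
    ∀ (d i : ℕ), i + d = k → ∀ v u, u ∈ D.leaves X d i v ↔
      (∀ j < i, ∀ a ∈ P.sch j, u a = v a) ∧
        ∀ j, i ≤ j → j < k → ∃ t < D.m j, ∀ a ∈ P.sch j, u a = D.val j t a := by
  intro d
  induction d with
  | zero =>
    intro i hi v u
    obtain rfl : i = k := by omega
    simp only [leaves, List.mem_singleton]
    constructor
    · rintro rfl
      exact ⟨fun _ _ _ _ => rfl, fun j h1 h2 => by omega⟩
    · rintro ⟨h, _⟩
      funext a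
      obtain ⟨j, hj, ha⟩ := P.cover a
      exact h j hj a ha
  | succ d ih =>
    intro i hi v u
    have hs := (hX i (by omega)).toSorted
    simp only [leaves, List.mem_flatMap, List.mem_range'_1, ih (i + 1) (by omega)]
    constructor
    · rintro ⟨q, ⟨h1, h2⟩, h3, h4⟩
      have h2' : q < D.hi X i v := by omega
      refine ⟨fun j hj a ha => ?_, fun j hj hjk => ?_⟩
      · rw [h3 j (by omega) a ha, ext_of_bound hs h1 h2' hj ha]
      · rcases hj.eq_or_lt with rfl | hj
        · exact ⟨X.perm i q, hs.maps q (h2'.trans_le (hi_le i v)), fun a ha => by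
            rw [h3 i (by omega) a ha, ext_of_mem ha]⟩
        · exact h4 j hj hjk
    · rintro ⟨h1, h2⟩
      obtain ⟨t, ht, h3⟩ := h2 i le_rfl (by omega)
      obtain ⟨q, hq, rfl⟩ := hs.exists_perm_eq ht
      have h4 : D.lo X i v ≤ q ∧ q < D.hi X i v := by
        refine (hs.mem_group_iff v hq).2 fun a ha => ?_
        obtain ⟨h5, j, h6, h7⟩ := Plan.mem_key.1 ha
        rw [← h3 a h5, h1 j h6 a h7]
      refine ⟨q, ⟨h4.1, by omega⟩, fun j hj a ha => ?_, fun j hj hjk => h2 j (by omega) hjk⟩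
      unfold ext
      split_ifs with h
      · exact h3 a h
      · rcases (Nat.lt_succ_iff.1 hj).lt_or_eq with hj | rfl
        · exact h1 j hj a ha
        · exact absurd ha h

theorem nodup_leaves (hX : ∀ i < k, D.Stage X i) :
    ∀ (d i : ℕ), i + d = k → ∀ v, (D.leaves X d i v).Nodup := by
  intro d
  induction d with
  | zero => intro i hi v; simp [leaves]
  | succ d ih =>
    intro i hi v
    have hs := (hX i (by omega)).toSorted
    rw [leaves, List.nodup_flatMap]
    refine ⟨fun q _ => ih (i + 1) (by omega) _, ?_⟩
    refine (List.nodup_range' (step := 1)).imp_of_mem fun {q q'} hq hq' hne => ?_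
    rw [List.mem_range'_1] at hq hq'
    have hle := D.lo_le_hi (X := X) i v
    have hm := D.hi_le (X := X) i v
    intro u hu hu'
    rw [mem_leaves hX d (i + 1) (by omega)] at hu hu'
    refine hne (hs.inj q (by omega) q' (by omega) (D.val_inj i (by omega) _
      (hs.maps q (by omega)) _ (hs.maps q' (by omega)) fun a ha => ?_))
    have h1 := hu.1 i (by omega) a ha
    have h2 := hu'.1 i (by omega) a ha
    rw [ext_of_mem ha] at h1 h2
    rw [← h1, h2]

theorem pre_mono_aux (hX : ∀ i < k, D.Stage X i) :
    ∀ (d i : ℕ), i + d = k → ∀ j, i ≤ j → j < k → ∀ q q', q ≤ q' → q' ≤ D.m j →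
      X.pre j q ≤ X.pre j q' := by
  intro d
  induction d with
  | zero => intro i hi j h1 h2; omega
  | succ d ih =>
    intro i hi j hij hjk q q' hqq
    rcases hij.lt_or_eq with hij | rfl
    · exact ih (i + 1) (by omega) j hij hjk q q' hqq
    · induction q', hqq using Nat.le_induction with
      | base => intro _; exact le_rfl
      | succ q' _ ihq =>
        intro hq'
        refine (ihq (by omega)).trans ?_
        have hs := hX i (by omega)
        rw [hs.succ q' (by omega)]
        have h1 := (D.wt_mem i (by omega) _ (hs.maps q' (by omega))).1
        have h2 : 0 ≤ ∏ c ∈ P.ch i, D.grp X c (D.val i (X.perm i q')) :=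
          Finset.prod_nonneg fun c hc => sub_nonneg.2
            (ih (i + 1) (by omega) c (Plan.lt_of_mem_ch hc) (Plan.mem_ch.1 hc).1 _ _
              (lo_le_hi _ _) (hi_le _ _))
        linarith [mul_nonneg h1 h2]

theorem pre_mono (hX : ∀ i < k, D.Stage X i) {i : ℕ} (hi : i < k) {q q' : ℕ} (h : q ≤ q')
    (hq : q' ≤ D.m i) : X.pre i q ≤ X.pre i q' :=
  pre_mono_aux hX k 0 (by omega) i (by omega) hi q q' h hq

theorem grp_nonneg (hX : ∀ i < k, D.Stage X i) {i : ℕ} (hi : i < k) (v : Fin n → ℝ) :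
    0 ≤ D.grp X i v :=
  sub_nonneg.2 (pre_mono hX hi (lo_le_hi i v) (hi_le i v))

theorem tot_zero (hX : ∀ i < k, D.Stage X i) (hk : 0 < k) (v : Fin n → ℝ) :
    D.tot X 0 v = X.pre 0 (D.m 0) := by
  have h1 : P.pend 0 = {0} := by
    ext c
    simp only [Plan.mem_pend, Finset.mem_singleton]
    omega
  have h2 : P.key 0 = [] := List.eq_nil_iff_forall_not_mem.2 fun a ha => by
    obtain ⟨_, j, hj, _⟩ := Plan.mem_key.1 ha
    omega
  have h3 : D.lo X 0 v = 0 := by simp [lo, Plan.keyOf, h2]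
  have h4 : D.hi X 0 v = D.m 0 := by simp [hi, Plan.keyOf, h2]
  simp [tot, h1, grp, h3, h4, (hX 0 hk).zero]

end Data

end SubsetSamplingJoin

namespace SubsetSamplingJoin

/-! ### Locating the element hit by a step -/

section Lists

variable {α : Type*} {p : α → ℝ}

theorem sum_map_nonneg {l : List α} (hp : ∀ u ∈ l, 0 ≤ p u) : 0 ≤ (l.map p).sum :=
  List.sum_nonneg fun x hx => by
    obtain ⟨v, hv, rfl⟩ := List.mem_map.1 hx
    exact hp v hv

theorem append_cons_unique {w : ℝ} : ∀ {L₁ L₁' : List α} {u u' : α} {L₂ L₂' : List α},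
    L₁ ++ u :: L₂ = L₁' ++ u' :: L₂' → (∀ v ∈ L₁ ++ u :: L₂, 0 ≤ p v) → ∀ c : ℝ,
    c + (L₁.map p).sum ≤ w → w < c + (L₁.map p).sum + p u →
    c + (L₁'.map p).sum ≤ w → w < c + (L₁'.map p).sum + p u' →
    L₁ = L₁' ∧ u = u' ∧ L₂ = L₂' := by
  intro L₁
  induction L₁ with
  | nil =>
    intro L₁' u u' L₂ L₂' h hp c h1 h2 h3 h4
    cases L₁' with
    | nil => simpa using h
    | cons a L =>
      simp only [List.nil_append, List.cons_append, List.cons.injEq] at h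
      obtain ⟨rfl, rfl⟩ := h
      have := sum_map_nonneg (p := p) (l := L) fun v hv => hp v (by simp [hv])
      simp only [List.map_cons, List.sum_cons, List.map_nil, List.sum_nil] at *
      linarith
  | cons a L ih =>
    intro L₁' u u' L₂ L₂' h hp c h1 h2 h3 h4
    cases L₁' with
    | nil =>
      simp only [List.nil_append, List.cons_append, List.cons.injEq] at h
      obtain ⟨rfl, rfl⟩ := h
      have := sum_map_nonneg (p := p) (l := L) fun v hv => hp v (by simp [hv])
      simp only [List.map_cons, List.sum_cons, List.map_nil, List.sum_nil] at *
      linarith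
    | cons a' L' =>
      simp only [List.cons_append, List.cons.injEq] at h
      obtain ⟨rfl, h⟩ := h
      simp only [List.map_cons, List.sum_cons] at h1 h2 h3 h4
      obtain ⟨rfl, rfl, rfl⟩ := ih h (fun v hv => hp v (List.mem_cons_of_mem _ hv)) (c + p a)
        (by linarith) (by linarith) (by linarith) (by linarith)
      exact ⟨rfl, rfl, rfl⟩

theorem hits_eq_nil : ∀ {l : List α}, (∀ u ∈ l, 0 ≤ p u) → ∀ {a z : ℝ} {τ : Tape},
    a + (l.map p).sum ≤ z → hits p l a z τ = [] := by
  intro l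
  induction l with
  | nil => intros; rfl
  | cons u l ih =>
    intro hp a z τ h
    have := sum_map_nonneg (p := p) (l := l) fun v hv => hp v (by simp [hv])
    rw [List.map_cons, List.sum_cons] at h
    rw [hits_cons_of_le p (by linarith), ih (fun v hv => hp v (by simp [hv])) (by linarith)]

theorem exists_hits_eq_cons : ∀ {l : List α} {a z : ℝ} {τ : Tape},
    a ≤ z → z < a + (l.map p).sum → ∃ l₁ u l₂, l = l₁ ++ u :: l₂ ∧ a + (l₁.map p).sum ≤ z ∧
      z < a + (l₁.map p).sum + p u ∧ hits p l a z τ =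
        (u, (τ 0 : ℝ) ≤ keepProb (a + (l₁.map p).sum) (p u)) :: process p l₂ τ.tail := by
  intro l
  induction l with
  | nil => intro a z τ h1 h2; simp at h2; linarith
  | cons u l ih =>
    intro a z τ h1 h2
    rw [List.map_cons, List.sum_cons] at h2
    rcases lt_or_ge z (a + p u) with h | h
    · exact ⟨[], u, l, rfl, by simpa using h1, by simpa using h, by
        rw [hits_cons_of_lt p h]; simp⟩
    · obtain ⟨l₁, u', l₂, rfl, h3, h4, h5⟩ := ih (τ := τ) h (by linarith)
      refine ⟨u :: l₁, u', l₂, rfl, ?_, ?_, ?_⟩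
      · simp only [List.map_cons, List.sum_cons]; linarith
      · simp only [List.map_cons, List.sum_cons]; linarith
      · rw [hits_cons_of_le p h, h5]
        simp only [List.map_cons, List.sum_cons, add_assoc]

/-- The hit of a step of length `z` from the end of `L₀` is the element found at the absolute
position `w`. -/
theorem hits_eq_of_located {L₀ l L₁ L₂ : List α} {u : α} (h : L₀ ++ l = L₁ ++ u :: L₂)
    (hp : ∀ v ∈ L₀ ++ l, 0 ≤ p v) {z : ℝ} (hz : 0 ≤ z)
    (h1 : (L₁.map p).sum ≤ (L₀.map p).sum + z)
    (h2 : (L₀.map p).sum + z < (L₁.map p).sum + p u) (τ : Tape) :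
    L₂.length < l.length ∧ hits p l 0 z τ = (u, (τ 0 : ℝ) ≤ keepProb ((L₁.map p).sum - (L₀.map p).sum) (p u)) ::
      process p L₂ τ.tail := by
  have hlt : z < 0 + (l.map p).sum := by
    have h3 := congrArg (fun L => (L.map p).sum) h
    simp only [List.map_append, List.sum_append, List.map_cons, List.sum_cons] at h3
    have := sum_map_nonneg (p := p) (l := L₂) fun v hv => hp v (by rw [h]; simp [hv])
    linarith
  obtain ⟨l₁, u', l₂, rfl, h3, h4, h5⟩ := exists_hits_eq_cons (τ := τ) hz hlt
  rw [← List.append_assoc] at h hp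
  obtain ⟨rfl, rfl, rfl⟩ := append_cons_unique (w := (L₀.map p).sum + z) h hp 0
    (by simp only [List.map_append, List.sum_append]; linarith)
    (by simp only [List.map_append, List.sum_append]; linarith) (by linarith) (by linarith)
  rw [h5]
  simp
  omega

end Lists

theorem Data.leaves_congr {n k : ℕ} {P : Plan n k} {D : Data P} {X : Index} :
    ∀ (d i : ℕ), i + d = k → ∀ v w : Fin n → ℝ, (∀ j < i, ∀ a ∈ P.sch j, v a = w a) →
      D.leaves X d i v = D.leaves X d i w := by
  intro d
  induction d with
  | zero =>
    intro i hi v w h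
    have : v = w := funext fun a => by
      obtain ⟨j, hj, ha⟩ := P.cover a
      exact h j (by omega) a ha
    rw [this]
  | succ d ih =>
    intro i hi v w h
    have hk : P.keyOf i v = P.keyOf i w := List.map_inj_left.2 fun a ha => by
      obtain ⟨_, j, hj, ha⟩ := Plan.mem_key.1 ha
      exact h j hj a ha
    have h1 : D.lo X i v = D.lo X i w := by simp only [Data.lo, hk]
    have h2 : D.hi X i v = D.hi X i w := by simp only [Data.hi, hk]
    rw [leaves, leaves, h1, h2]
    congr 1
    funext q
    refine ih (i + 1) (by omega) _ _ fun j hj a ha => ?_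
    unfold ext
    split_ifs with hs
    · rfl
    · refine h j ?_ a ha
      rcases (Nat.lt_succ_iff.1 hj).lt_or_eq with hj | rfl
      · exact hj
      · exact absurd ha hs

end SubsetSamplingJoin

namespace SubsetSamplingJoin

/-! ### Read-only program fragments -/

/-- The fragment that led from `s` to `s'` has changed only registers in `M`, and has accessed only
memory cells below `X`. -/
structure Keeps (M : ℕ → Prop) (X : ℕ) (s s' : State) : Prop where
  mem : s'.mem = s.mem
  tape : s'.tape = s.tape
  out : s'.out = s.out
  top : s'.top ≤ max s.top X
  reg : ∀ r, ¬ M r → s'.reg r = s.reg r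

theorem Keeps.refl {M X s} : Keeps M X s s := ⟨rfl, rfl, rfl, le_max_left _ _, fun _ _ => rfl⟩

theorem Keeps.trans {M X s s' s''} (h : Keeps M X s s') (h' : Keeps M X s' s'') :
    Keeps M X s s'' :=
  ⟨h'.mem.trans h.mem, h'.tape.trans h.tape, h'.out.trans h.out,
    h'.top.trans (max_le h.top (le_max_right _ _)),
    fun r hr => (h'.reg r hr).trans (h.reg r hr)⟩

theorem Keeps.mono {M M' X s s'} (h : Keeps M X s s') (hM : ∀ r, M r → M' r) :
    Keeps M' X s s' :=
  ⟨h.mem, h.tape, h.out, h.top, fun r hr => h.reg r fun hr' => hr (hM r hr')⟩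

theorem Keeps.tick {M X s s'} (h : Keeps M X s s') (t : ℕ) : Keeps M X s (s'.tick t) :=
  ⟨h.mem, h.tape, h.out, h.top, h.reg⟩

theorem Keeps.setReg {M X s s'} {r : ℕ} (h : Keeps M X s s') (hr : M r) (x : ℝ) :
    Keeps M X s (s'.setReg r x) :=
  ⟨h.mem, h.tape, h.out, h.top, fun r' hr' => by
    have hne : r' ≠ r := fun e => hr' (by rwa [e])
    simpa [State.setReg, hne] using h.reg r' hr'⟩

theorem Keeps.load {M X s s'} {r a : ℕ} (h : Keeps M X s s') (hr : M r) (ha : a < X) :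
    Keeps M X s (s'.load r a) :=
  ⟨h.mem, h.tape, h.out, max_le h.top (le_max_of_le_right ha), fun r' hr' => by
    have hne : r' ≠ r := fun e => hr' (by rwa [e])
    simpa [State.load, hne] using h.reg r' hr'⟩

variable {n k : ℕ}

/-- The number of a register in bank `b`. -/
def bank (b a : ℕ) : ℕ := 20 + 4 * a + b

namespace Data

variable {P : Plan n k} (D : Data P)

/-- The size of the input. -/
def total : ℕ := ∑ i ∈ Finset.range k, D.m i

theorem m_le_total {i : ℕ} (hi : i < k) : D.m i ≤ D.total :=
  Finset.single_le_sum (f := D.m) (fun _ _ => Nat.zero_le _) (Finset.mem_range.2 hi)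

/-- The address of cell `j` of array `a`. The arrays `0, …, 2 * k` are interleaved. -/
def cell (a j : ℕ) : ℕ := D.base + ((2 * k + 1) * j + a)

/-- A bound on the addresses in use. -/
def cap : ℕ := D.base + (2 * k + 1) * (2 * D.total + 3) + (n + 1)

theorem cell_lt_cap {a j : ℕ} (ha : a ≤ 2 * k) (hj : j ≤ 2 * D.total + 2) : D.cell a j < D.cap := by
  have : (2 * k + 1) * j ≤ (2 * k + 1) * (2 * D.total + 2) := Nat.mul_le_mul_left _ hj
  have h2 : (2 * k + 1) * (2 * D.total + 3) = (2 * k + 1) * (2 * D.total + 2) + (2 * k + 1) := by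
    ring
  unfold cell cap
  omega

theorem cell_inj {a a' j j' : ℕ} (ha : a ≤ 2 * k) (ha' : a' ≤ 2 * k)
    (h : D.cell a j = D.cell a' j') : a = a' ∧ j = j' := by
  unfold cell at h
  have h1 : ((2 * k + 1) * j + a) % (2 * k + 1) = ((2 * k + 1) * j' + a') % (2 * k + 1) := by
    rw [Nat.add_left_cancel h]
  rw [Nat.mul_add_mod, Nat.mul_add_mod, Nat.mod_eq_of_lt (by omega),
    Nat.mod_eq_of_lt (by omega)] at h1
  subst h1
  refine ⟨rfl, Nat.eq_of_mul_eq_mul_left (show 0 < 2 * k + 1 by omega) (by omega)⟩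

theorem base_le_cell (a j : ℕ) : D.base ≤ D.cell a j := Nat.le_add_right _ _

/-- The registers and the input are as expected by the programs. -/
structure Ready (s : State) : Prop where
  base : s.reg 0 = D.base
  off : ∀ i < k, s.reg (bank 3 (P.src i)) = D.off i
  inp : ∀ a < D.base, s.mem a = D.inp a

variable {D}

theorem Ready.of_keeps {M X s s'} (h : D.Ready s) (hK : Keeps M X s s') (h0 : ¬ M 0)
    (hM : ∀ j, ¬ M (bank 3 j)) : D.Ready s' :=
  ⟨(hK.reg 0 h0).trans h.base, fun i hi => (hK.reg _ (hM _)).trans (h.off i hi),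
    fun a ha => by rw [hK.mem]; exact h.inp a ha⟩

end Data

/-- Read cell `e` of array `a` into register `r`. -/
def Cmd.loadArr (k r a : ℕ) (e : Expr) : Cmd :=
  .load r (.reg 0 + (.const (2 * k + 1) * e + .const a))

/-- Write `x` into cell `e` of array `a`. -/
def Cmd.storeArr (k a : ℕ) (e x : Expr) : Cmd :=
  .store (.reg 0 + (.const (2 * k + 1) * e + .const a)) x

theorem Data.addr_cell {P : Plan n k} {D : Data P} {ρ : ℕ → ℝ} {a j : ℕ} {e : Expr}
    (h0 : ρ 0 = D.base) (he : e.eval ρ = (j : ℕ)) :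
    (Expr.reg 0 + (.const (2 * k + 1) * e + .const a) : Expr).addr ρ = D.cell a j := by
  refine Expr.addr_eq ?_
  simp [h0, he, Data.cell]

theorem wp_loadArr {P : Plan n k} {D : Data P} {r a j : ℕ} {e : Expr} {s : State}
    {Q : State → Prop} (h0 : s.reg 0 = D.base) (he : e.eval s.reg = (j : ℕ))
    (h : Q ((s.load r (D.cell a j)).tick (e.cost + 7))) : wp (.loadArr k r a e) s Q := by
  refine wp_load ?_
  rw [Data.addr_cell h0 he]
  convert h using 2
  change 1 + (1 + 1 + (1 + (1 + 1 + e.cost) + 1)) = _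
  omega

theorem wp_storeArr {P : Plan n k} {D : Data P} {a j : ℕ} {e x : Expr} {s : State}
    {Q : State → Prop} (h0 : s.reg 0 = D.base) (he : e.eval s.reg = (j : ℕ))
    (h : Q ((s.store (D.cell a j) (x.eval s.reg)).tick (e.cost + x.cost + 7))) :
    wp (.storeArr k a e x) s Q := by
  refine wp_store ?_
  rw [Data.addr_cell h0 he]
  convert h using 2
  change 1 + (1 + 1 + (1 + (1 + 1 + e.cost) + 1)) + x.cost = _
  omega

theorem wp_set_keeps {M : ℕ → Prop} {X r : ℕ} {e : Expr} {s₀ s : State} {Q : State → Prop}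
    (hK : Keeps M X s₀ s) (hr : M r)
    (h : ∀ s', Keeps M X s₀ s' → s'.reg r = e.eval s.reg → (∀ x, x ≠ r → s'.reg x = s.reg x) →
      s'.time = s.time + (1 + e.cost) → Q s') : wp (.set r e) s Q :=
  wp_set (h _ ((hK.setReg hr _).tick _) (by simp [State.tick, State.setReg])
    (fun x hx => by simp [State.tick, State.setReg, hx]) rfl)

theorem wp_loadArr_keeps {P : Plan n k} {D : Data P} {M : ℕ → Prop} {r a j : ℕ} {e : Expr}
    {s₀ s : State} {Q : State → Prop} (hK : Keeps M D.cap s₀ s) (hr : M r)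
    (h0 : s.reg 0 = D.base) (he : e.eval s.reg = (j : ℕ)) (ha : a ≤ 2 * k)
    (hj : j ≤ 2 * D.total + 2)
    (h : ∀ s', Keeps M D.cap s₀ s' → s'.reg r = s₀.mem (D.cell a j) →
      (∀ x, x ≠ r → s'.reg x = s.reg x) → s'.time = s.time + (e.cost + 7) → Q s') :
    wp (.loadArr k r a e) s Q :=
  wp_loadArr h0 he (h _ ((hK.load hr (D.cell_lt_cap ha hj)).tick _)
    (by simp [State.tick, State.load, hK.mem])
    (fun x hx => by simp [State.tick, State.load, hx]) rfl)

/-- Load some columns of the row of stage `i` whose number is in register `rt` into bank `b`. -/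
def Plan.loadCols (P : Plan n k) (b i : ℕ) (rt : ℕ) (cols : List (Fin n)) : Cmd :=
  .block (cols.map fun a : Fin n => .load (bank b a)
    (.reg (bank 3 (P.src i)) + (.reg rt * .const (P.width i) + .const (P.col i a))))

theorem Data.row_lt_cap {P : Plan n k} {D : Data P} {i t c : ℕ} (hi : i < k)
    (ht : t ≤ D.m i) (hc : c ≤ (P.sch i).card) : D.off i + t * P.width i + c < D.cap := by
  have h1 := D.off_le i hi
  have h2 : t * P.width i ≤ D.m i * P.width i := Nat.mul_le_mul_right _ ht
  have h3 : (P.sch i).card ≤ n := by simpa using Finset.card_le_univ (P.sch i)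
  have h4 : 0 < (2 * k + 1) * (2 * D.total + 3) := by positivity
  unfold Data.cap
  omega

theorem wp_loadCols {P : Plan n k} {D : Data P} {b i t rt : ℕ} (hi : i < k)
    (hb : b < 3) (hrt : rt < 20) (ht : t ≤ D.m i) :
    ∀ (cols : List (Fin n)) (s : State), D.Ready s → s.reg rt = t →
      (∀ a ∈ cols, a ∈ P.sch i) → cols.Nodup →
      wp (P.loadCols b i rt cols) s fun s' =>
        Keeps (fun r => ∃ a ∈ cols, r = bank b a) D.cap s s' ∧
        (t < D.m i → ∀ a ∈ cols, s'.reg (bank b a) = D.val i t a) ∧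
        s'.time ≤ s.time + 8 * cols.length + 1 := by
  intro cols
  induction cols with
  | nil =>
    intro s _ _ _ _
    exact wp_block_nil ⟨Keeps.refl.tick _, by simp, by simp [State.tick]⟩
  | cons a cols ih =>
    intro s hs hr hcols hnd
    have ha := P.col_lt i a (hcols a (by simp))
    have haddr : (Expr.reg (bank 3 (P.src i)) + (.reg rt * .const (P.width i) +
        .const (P.col i a)) : Expr).addr s.reg = D.off i + t * P.width i + P.col i a := by
      refine Expr.addr_eq ?_
      simp [hr, hs.off i hi, add_assoc]
    refine wp_block_cons (wp_load ?_)
    rw [haddr]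
    have hK : Keeps (fun r => r = bank b a) D.cap s (((s.load (bank b a)
        (D.off i + t * P.width i + P.col i a)).tick 8)) :=
      (Keeps.load (M := fun r => r = bank b a) Keeps.refl rfl
        (Data.row_lt_cap hi ht ha.le)).tick _
    refine (ih _ (hs.of_keeps hK ?_ ?_) ?_ (fun a' h => hcols a' (by simp [h]))
      (List.nodup_cons.1 hnd).2).mono fun s' ⟨h1, h2, h3⟩ => ⟨?_, ?_, ?_⟩
    · simp only [bank]; omega
    · intro j; simp only [bank]; omega
    · rw [← hr]
      exact hK.reg _ (by simp only [bank]; omega)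
    · refine (hK.mono fun r h => ⟨a, by simp, h⟩).trans (Keeps.mono h1 ?_)
      rintro r ⟨a', h, rfl⟩
      exact ⟨a', by simp [h], rfl⟩
    · intro htm a' ha'
      rcases List.mem_cons.1 ha' with rfl | ha'
      · rw [h1.reg]
        · have h4 : D.off i + t * P.width i + P.col i a' < D.base := by
            have h5 := D.off_le i hi
            have h6 : (t + 1) * P.width i ≤ D.m i * P.width i := Nat.mul_le_mul_right _ htm
            have h7 : (t + 1) * P.width i = t * P.width i + P.width i := by ring
            have h8 : P.width i = (P.sch i).card + 1 := rfl
            omega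
          simp only [State.tick, State.load, Function.update_self]
          rw [hs.inp _ h4, D.inp_val i hi t htm _ (hcols _ (by simp))]
        · rintro ⟨a, h, h'⟩
          have : a' = a := Fin.ext (by simp only [bank] at h'; omega)
          exact (List.nodup_cons.1 hnd).1 (this ▸ h)
      · exact h2 htm a' ha'
    · refine h3.trans ?_
      simp only [List.length_cons, State.tick, State.load]
      change s.time + (1 + (1 + 1 + (1 + (1 + 1 + 1) + 1))) + 8 * cols.length + 1 ≤ _
      omega

/-- The lexicographic comparison of the values of two banks on some attributes. -/
def lexTest (x y : ℕ) : List (Fin n) → Test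
  | [] => .le (.const 0) (.const 0)
  | a :: l => .and (.le (.reg (bank x a)) (.reg (bank y a)))
      (.not (.and (.le (.reg (bank y a)) (.reg (bank x a))) (.not (lexTest x y l))))

theorem lexTest_holds {x y : ℕ} {ρ : ℕ → ℝ} {u v : Fin n → ℝ} : ∀ {l : List (Fin n)},
    (∀ a ∈ l, ρ (bank x a) = u a) → (∀ a ∈ l, ρ (bank y a) = v a) →
    ((lexTest x y l).holds ρ ↔ l.map u ≤ l.map v) := by
  intro l
  induction l with
  | nil => intro _ _; simp [lexTest]
  | cons a l ih =>
    intro hu hv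
    have h1 := hu a (by simp)
    have h2 := hv a (by simp)
    specialize ih (fun b hb => hu b (by simp [hb])) (fun b hb => hv b (by simp [hb]))
    simp only [lexTest, Test.holds_and, Test.holds_not, Test.holds_le, Expr.eval_reg, h1, h2, ih,
      List.map_cons]
    rw [← not_lt (a := v a :: List.map v l), List.cons_lt_cons_iff, not_or, not_lt,
      ← not_lt (a := List.map v l)]
    grind

/-- Binary search in the interval between registers `1` and `2`, where `c` sets register `4` to `1`
if the position in register `3` is large enough, and to `0` otherwise. -/
def Cmd.bsearch (c : Cmd) : Cmd :=
  .while (.not (.le (.reg 2) (.reg 1)))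
    (.seq (.set 3 (.un .floor ((.reg 1 + .reg 2) / .const 2)))
      (.seq c (.ite (.le (.const 1) (.reg 4)) (.set 2 (.reg 3)) (.set 1 (.reg 3 + .const 1)))))

theorem floor_half (a b : ℕ) : ((⌊((a : ℝ) + b) / 2⌋ : ℤ) : ℝ) = ((a + b) / 2 : ℕ) := by
  have : ⌊((a : ℝ) + b) / 2⌋ = (((a + b) / 2 : ℕ) : ℤ) := by
    have h := Nat.div_add_mod (a + b) 2
    have h2 := Nat.mod_lt (a + b) (show 0 < 2 by norm_num)
    rw [Int.floor_eq_iff]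
    push_cast
    have h3 : (2 : ℝ) * ((a + b) / 2 : ℕ) + ((a + b) % 2 : ℕ) = a + b := by exact_mod_cast h
    have h4 : (((a + b) % 2 : ℕ) : ℝ) ≤ 1 := by exact_mod_cast (by omega)
    have h5 : (0 : ℝ) ≤ ((a + b) % 2 : ℕ) := Nat.cast_nonneg _
    have h6 : (((a + b : ℕ) / 2 : ℕ) : ℤ) = ((a : ℤ) + b) / 2 := by push_cast; rfl
    rw [← h6]
    simp only [Int.cast_natCast]
    constructor <;> linarith
  rw [this, Int.cast_natCast]

theorem wp_bsearch {c : Cmd} {M : ℕ → Prop} {X : ℕ} (hM1 : ¬ M 1) (hM2 : ¬ M 2) (hM3 : ¬ M 3)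
    {s₀ : State} {lo hi r B : ℕ} (hlo : lo ≤ r) (hhi : r ≤ hi)
    (hbody : ∀ q s, lo ≤ q → q < hi → Keeps (fun r => M r ∨ r = 1 ∨ r = 2 ∨ r = 3) X s₀ s →
      s.reg 3 = q → wp c s fun s' => Keeps M X s s' ∧ (s'.reg 4 = if r ≤ q then 1 else 0) ∧
        s'.time ≤ s.time + B)
    (j : ℕ) : ∀ (lo' hi' : ℕ) (s : State), lo ≤ lo' → lo' ≤ r → r ≤ hi' → hi' ≤ hi →
      hi' - lo' < 2 ^ j → s.reg 1 = lo' → s.reg 2 = hi' →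
      Keeps (fun r => M r ∨ r = 1 ∨ r = 2 ∨ r = 3) X s₀ s →
      wp (.bsearch c) s fun s' => Keeps (fun r => M r ∨ r = 1 ∨ r = 2 ∨ r = 3) X s₀ s' ∧
        s'.reg 1 = r ∧ s'.time ≤ s.time + j * (B + 20) + 4 := by
  induction j with
  | zero =>
    intro lo' hi' s h1 h2 h3 h4 h5 h6 h7 hK
    refine wp_while (fun h => absurd ?_ h) fun _ => ⟨hK.tick _, ?_, ?_⟩
    · simp only [Test.holds_le, Expr.eval_reg, h6, h7, Nat.cast_le]; omega
    · simp only [State.tick, h6]; congr 1; omega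
    · simp [State.tick]
  | succ j ih =>
    intro lo' hi' s h1 h2 h3 h4 h5 h6 h7 hK
    refine wp_while (fun h => ?_) fun h => ⟨hK.tick _, ?_, ?_⟩
    · have hlt : lo' < hi' := by
        simpa [h6, h7] using h
      refine wp_seq (wp_set (wp_seq ?_))
      have hmid : (Expr.un .floor ((.reg 1 + .reg 2) / .const 2)).eval
          (s.tick (Test.le (.reg 2) (.reg 1)).not.cost).reg = ((lo' + hi') / 2 : ℕ) := by
        rw [← floor_half]
        simp [State.tick, h6, h7]
      rw [hmid]
      set q := (lo' + hi') / 2 with hq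
      have hKm : Keeps (fun r => M r ∨ r = 1 ∨ r = 2 ∨ r = 3) X s₀
          (((s.tick (Test.le (.reg 2) (.reg 1)).not.cost).setReg 3 (q : ℕ)).tick
            (1 + (Expr.un .floor ((.reg 1 + .reg 2) / .const 2)).cost)) :=
        ((hK.tick _).setReg (by simp) _).tick _
      refine (hbody q _ (by omega) (by omega) hKm (by simp [State.tick, State.setReg])).mono
        fun s' hs' => ?_
      obtain ⟨hK', hf, ht⟩ := hs'
      have hK2 := hKm.trans (hK'.mono fun r hr => Or.inl hr)
      have hr1 : s'.reg 1 = lo' := by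
        rw [hK'.reg 1 hM1]; simp [State.tick, State.setReg, h6]
      have hr2 : s'.reg 2 = hi' := by
        rw [hK'.reg 2 hM2]; simp [State.tick, State.setReg, h7]
      have hr3 : s'.reg 3 = q := by
        rw [hK'.reg 3 hM3]; simp [State.tick, State.setReg]
      have ht' : s'.time ≤ s.time + B + 11 := by
        refine ht.trans ?_
        simp only [State.tick, State.setReg, Test.cost_not, Test.cost_le, Expr.cost_un,
          Expr.cost_div, Expr.cost_add, Expr.cost_reg, Expr.cost_const]
        omega
      have hexp : (j + 1) * (B + 20) = j * (B + 20) + B + 20 := by ring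
      rw [pow_succ] at h5
      refine wp_ite (fun h => wp_set ?_) fun h => wp_set ?_
      · have hrq : r ≤ q := by
          by_contra hrq
          simp [hf, hrq] at h
          norm_num at h
        refine (ih lo' q _ h1 h2 hrq (by omega) (by omega) ?_ ?_
          ((hK2.tick _).setReg (by simp) _ |>.tick _)).mono fun s'' ⟨e1, e2, e3⟩ => ⟨e1, e2, ?_⟩
        · simp [State.tick, State.setReg, hr1]
        · simp [State.tick, State.setReg, hr3]
        · simp only [State.tick, State.setReg, Test.cost_le, Expr.cost_reg, Expr.cost_const] at e3
          omega
      · have hrq : ¬ r ≤ q := by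
          intro hrq
          simp [hf, hrq] at h
        refine (ih (q + 1) hi' _ (by omega) (by omega) h3 h4 (by omega) ?_ ?_
          ((hK2.tick _).setReg (by simp) _ |>.tick _)).mono fun s'' ⟨e1, e2, e3⟩ => ⟨e1, e2, ?_⟩
        · simp [State.tick, State.setReg, hr3]
        · simp [State.tick, State.setReg, hr2]
        · simp only [State.tick, State.setReg, Test.cost_le, Expr.cost_reg, Expr.cost_const,
            Expr.cost_add] at e3
          omega
    · have : hi' ≤ lo' := by
        simpa [h6, h7] using h
      simp only [State.tick, h6]; congr 1; omega
    · simp [State.tick]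

end SubsetSamplingJoin

namespace SubsetSamplingJoin

variable {n k : ℕ}

namespace Plan

variable (P : Plan n k)

/-- Compare the key of the row at position (register `3`) with the key in bank `0`. -/
noncomputable def cmpBody (i : ℕ) (t : Test) : Cmd :=
  .seq (.loadArr k 5 (2 * i) (.reg 3))
    (.seq (P.loadCols 1 i 5 (P.key i)) (.ite t (.set 4 (.const 1)) (.set 4 (.const 0))))

/-- Compute the interval of the rows of stage `i` that match bank `0`, into registers `6` and `7`. -/
noncomputable def group (i : ℕ) : Cmd :=
  .block [.set 1 (.const 0), .load 2 (.const (P.src i)),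
    .bsearch (P.cmpBody i (lexTest 0 1 (P.key i))), .set 6 (.reg 1), .load 2 (.const (P.src i)),
    .bsearch (P.cmpBody i (.not (lexTest 1 0 (P.key i)))), .set 7 (.reg 1)]

end Plan

/-- The arrays of stage `i` are in memory. -/
structure Data.HasPerm {P : Plan n k} (D : Data P) (X : Index) (i : ℕ) (mem : ℕ → ℝ) : Prop where
  perm : ∀ q < D.m i, mem (D.cell (2 * i) q) = X.perm i q

structure Data.Has {P : Plan n k} (D : Data P) (X : Index) (i : ℕ) (mem : ℕ → ℝ) : Prop
    extends D.HasPerm X i mem where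
  pre : ∀ q ≤ D.m i, mem (D.cell (2 * i + 1) q) = X.pre i q

/-- The registers changed by comparisons of keys. -/
def cmpRegs (r : ℕ) : Prop := r = 4 ∨ r = 5 ∨ (20 ≤ r ∧ r % 4 = 1)

/-- The registers changed by `group`. -/
def groupRegs (r : ℕ) : Prop := (1 ≤ r ∧ r ≤ 7) ∨ (20 ≤ r ∧ r % 4 = 1)

theorem Plan.key_subset_sch {P : Plan n k} {i : ℕ} : ∀ a ∈ P.key i, a ∈ P.sch i :=
  fun _ ha => (Plan.mem_key.1 ha).1

theorem wp_cmpBody {P : Plan n k} {D : Data P} {X : Index} {i q : ℕ} {T : Test} {s : State}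
    {b : Prop} [Decidable b] (hi : i < k) (hs : D.Ready s) (hX : D.Sorted X i)
    (hmem : D.HasPerm X i s.mem) (hq : q < D.m i) (h3 : s.reg 3 = q)
    (hT : ∀ ρ : ℕ → ℝ, (∀ a : Fin n, ρ (bank 0 a) = s.reg (bank 0 a)) →
      (∀ a ∈ P.key i, ρ (bank 1 a) = D.val i (X.perm i q) a) → (T.holds ρ ↔ b)) :
    wp (P.cmpBody i T) s fun s' => Keeps cmpRegs D.cap s s' ∧
      (s'.reg 4 = if b then 1 else 0) ∧ s'.time ≤ s.time + (8 * (P.key i).length + T.cost + 20) := by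
  have hm := D.m_le_total hi
  have hp := hX.maps q hq
  refine wp_seq (wp_loadArr (j := q) hs.base (by simpa using h3) (wp_seq ?_))
  have hK : Keeps cmpRegs D.cap s
      ((s.load 5 (D.cell (2 * i) q)).tick ((Expr.reg 3).cost + 7)) :=
    (Keeps.refl.load (by simp [cmpRegs]) (D.cell_lt_cap (by omega) (by omega))).tick _
  refine (wp_loadCols (b := 1) (t := X.perm i q) hi (by norm_num) (by norm_num) hp.le (P.key i) _
    (hs.of_keeps hK (by simp [cmpRegs]) (fun j => by simp only [cmpRegs, bank]; omega)) ?_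
    Plan.key_subset_sch (Finset.nodup_toList _)).mono fun s' h => ?_
  · simp [State.tick, State.load, hmem.perm q hq]
  · obtain ⟨h1, h2, h4⟩ := h
    have hK' : Keeps cmpRegs D.cap s s' := hK.trans (h1.mono (by
      rintro r ⟨a, _, rfl⟩
      simp only [cmpRegs, bank]; omega))
    have hiff : T.holds s'.reg ↔ b := by
      refine hT _ (fun a => hK'.reg _ (by simp only [cmpRegs, bank]; omega)) (h2 hp)
    simp only [State.tick, State.load, Expr.cost_reg] at h4
    refine wp_ite (fun h => wp_set ⟨?_, ?_, ?_⟩) fun h => wp_set ⟨?_, ?_, ?_⟩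
    · exact ((hK'.tick _).setReg (by simp [cmpRegs]) _).tick _
    · simp [State.tick, State.setReg, hiff.1 h]
    · simp only [State.tick, State.setReg, Expr.cost_const]; omega
    · exact ((hK'.tick _).setReg (by simp [cmpRegs]) _).tick _
    · simp [State.tick, State.setReg, mt hiff.2 h]
    · simp only [State.tick, State.setReg, Expr.cost_const]; omega

theorem cmpRegs_le {r : ℕ} (h : cmpRegs r ∨ r = 1 ∨ r = 2 ∨ r = 3) : groupRegs r := by
  unfold cmpRegs at h
  unfold groupRegs
  omega

theorem Keeps.ready {P : Plan n k} {D : Data P} {X : ℕ} {s s' : State} (hs : D.Ready s)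
    (h : Keeps groupRegs X s s') : D.Ready s' :=
  hs.of_keeps h (by simp [groupRegs]) fun j => by simp only [groupRegs, bank]; omega

theorem exists_wp_group (P : Plan n k) {i : ℕ} (hi : i < k) : ∃ B, ∀ (D : Data P) (X : Index)
    (s : State) (v : Fin n → ℝ) (j : ℕ), D.Ready s → D.Sorted X i → D.HasPerm X i s.mem →
    (∀ a ∈ P.key i, s.reg (bank 0 a) = v a) → D.m i < 2 ^ j →
    wp (P.group i) s fun s' => Keeps groupRegs D.cap s s' ∧ s'.reg 6 = D.lo X i v ∧
      s'.reg 7 = D.hi X i v ∧ s'.time ≤ s.time + B * (j + 1) := by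
  set K := 8 * (P.key i).length + (lexTest 0 1 (P.key i)).cost +
    (lexTest 1 0 (P.key i)).cost + 41 with hKd
  refine ⟨2 * K + 30, fun D X s v j hs hX hmem hv hj => ?_⟩
  have hlh := D.lo_le_hi (X := X) i v
  have hhm := D.hi_le (X := X) i v
  have hsrc : P.src i < D.base := (P.src_lt i hi).trans_le D.le_base
  have hcap : D.base < D.cap := by
    have : 0 < (2 * k + 1) * (2 * D.total + 3) := by positivity
    unfold Data.cap; omega
  have haddr : ∀ ρ, (Expr.const (P.src i : ℕ)).addr ρ = P.src i := fun ρ =>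
    Expr.addr_eq (by simp)
  -- the first search
  refine wp_block_cons (wp_set (wp_block_cons (wp_load ?_)))
  rw [haddr]
  set s1 := ((((s.setReg 1 ((Expr.const 0).eval s.reg)).tick (1 + (Expr.const 0).cost)).load 2
    (P.src i)).tick (1 + (Expr.const (P.src i : ℕ)).cost)) with hs1
  have hK1 : Keeps groupRegs D.cap s s1 :=
    (((Keeps.refl.setReg (by simp [groupRegs]) _).tick _).load (by simp [groupRegs])
      (hsrc.trans hcap)).tick _
  have hin : ∀ s', D.Ready s' → s'.mem (P.src i) = D.m i := fun s' hs' => by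
    rw [hs'.inp _ hsrc, D.inp_size i hi]
  have h11 : s1.reg 1 = (0 : ℕ) := by simp [hs1, State.tick, State.load, State.setReg]
  have h12 : s1.reg 2 = D.m i := by
    simp [hs1, State.tick, State.load, State.setReg, hin s hs]
  have ht1 : s1.time = s.time + 4 := by
    simp only [hs1, State.tick, State.load, State.setReg, Expr.cost_const]
  have hbody : ∀ (T : Test) (r : ℕ) (s0 : State), Keeps groupRegs D.cap s s0 → 
      T.cost ≤ (lexTest 0 1 (P.key i)).cost + (lexTest 1 0 (P.key i)).cost + 1 →
      (∀ q < D.m i, ∀ ρ : ℕ → ℝ, (∀ a ∈ P.key i, ρ (bank 0 a) = v a) →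
      (∀ a ∈ P.key i, ρ (bank 1 a) = D.val i (X.perm i q) a) → (T.holds ρ ↔ r ≤ q)) →
      ∀ q u, 0 ≤ q → q < D.m i → Keeps (fun r => cmpRegs r ∨ r = 1 ∨ r = 2 ∨ r = 3) D.cap s0 u →
      u.reg 3 = q → wp (P.cmpBody i T) u fun s' => Keeps cmpRegs D.cap u s' ∧
        (s'.reg 4 = if r ≤ q then 1 else 0) ∧ s'.time ≤ u.time + (K - 20) := by
    intro T r s0 hK0 hc hT q u _ hq hKu h3
    have hKs := hK0.trans (hKu.mono fun r => cmpRegs_le)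
    refine (wp_cmpBody (b := r ≤ q) hi (hKs.ready hs) hX ⟨fun q hq => by
      rw [hKs.mem]; exact hmem.perm q hq⟩ hq h3 fun ρ h0 h1 => hT q hq ρ (fun a ha => ?_) h1).mono
      fun s' h => ⟨h.1, h.2.1, h.2.2.trans (by omega)⟩
    rw [h0, hKs.reg _ (by simp only [groupRegs, bank]; omega), hv a ha]
  have hsearch := wp_bsearch (c := P.cmpBody i (lexTest 0 1 (P.key i))) (M := cmpRegs)
    (X := D.cap) (s₀ := s1) (lo := 0) (hi := D.m i) (r := D.lo X i v) (B := K - 20)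
    (by simp [cmpRegs]) (by simp [cmpRegs]) (by simp [cmpRegs]) (Nat.zero_le _) (by omega)
    (hbody _ _ s1 hK1 (by omega) fun q hq ρ h0 h1 => by
      rw [lexTest_holds h0 h1, ← not_lt (a := List.map (D.val i (X.perm i q)) (P.key i)),
        ← not_lt]
      exact not_congr (hX.lt_lo_iff v hq).symm) j 0 (D.m i) s1 le_rfl (by omega) (by omega) le_rfl
    (by omega) h11 h12 Keeps.refl
  refine wp_block_cons (hsearch.mono fun s2 ⟨hK2, h21, ht2⟩ => ?_)
  have hK2 := hK1.trans (hK2.mono fun r => cmpRegs_le)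
  -- the second search
  refine wp_block_cons (wp_set (wp_block_cons (wp_load ?_)))
  rw [haddr]
  set s3 := ((((s2.setReg 6 ((Expr.reg 1).eval s2.reg)).tick (1 + (Expr.reg 1).cost)).load 2
    (P.src i)).tick (1 + (Expr.const (P.src i : ℕ)).cost)) with hs3
  have hK3 : Keeps groupRegs D.cap s s3 :=
    (((hK2.setReg (by simp [groupRegs]) _).tick _).load (by simp [groupRegs])
      (hsrc.trans hcap)).tick _
  have h31 : s3.reg 1 = D.lo X i v := by simp [hs3, State.tick, State.load, State.setReg, h21]
  have h36 : s3.reg 6 = D.lo X i v := by simp [hs3, State.tick, State.load, State.setReg, h21]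
  have h32 : s3.reg 2 = D.m i := by
    simp [hs3, State.tick, State.load, State.setReg, hin s2 (hK2.ready hs)]
  have ht3 : s3.time = s2.time + 4 := by
    simp only [hs3, State.tick, State.load, State.setReg, Expr.cost_const, Expr.cost_reg]
  have hsearch := wp_bsearch (c := P.cmpBody i (.not (lexTest 1 0 (P.key i)))) (M := cmpRegs)
    (X := D.cap) (s₀ := s3) (lo := 0) (hi := D.m i) (r := D.hi X i v) (B := K - 20)
    (by simp [cmpRegs]) (by simp [cmpRegs]) (by simp [cmpRegs]) (Nat.zero_le _) (by omega)
    (hbody _ _ s3 hK3 (by simp only [Test.cost_not]; omega) fun q hq ρ h0 h1 => by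
      rw [Test.holds_not, lexTest_holds h1 h0, ← not_lt (a := q)]
      exact not_congr (hX.lt_hi_iff v hq).symm) j (D.lo X i v) (D.m i) s3 (Nat.zero_le _) hlh hhm
    le_rfl (by omega) h31 h32 Keeps.refl
  refine wp_block_cons (hsearch.mono fun s4 ⟨hK4, h41, ht4⟩ => ?_)
  have hK4' := hK3.trans (hK4.mono fun r => cmpRegs_le)
  refine wp_block_cons (wp_set (wp_block_nil ⟨?_, ?_, ?_, ?_⟩))
  · exact ((hK4'.setReg (by simp [groupRegs]) _).tick _).tick _
  · have := hK4.reg 6 (by simp [cmpRegs])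
    simp [State.tick, State.setReg, this, h36]
  · simp [State.tick, State.setReg, h41]
  · have e1 : K - 20 + 20 = K := by omega
    rw [e1] at ht2 ht4
    simp only [State.tick, State.setReg, Expr.cost_reg]
    have e2 : (2 * K + 30) * (j + 1) = 2 * (j * K) + 2 * K + 30 * j + 30 := by ring
    omega

end SubsetSamplingJoin

namespace SubsetSamplingJoin

variable {n k : ℕ}

namespace Plan

variable (P : Plan n k)

/-- One step of the descent to the join result at position (register `12`): choose the row of stage
`i`. The interval of the results that extend the rows chosen so far starts at register `13` and has
the length in register `14`; the attribute values chosen so far are in bank `0`. -/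
noncomputable def locStage (i : ℕ) : Cmd :=
  .block [P.group i, .loadArr k 8 (2 * i + 1) (.reg 6), .loadArr k 9 (2 * i + 1) (.reg 7),
    .set 14 (.reg 14 / (.reg 9 - .reg 8)), .set 16 (.reg 8 + (.reg 12 - .reg 13) / .reg 14),
    .set 1 (.reg 6), .set 2 (.reg 7),
    .bsearch (.seq (.loadArr k 5 (2 * i + 1) (.reg 3 + .const 1))
      (.ite (.le (.reg 5) (.reg 16)) (.set 4 (.const 0)) (.set 4 (.const 1)))),
    .loadArr k 5 (2 * i + 1) (.reg 1), .loadArr k 9 (2 * i + 1) (.reg 1 + .const 1),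
    .set 13 (.reg 13 + .reg 14 * (.reg 5 - .reg 8)), .set 14 (.reg 14 * (.reg 9 - .reg 5)),
    .loadArr k 5 (2 * i) (.reg 1), P.loadCols 0 i 5 (P.sch i).toList]

/-- The descent through the stages from `i` on; here `d` is their number. -/
noncomputable def locate (d i : ℕ) : Cmd := .block ((List.range' i d).map P.locStage)

end Plan

/-- The registers changed by `locStage`. -/
def locRegs (r : ℕ) : Prop :=
  (1 ≤ r ∧ r ≤ 9) ∨ (13 ≤ r ∧ r ≤ 16 ∧ r ≠ 15) ∨ (20 ≤ r ∧ r % 4 ≤ 1)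

theorem groupRegs_le {r : ℕ} (h : groupRegs r) : locRegs r := by
  unfold groupRegs at h
  unfold locRegs
  omega

theorem Keeps.ready' {P : Plan n k} {D : Data P} {X : ℕ} {s s' : State} (hs : D.Ready s)
    (h : Keeps locRegs X s s') : D.Ready s' :=
  hs.of_keeps h (by simp [locRegs]) fun j => by simp only [locRegs, bank]; omega

theorem exists_step {f : ℕ → ℝ} {lo hi : ℕ} (hlh : lo ≤ hi) {y : ℝ}
    (h1 : f lo ≤ y) (h2 : y < f hi) :
    ∃ q, lo ≤ q ∧ q < hi ∧ f q ≤ y ∧ y < f (q + 1) := by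
  induction hi, hlh using Nat.le_induction with
  | base => linarith
  | succ hi hlh ih =>
    rcases lt_or_ge y (f hi) with h | h
    · obtain ⟨q, h3, h4, h5⟩ := ih h
      exact ⟨q, h3, by omega, h5⟩
    · exact ⟨hi, hlh, by omega, h, h2⟩

set_option maxHeartbeats 1000000 in
theorem exists_wp_locStage (P : Plan n k) {i : ℕ} (hi : i < k) : ∃ B, ∀ (D : Data P) (X : Index)
    (s : State) (v : Fin n → ℝ) (j : ℕ), D.Ready s → (∀ i < k, D.Stage X i) →
    (∀ i < k, D.Has X i s.mem) → (∀ a : Fin n, s.reg (bank 0 a) = v a) → D.total < 2 ^ j →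
    s.reg 14 = D.tot X i v → s.reg 13 ≤ s.reg 12 → s.reg 12 < s.reg 13 + s.reg 14 →
    wp (P.locStage i) s fun s' => Keeps locRegs D.cap s s' ∧
      s'.time ≤ s.time + B * (j + 1) ∧ ∃ q, D.lo X i v ≤ q ∧ q < D.hi X i v ∧
      (∀ a : Fin n, s'.reg (bank 0 a) = D.ext i v (X.perm i q) a) ∧
      s'.reg 13 = s.reg 13 + D.rest X i v * (X.pre i q - X.pre i (D.lo X i v)) ∧
      s'.reg 14 = D.tot X (i + 1) (D.ext i v (X.perm i q)) ∧
      s'.reg 13 ≤ s.reg 12 ∧ s.reg 12 < s'.reg 13 + s'.reg 14 := by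
  obtain ⟨B₁, hB₁⟩ := exists_wp_group P hi
  refine ⟨B₁ + 8 * (P.sch i).toList.length + 150, fun D X s v j hs hX hmem hv hj h14 hl hr => ?_⟩
  have hm := D.m_le_total hi
  have hlh := D.lo_le_hi (X := X) i v
  have hhm := D.hi_le (X := X) i v
  have hT : D.tot X i v = D.rest X i v * D.grp X i v := D.tot_eq hi v
  have hTpos : 0 < D.tot X i v := by rw [← h14]; linarith
  have hA0 : D.grp X i v ≠ 0 := by rintro h; rw [h, mul_zero] at hT; linarith
  have hApos : 0 < D.grp X i v := lt_of_le_of_ne (D.grp_nonneg hX hi v) hA0.symm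
  have hR : D.tot X i v / D.grp X i v = D.rest X i v := by rw [hT, mul_div_cancel_right₀ _ hA0]
  have hRpos : 0 < D.rest X i v := by rw [← hR]; exact div_pos hTpos hApos
  have hgrp : X.pre i (D.hi X i v) - X.pre i (D.lo X i v) = D.grp X i v := rfl
  set y := X.pre i (D.lo X i v) + (s.reg 12 - s.reg 13) / D.rest X i v with hy
  obtain ⟨q, hq1, hq2, hq3, hq4⟩ := exists_step (f := X.pre i) hlh (y := y)
    (by have := div_nonneg (sub_nonneg.2 hl) hRpos.le; linarith)
    (by
      have : (s.reg 12 - s.reg 13) / D.rest X i v < D.grp X i v := by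
        rw [div_lt_iff₀ hRpos, mul_comm, ← hT, ← h14]; linarith
      linarith)
  have hy' : s.reg 12 = s.reg 13 + D.rest X i v * (y - X.pre i (D.lo X i v)) := by
    rw [hy]; field_simp; ring
  have hfin1 : s.reg 13 + D.rest X i v * (X.pre i q - X.pre i (D.lo X i v)) ≤ s.reg 12 := by
    rw [hy']
    gcongr
  have hfin2 : s.reg 12 < s.reg 13 + D.rest X i v * (X.pre i q - X.pre i (D.lo X i v)) +
      D.rest X i v * (X.pre i (q + 1) - X.pre i q) := by
    rw [hy', add_assoc, ← mul_add]
    gcongr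
    linarith
  refine wp_block_cons ((hB₁ D X s v j hs (hX i hi).toSorted (hmem i hi).toHasPerm
    (fun a _ => hv a) (by omega)).mono fun s1 ⟨hK0, h16, h17, ht1⟩ => ?_)
  have hK1 := hK0.mono (fun r => groupRegs_le)
  have hs1 := hK1.ready' hs
  have e12 : s1.reg 12 = s.reg 12 := hK0.reg _ (by simp [groupRegs])
  have e13 : s1.reg 13 = s.reg 13 := hK0.reg _ (by simp [groupRegs])
  have e14 : s1.reg 14 = s.reg 14 := hK0.reg _ (by simp [groupRegs])
  have hM : ∀ r, r ∈ [1, 2, 5, 8, 9, 13, 14, 16] → locRegs r := by simp [locRegs]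
  have hpre : ∀ q ≤ D.m i, s.mem (D.cell (2 * i + 1) q) = X.pre i q := (hmem i hi).pre
  refine wp_block_cons (wp_loadArr_keeps (j := D.lo X i v) hK1 (hM _ (by simp)) hs1.base
    (by simpa using h16) (by omega) (by omega) fun s2 hK2 e2 n2 t2 => ?_)
  rw [hpre _ (hlh.trans hhm)] at e2
  refine wp_block_cons (wp_loadArr_keeps (j := D.hi X i v) hK2 (hM _ (by simp))
    (hK2.ready' hs).base (by simp [n2, h17]) (by omega) (by omega) fun s3 hK3 e3 n3 t3 => ?_)
  rw [hpre _ hhm] at e3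
  refine wp_block_cons (wp_set_keeps hK3 (hM _ (by simp)) fun s4 hK4 e4 n4 t4 => ?_)
  have e4 : s4.reg 14 = D.rest X i v := by simp [e4, e3, n3, e2, n2, e14, h14, hgrp, hR]
  refine wp_block_cons (wp_set_keeps hK4 (hM _ (by simp)) fun s5 hK5 e5 n5 t5 => ?_)
  have e5 : s5.reg 16 = y := by simp [e5, e4, n4, n3, e2, n2, e12, e13, hy]
  refine wp_block_cons (wp_set_keeps hK5 (hM _ (by simp)) fun s6 hK6 e6 n6 t6 => ?_)
  refine wp_block_cons (wp_set_keeps hK6 (hM _ (by simp)) fun s7 hK7 e7 n7 t7 => ?_)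
  -- the binary search
  refine wp_block_cons ((wp_bsearch (M := fun r => r = 4 ∨ r = 5) (X := D.cap) (s₀ := s7)
    (lo := D.lo X i v) (hi := D.hi X i v) (r := q) (B := 30) (by simp) (by simp) (by simp) hq1 hq2.le
    ?_ j (D.lo X i v) (D.hi X i v) s7 le_rfl hq1 hq2.le le_rfl (by omega)
    (by simp [n7, e6, n5, n4, n3, n2, h16]) (by simp [e7, n6, n5, n4, n3, n2, h17])
    Keeps.refl).mono fun s8 ⟨hK8, h81, t8⟩ => ?_)
  · intro q' u h1 h2 hKu hu3
    have hu0 : u.reg 0 = D.base := by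
      rw [hKu.reg 0 (by simp)]; exact (hK7.ready' hs).base
    have hu16 : u.reg 16 = y := by rw [hKu.reg 16 (by simp)]; simp [n7, n6, e5]
    refine wp_seq (wp_loadArr_keeps (j := q' + 1) (M := fun r => r = 4 ∨ r = 5)
      Keeps.refl (Or.inr rfl) hu0 (by simp [hu3]) (by omega) (by omega) fun w1 hKw ew nw tw => ?_)
    rw [hKu.mem, hK7.mem, hpre _ (by omega)] at ew
    refine wp_ite (fun h => wp_set_keeps (hKw.tick _) (Or.inl rfl) fun w2 hKw2 ew2 _ tw2 =>
      ⟨hKw2, ?_, ?_⟩) fun h => wp_set_keeps (hKw.tick _) (Or.inl rfl) fun w2 hKw2 ew2 _ tw2 =>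
      ⟨hKw2, ?_, ?_⟩
    · simp [ew, nw, hu16] at h
      have : ¬ q ≤ q' := fun hqq => by
        have := D.pre_mono hX hi (Nat.succ_le_succ hqq) (by omega)
        simp only [Nat.succ_eq_add_one] at this
        linarith
      simp [ew2, this]
    · simp [State.tick] at tw tw2; omega
    · simp [ew, nw, hu16] at h
      have : q ≤ q' := by
        by_contra hqq
        have := D.pre_mono hX hi (show q' + 1 ≤ q by omega) (by omega)
        linarith
      simp [ew2, this]
    · simp [State.tick] at tw tw2; omega
  have n8 : ∀ x, 6 ≤ x → s8.reg x = s7.reg x := fun x hx => hK8.reg x (by omega)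
  have hK8 := hK7.trans (hK8.mono (M' := locRegs) fun r h => by simp only [locRegs]; omega)
  refine wp_block_cons (wp_loadArr_keeps (j := q) hK8 (hM _ (by simp)) (hK8.ready' hs).base
    (by simpa using h81) (by omega) (by omega) fun s9 hK9 e9 n9 t9 => ?_)
  rw [hpre _ (by omega)] at e9
  refine wp_block_cons (wp_loadArr_keeps (j := q + 1) hK9 (hM _ (by simp)) (hK9.ready' hs).base
    (by simp [n9, h81]) (by omega) (by omega) fun s10 hK10 e10 n10 t10 => ?_)
  rw [hpre _ (by omega)] at e10
  refine wp_block_cons (wp_set_keeps hK10 (hM _ (by simp)) fun s11 hK11 e11 n11 t11 => ?_)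
  refine wp_block_cons (wp_set_keeps hK11 (hM _ (by simp)) fun s12 hK12 e12' n12 t12 => ?_)
  refine wp_block_cons (wp_loadArr_keeps (j := q) hK12 (hM _ (by simp)) (hK12.ready' hs).base
    (by simp [n12, n11, n10, n9, h81]) (by omega) (by omega) fun s13 hK13 e15 n13 t13 => ?_)
  rw [(hmem i hi).perm q (by omega)] at e15
  have hp := (hX i hi).maps q (by omega)
  refine wp_block_cons ((wp_loadCols (b := 0) hi (by norm_num) (by norm_num) hp.le _ s13
    (hK13.ready' hs) e15 (fun a ha => Finset.mem_toList.1 ha) (Finset.nodup_toList _)).mono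
    fun s14 ⟨hK14, v14, t14⟩ => wp_block_nil ?_)
  have n14 : ∀ x, x < 20 → s14.reg x = s13.reg x := fun x hx => hK14.reg x (by
    rintro ⟨a, _, h⟩; simp only [bank] at h; omega)
  have hL : s14.reg 13 = s.reg 13 + D.rest X i v * (X.pre i q - X.pre i (D.lo X i v)) := by
    simp [n14, n13, n12, e11, n10, e9, n9, n8, n7, n6, n5, e4, n4, n3, e2, n2, e13]
  have hT' : s14.reg 14 = D.rest X i v * (X.pre i (q + 1) - X.pre i q) := by
    simp [n14, n13, e12', n11, e10, n10, e9, n9, n8, n7, n6, n5, e4]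
  refine ⟨?_, ?_, q, hq1, hq2, ?_, ?_, ?_, ?_, ?_⟩
  · refine (hK13.trans (hK14.mono ?_)).tick _
    rintro r ⟨a, _, rfl⟩
    simp only [locRegs, bank]; omega
  · simp at t2 t3 t4 t5 t6 t7 t9 t10 t11 t12 t13
    simp only [State.tick]
    have : (B₁ + 8 * (P.sch i).toList.length + 150) * (j + 1) = B₁ * (j + 1) + j * 50 + j * 100
      + j * (8 * (P.sch i).toList.length) + 8 * (P.sch i).toList.length + 150 := by ring
    omega
  · intro a
    simp only [State.tick, Data.ext]
    split_ifs with h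
    · exact v14 hp a (Finset.mem_toList.2 h)
    · rw [hK14.reg _ (by
        rintro ⟨a', h1, h2⟩
        have : a = a' := Fin.ext (by simp only [bank] at h2; omega)
        exact h (this ▸ Finset.mem_toList.1 h1)), ← hv a]
      simp only [bank]
      rw [n13 _ (by omega), n12 _ (by omega), n11 _ (by omega), n10 _ (by omega), n9 _ (by omega),
        n8 _ (by omega), n7 _ (by omega), n6 _ (by omega), n5 _ (by omega), n4 _ (by omega),
        n3 _ (by omega), n2 _ (by omega)]
      exact hK0.reg _ (by simp only [groupRegs]; omega)
  · exact hL
  · rw [D.tot_ext (hX i hi) hq1 hq2]; exact hT'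
  · simp only [State.tick]
    rw [hL]
    exact hfin1
  · simp only [State.tick]
    rw [hL, hT']
    exact hfin2

end SubsetSamplingJoin

namespace SubsetSamplingJoin

variable {n k : ℕ}

theorem exists_wp_locate (P : Plan n k) : ∀ (d i : ℕ), i + d = k → ∃ B, ∀ (D : Data P) (X : Index)
    (s : State) (v : Fin n → ℝ) (j : ℕ), D.Ready s → (∀ i < k, D.Stage X i) →
    (∀ i < k, D.Has X i s.mem) → (∀ a : Fin n, s.reg (bank 0 a) = v a) → D.total < 2 ^ j →
    s.reg 14 = D.tot X i v → s.reg 13 ≤ s.reg 12 → s.reg 12 < s.reg 13 + s.reg 14 →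
    wp (P.locate d i) s fun s' => Keeps locRegs D.cap s s' ∧
      s'.time ≤ s.time + B * (j + 1) ∧ ∃ L₁ u L₂, D.leaves X d i v = L₁ ++ u :: L₂ ∧
      (∀ a : Fin n, s'.reg (bank 0 a) = u a) ∧
      s'.reg 13 = s.reg 13 + (L₁.map D.weight).sum ∧ s'.reg 14 = D.weight u ∧
      s'.reg 13 ≤ s.reg 12 ∧ s.reg 12 < s'.reg 13 + s'.reg 14 := by
  intro d
  induction d with
  | zero =>
    intro i hi
    refine ⟨1, fun D X s v j hs hX hmem hv hj h14 hl hr => wp_block_nil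
      ⟨Keeps.refl.tick _, ?_, [], v, [], rfl, hv, ?_, ?_, hl, hr⟩⟩
    · simp [State.tick]
    · simp [State.tick]
    · have := D.sum_leaves hX 0 i hi v
      simp only [Data.leaves, List.map_cons, List.map_nil, List.sum_cons, List.sum_nil,
        add_zero] at this
      rw [this, ← h14]
      rfl
  | succ d ih =>
    intro i hi
    obtain ⟨B₁, h₁⟩ := exists_wp_locStage P (show i < k by omega)
    obtain ⟨B₂, h₂⟩ := ih (i + 1) (by omega)
    refine ⟨B₁ + B₂, fun D X s v j hs hX hmem hv hj h14 hl hr => ?_⟩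
    rw [Plan.locate, List.range'_succ, List.map_cons]
    refine wp_block_cons ((h₁ D X s v j hs hX hmem hv hj h14 hl hr).mono
      fun s1 ⟨hK1, t1, q, hq1, hq2, v1, e13, e14, hl1, hr1⟩ => ?_)
    have e12 : s1.reg 12 = s.reg 12 := hK1.reg _ (by simp [locRegs])
    refine (h₂ D X s1 _ j (hK1.ready' hs) hX (by rw [hK1.mem]; exact hmem) v1 hj e14
      (by rw [e12]; exact hl1) (by rw [e12]; exact hr1)).mono
      fun s2 ⟨hK2, t2, L₁, u, L₂, hL, v2, e13', e14', hl2, hr2⟩ => ?_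
    obtain ⟨M₁, M₂, hM, hsum⟩ := D.leaves_split hX hi hq1 hq2
    rw [e12] at hl2 hr2
    refine ⟨hK1.trans hK2, ?_, M₁ ++ L₁, u, L₂ ++ M₂, ?_, v2, ?_, e14', hl2, hr2⟩
    · have : (B₁ + B₂) * (j + 1) = B₁ * (j + 1) + B₂ * (j + 1) := by ring
      omega
    · rw [hM, hL]; simp
    · rw [e13', e13, List.map_append, List.sum_append, hsum]; ring

/-! ### Queries -/

namespace Plan

variable (P : Plan n k)

/-- One step of the sampling process. Register `10` holds the current position, register `11` the
total weight. -/
noncomputable def queryStep : Cmd :=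
  .block [.rand 15, .set 12 ((.const 0 - .un .log (.reg 15)) / .const 2),
    .ite (.le (.const 1 / .const 2) (.reg 12)) (.set 12 (.const 1 / .const 2)) .skip,
    .set 12 (.reg 10 + .reg 12),
    .ite (.le (.reg 11) (.reg 12)) (.set 10 (.reg 11))
      (.block [.set 13 (.const 0), .set 14 (.reg 11), P.locate k 0, .rand 15,
        .set 9 (.reg 13 + .reg 14),
        .ite (.le (.reg 9) (.reg 10 + .const 1 / .const 2))
          (.set 8 (.reg 14 / (.const 1 - .un .exp (.const 0 - .const 2 * .reg 14))))
          (.set 8 (.reg 14)),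
        .ite (.le (.reg 15) (.reg 8)) (.emit (List.ofFn fun a : Fin n => .reg (bank 0 a))) .skip,
        .set 10 (.reg 9)])]

/-- The program that answers a query. -/
noncomputable def query : Cmd :=
  .block [.load 2 (.const (P.src 0)), .loadArr k 11 1 (.reg 2), .set 10 (.const 0),
    .while (.not (.le (.reg 11) (.reg 10))) P.queryStep]

end Plan

/-- The fragment that led from `s` to `s'` has changed neither the memory nor the registers that
describe the layout. -/
structure SameIndex (s s' : State) : Prop where
  mem : s'.mem = s.mem
  base : s'.reg 0 = s.reg 0
  off : ∀ j, s'.reg (bank 3 j) = s.reg (bank 3 j)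

theorem SameIndex.trans {s s' s'' : State} (h : SameIndex s s') (h' : SameIndex s' s'') :
    SameIndex s s'' :=
  ⟨h'.mem.trans h.mem, h'.base.trans h.base, fun j => (h'.off j).trans (h.off j)⟩

/-- The registers changed by a query. -/
def queryRegs (r : ℕ) : Prop := (1 ≤ r ∧ r ≤ 19) ∨ (20 ≤ r ∧ r % 4 ≤ 1)

theorem Keeps.sameIndex {X : ℕ} {s s' : State} (h : Keeps queryRegs X s s') : SameIndex s s' :=
  ⟨h.mem, h.reg 0 (by simp [queryRegs]), fun j => h.reg _ (by simp only [queryRegs, bank]; omega)⟩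

theorem SameIndex.ready {P : Plan n k} {D : Data P} {s s' : State} (h : SameIndex s s')
    (hs : D.Ready s) : D.Ready s' :=
  ⟨h.base.trans hs.base, fun i hi => (h.off _).trans (hs.off i hi), fun a ha => by
    rw [h.mem]; exact hs.inp a ha⟩

theorem locRegs_le {r : ℕ} (h : locRegs r) : queryRegs r := by
  unfold locRegs at h
  unfold queryRegs
  omega

theorem wp_rand_same {r : ℕ} {s : State} {Q : State → Prop} (hr : 1 ≤ r ∧ r ≤ 19)
    (h : ∀ s', SameIndex s s' → s'.reg r = s.tape 0 → (∀ x, x ≠ r → s'.reg x = s.reg x) →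
      s'.tape = s.tape.tail → s'.out = s.out → s'.time = s.time + 1 → Q s') : wp (.rand r) s Q := by
  have hne : ∀ x, x ≠ r → ((s.rand r).tick 1).reg x = s.reg x := fun x hx => by
    simp [State.tick, State.rand, hx]
  refine wp_rand (h _ ⟨rfl, hne 0 (by omega), fun j => hne _ (by simp only [bank]; omega)⟩
    (by simp [State.tick, State.rand]) hne rfl rfl rfl)

theorem Data.weight_mem {P : Plan n k} {D : Data P} {X : Index} (hX : ∀ i < k, D.Stage X i)
    {v u : Fin n → ℝ} (hu : u ∈ D.leaves X k 0 v) : D.weight u ∈ Set.Icc (0 : ℝ) 1 := by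
  have h : ∀ j ∈ Finset.range k, D.wt j u ∈ Set.Icc (0 : ℝ) 1 := fun j hj => by
    obtain ⟨t, ht, h⟩ := ((D.mem_leaves hX k 0 (by omega) v u).1 hu).2 j (by omega)
      (Finset.mem_range.1 hj)
    rw [D.wt_congr j u _ h]
    exact D.wt_mem j (Finset.mem_range.1 hj) t ht
  exact ⟨Finset.prod_nonneg fun j hj => (h j hj).1,
    Finset.prod_le_one (fun j hj => (h j hj).1) fun j hj => (h j hj).2⟩

set_option maxHeartbeats 1000000 in
theorem exists_wp_queryLoop (P : Plan n k) : ∃ B, ∀ (D : Data P) (X : Index) (j : ℕ),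
    (∀ i < k, D.Stage X i) → D.total < 2 ^ j → ∀ (N : ℕ) (L₀ l : List (Fin n → ℝ)) (s : State),
    l.length ≤ N → D.leaves X k 0 0 = L₀ ++ l → D.Ready s → (∀ i < k, D.Has X i s.mem) →
    s.reg 10 = (L₀.map D.weight).sum → s.reg 11 = ((L₀ ++ l).map D.weight).sum →
    wp (.while (.not (.le (.reg 11) (.reg 10))) P.queryStep) s fun s' => SameIndex s s' ∧
      s'.out = s.out ++ (kept (process D.weight l s.tape)).map List.ofFn ∧
      s'.time ≤ s.time + B * (j + 1) * (process D.weight l s.tape).length + B := by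
  obtain ⟨B₁, h₁⟩ := exists_wp_locate P k 0 (by omega)
  set E := ((List.ofFn fun a : Fin n => Expr.reg (bank 0 a)).map Expr.cost).sum with hE
  refine ⟨B₁ + E + 200, fun D X j hX hj N => ?_⟩
  induction N with
  | zero =>
    intro L₀ l s hN hL hs hmem h10 h11
    obtain rfl : l = [] := by simpa using hN
    refine wp_while (fun h => absurd ?_ h) fun _ => ⟨⟨rfl, rfl, fun _ => rfl⟩, ?_, ?_⟩
    · simp [h10, h11]
    · simp [State.tick, process, hits, kept]
    · simp [State.tick]; omega
  | succ N ih =>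
    intro L₀ l s hN hL hs hmem h10 h11
    have hp : ∀ u ∈ L₀ ++ l, 0 ≤ D.weight u := fun u hu => (Data.weight_mem hX (hL ▸ hu)).1
    have hpl : ∀ u ∈ l, 0 ≤ D.weight u := fun u hu => hp u (by simp [hu])
    rw [List.map_append, List.sum_append] at h11
    refine wp_while (fun hlt => ?_) fun h => ?_
    swap
    · have h0 : (l.map D.weight).sum ≤ 0 := by simpa [h10, h11] using h
      have : process D.weight l s.tape = [] := hits_eq_nil hpl (by
        rw [zero_add]; exact h0.trans (stepLen_nonneg _))
      rw [this]
      refine ⟨⟨rfl, rfl, fun _ => rfl⟩, ?_, ?_⟩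
      · simp [State.tick, kept]
      · simp [State.tick]
    set z := stepLen (s.tape 0) with hz
    have hz0 : 0 ≤ z := stepLen_nonneg _
    have hproc : process D.weight l s.tape = hits D.weight l 0 z s.tape.tail := rfl
    have hx0 : 0 ≤ s.reg 10 := h10 ▸ sum_map_nonneg fun u hu => hp u (by simp [hu])
    refine wp_block_cons (wp_rand_same (by omega) fun s1 hS1 e1 n1 τ1 o1 t1 => ?_)
    have M : ∀ r, 1 ≤ r ∧ r ≤ 19 → queryRegs r := fun r hr => Or.inl hr
    refine wp_block_cons (wp_set_keeps (X := D.cap) Keeps.refl (M _ (by omega))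
      fun s2 hK2 e2 n2 t2 => ?_)
    have hcont : ∀ s3, Keeps queryRegs D.cap s1 s3 →
        s3.reg 12 = z → (∀ x, x ≠ 12 → s3.reg x = s2.reg x) → s3.time ≤ s2.time + 20 →
        wp (.block [.set 12 (.reg 10 + .reg 12),
          .ite (.le (.reg 11) (.reg 12)) (.set 10 (.reg 11))
          (.block [.set 13 (.const 0), .set 14 (.reg 11), P.locate k 0, .rand 15,
            .set 9 (.reg 13 + .reg 14),
            .ite (.le (.reg 9) (.reg 10 + .const 1 / .const 2))
              (.set 8 (.reg 14 / (.const 1 - .un .exp (.const 0 - .const 2 * .reg 14))))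
              (.set 8 (.reg 14)),
            .ite (.le (.reg 15) (.reg 8))
              (.emit (List.ofFn fun a : Fin n => .reg (bank 0 a))) .skip,
            .set 10 (.reg 9)])]) s3 fun s' => wp (.while (.not (.le (.reg 11) (.reg 10)))
              P.queryStep) s' fun s' => SameIndex s s' ∧
              s'.out = s.out ++ (kept (process D.weight l s.tape)).map List.ofFn ∧
              s'.time ≤ s.time + (B₁ + E + 200) * (j + 1) * (process D.weight l s.tape).length +
                (B₁ + E + 200) := by
      intro s3 hK3 e3 n3 t3
      have n3' : ∀ x, x ≠ 12 → x ≠ 15 → s3.reg x = s.reg x := fun x h12 h15 => by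
        rw [n3 x h12, n2 x h12, n1 x h15]; rfl
      have hS0 : SameIndex s s1 := ⟨hS1.mem, hS1.base, hS1.off⟩
      have t3' : s3.time ≤ s.time + 40 := by
        simp only [State.tick, Test.cost_not, Test.cost_le, Expr.cost_reg] at t1
        simp only [Expr.cost_div, Expr.cost_sub, Expr.cost_const, Expr.cost_un,
          Expr.cost_reg] at t2
        omega
      refine wp_block_cons (wp_set_keeps hK3 (M _ (by omega)) fun s4 hK4 e4 n4 t4 => ?_)
      have n4' : ∀ x, x ≠ 12 → x ≠ 15 → s4.reg x = s.reg x := fun x h12 h15 => by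
        rw [n4 x h12, n3' x h12 h15]
      simp only [Expr.eval_add, Expr.eval_reg, e3, n3' 10 (by omega) (by omega)] at e4
      simp only [Expr.cost_add, Expr.cost_reg] at t4
      refine wp_block_cons (wp_ite (fun hexit => ?_) fun hstay => ?_)
      · simp only [Test.holds_le, Expr.eval_reg, e4, n4' 11 (by omega) (by omega)] at hexit
        refine wp_set_keeps (hK4.tick _) (M _ (by omega)) fun s5 hK5 e5 n5 t5 =>
          wp_block_nil (wp_while (fun h => absurd ?_ h) fun _ => ?_)
        · simp only [Test.holds_le, Expr.eval_reg]
          exact (n5 11 (by omega)).trans_le e5.ge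
        have hnil : process D.weight l s.tape = [] := hproc ▸ hits_eq_nil hpl (by linarith)
        rw [hnil]
        refine ⟨?_, ?_, ?_⟩
        · exact hS0.trans (((hK5.tick 1).tick _).sameIndex)
        · change s5.out = _
          rw [hK5.out, o1]; simp [State.tick, kept]
        · simp only [State.tick, Test.cost_not, Test.cost_le, Expr.cost_reg] at t5 ⊢
          simp only [List.length_nil]
          omega
      simp only [Test.holds_le, Expr.eval_reg, e4, n4' 11 (by omega) (by omega), not_le]
        at hstay
      refine wp_block_cons (wp_set_keeps (hK4.tick _) (M _ (by omega))
        fun s5 hK5 e5 n5 t5 => ?_)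
      refine wp_block_cons (wp_set_keeps hK5 (M _ (by omega)) fun s6 hK6 e6 n6 t6 => ?_)
      have n6' : ∀ x, x ≠ 12 → x ≠ 13 → x ≠ 14 → x ≠ 15 → s6.reg x = s.reg x :=
        fun x h12 h13 h14 h15 => by
          rw [n6 x h14, n5 x h13]; exact n4' x h12 h15
      have e6_12 : s6.reg 12 = s.reg 10 + z := by
        rw [n6 _ (by omega), n5 _ (by omega)]; exact e4
      have e6_13 : s6.reg 13 = 0 := by rw [n6 _ (by omega), e5]; simp
      have e6_14 : s6.reg 14 = s.reg 11 := by
        rw [e6, Expr.eval_reg, n5 _ (by omega)]; exact n4' 11 (by omega) (by omega)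
      have hleaf : ∀ v, D.leaves X k 0 v = L₀ ++ l := fun v => by
        rw [← hL]; exact D.leaves_congr k 0 (by omega) v 0 fun j hj => by omega
      have hS6 : SameIndex s s6 := hS0.trans hK6.sameIndex
      refine wp_block_cons ((h₁ D X s6 (fun a => s6.reg (bank 0 a)) j (hS6.ready hs) hX
        (by rw [hS6.mem]; exact hmem) (fun a => rfl) hj ?_ ?_ ?_).mono
        fun s7 ⟨hK7, t7, L₁, u, L₂, hsplit, v7, e13, e14, hl7, hr7⟩ => ?_)
      · rw [e6_14, ← D.sum_leaves hX k 0 (by omega), hleaf, h11, List.map_append,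
          List.sum_append]
      · rw [e6_12, e6_13]; linarith
      · rw [e6_12, e6_13, e6_14]; linarith
      rw [hleaf] at hsplit
      rw [e6_13, zero_add] at e13
      rw [e6_12, e13] at hl7 hr7
      rw [e14] at hr7
      rw [h10] at hl7 hr7
      obtain ⟨hlen, hhits⟩ := hits_eq_of_located hsplit hp hz0 hl7 hr7 s.tape.tail
      have n7 : ∀ x, ¬ locRegs x → s7.reg x = s6.reg x := hK7.reg
      have hS7 : SameIndex s s7 := hS6.trans (hK7.mono fun r => locRegs_le).sameIndex
      have hτ7 : s7.tape = s.tape.tail := by rw [hK7.tape, hK6.tape, τ1]; rfl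
      have ho7 : s7.out = s.out := by rw [hK7.out, hK6.out, o1]; rfl
      refine wp_block_cons (wp_rand_same (by omega) fun s8 hS8 e8 n8 τ8 o8 t8 => ?_)
      refine wp_block_cons (wp_set_keeps (X := D.cap) Keeps.refl (M _ (by omega))
        fun s9 hK9 e9 n9 t9 => ?_)
      simp only [Expr.eval_add, Expr.eval_reg, n8 13 (by omega), n8 14 (by omega), e13, e14]
        at e9
      have n9' : ∀ x, x ≠ 9 → x ≠ 15 → s9.reg x = s7.reg x := fun x h9 h15 => by
        rw [n9 x h9, n8 x h15]
      have e9_10 : s9.reg 10 = (L₀.map D.weight).sum := by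
        rw [n9' _ (by omega) (by omega), n7 _ (by simp [locRegs]),
          n6' _ (by omega) (by omega) (by omega) (by omega), h10]
      have e9_11 : s9.reg 11 = ((L₀ ++ l).map D.weight).sum := by
        rw [n9' _ (by omega) (by omega), n7 _ (by simp [locRegs]),
          n6' _ (by omega) (by omega) (by omega) (by omega), h11, List.map_append,
          List.sum_append]
      have e9_14 : s9.reg 14 = D.weight u := by rw [n9' _ (by omega) (by omega), e14]
      have e9_15 : s9.reg 15 = s.tape.tail 0 := by rw [n9 _ (by omega), e8, hτ7]
      set kp := keepProb ((L₁.map D.weight).sum - (L₀.map D.weight).sum) (D.weight u) with hkp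
      have hcont2 : ∀ s10, Keeps queryRegs D.cap s8 s10 → s10.reg 8 = kp →
          (∀ x, x ≠ 8 → s10.reg x = s9.reg x) → s10.time ≤ s9.time + 20 →
          wp (.block [.ite (.le (.reg 15) (.reg 8))
              (.emit (List.ofFn fun a : Fin n => .reg (bank 0 a))) .skip,
            .set 10 (.reg 9)]) s10 fun s' => wp (.block []) s' fun s' =>
            wp (.while (.not (.le (.reg 11) (.reg 10)))
              P.queryStep) s' fun s' => SameIndex s s' ∧
              s'.out = s.out ++ (kept (process D.weight l s.tape)).map List.ofFn ∧
              s'.time ≤ s.time + (B₁ + E + 200) * (j + 1) * (process D.weight l s.tape).length +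
                (B₁ + E + 200) := by
        intro s10 hK10 e10 n10 t10
        have n10' : ∀ x, x ≠ 8 → x ≠ 9 → x ≠ 15 → s10.reg x = s7.reg x :=
          fun x h8 h9 h15 => by rw [n10 x h8, n9' x h9 h15]
        have hS10 : SameIndex s s10 := (hS7.trans hS8).trans hK10.sameIndex
        have hτ10 : s10.tape = s.tape.tail.tail := by rw [hK10.tape, τ8, hτ7]
        have ho10 : s10.out = s.out := by rw [hK10.out, o8, ho7]
        have hfin : ∀ s11 : State, s11.reg = s10.reg → s11.mem = s10.mem →
            s11.tape = s10.tape → s11.out = s.out ++ (if (s.tape.tail 0 : ℝ) ≤ kp then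
              [List.ofFn u] else []) → s11.time ≤ s10.time + E + 20 →
            wp (.block [.set 10 (.reg 9)]) s11 fun s' => wp (.block []) s' fun s' =>
            wp (.while (.not (.le (.reg 11) (.reg 10)))
              P.queryStep) s' fun s' => SameIndex s s' ∧
              s'.out = s.out ++ (kept (process D.weight l s.tape)).map List.ofFn ∧
              s'.time ≤ s.time + (B₁ + E + 200) * (j + 1) * (process D.weight l s.tape).length +
                (B₁ + E + 200) := by
          intro s11 r11 m11 τ11 o11 t11
          have hS11 : SameIndex s s11 :=
            ⟨m11.trans hS10.mem, (congrFun r11 0).trans hS10.base,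
              fun j => (congrFun r11 _).trans (hS10.off j)⟩
          refine wp_block_cons (wp_set_keeps (X := D.cap) Keeps.refl (M _ (by omega))
            fun s12 hK12 e12 n12 t12 => wp_block_nil (wp_block_nil ?_))
          have hS12 : SameIndex s ((s12.tick 1).tick 1) :=
            hS11.trans ((hK12.tick 1).tick 1).sameIndex
          have hsplit' : L₀ ++ l = (L₁ ++ [u]) ++ L₂ := by rw [hsplit]; simp
          refine (ih (L₁ ++ [u]) L₂ _ (by omega) (by rw [hL, hsplit']) (hS12.ready hs)
            (by rw [hS12.mem]; exact hmem) ?_ ?_).mono fun s13 ⟨hS13, o13, t13⟩ =>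
              ⟨hS12.trans hS13, ?_, ?_⟩
          · change s12.reg 10 = _
            rw [e12, Expr.eval_reg, r11, n10 _ (by omega), e9]
            simp
          · change s12.reg 11 = _
            rw [n12 _ (by omega), r11, n10 _ (by omega), e9_11, hsplit']
          · have hτ : ((s12.tick 1).tick 1).tape = s.tape.tail.tail := by
              change s12.tape = _
              rw [hK12.tape, τ11, hτ10]
            rw [o13, hτ, hproc, hhits, kept_cons]
            change s12.out ++ _ = _
            rw [hK12.out, o11]
            split_ifs <;> simp
          · have hτ : ((s12.tick 1).tick 1).tape = s.tape.tail.tail := by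
              change s12.tape = _
              rw [hK12.tape, τ11, hτ10]
            rw [hτ] at t13
            rw [hproc, hhits, List.length_cons]
            refine t13.trans ?_
            simp only [State.tick, Expr.cost_reg, Expr.cost_const, Expr.cost_add,
              Test.cost_le] at t5 t6 t7 t8 t9 t12 ⊢
            have e : (B₁ + E + 200) * (j + 1) *
              ((process D.weight L₂ s.tape.tail.tail).length + 1) = (B₁ + E + 200) * (j + 1) *
              (process D.weight L₂ s.tape.tail.tail).length + B₁ * (j + 1) + E * j + E +
                200 * j + 200 := by ring
            rw [e]
            clear e
            generalize (B₁ + E + 200) * (j + 1) *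
              (process D.weight L₂ s.tape.tail.tail).length = W at *
            generalize B₁ * (j + 1) = V at *
            generalize E * j = V' at *
            omega
        refine wp_block_cons (wp_ite (fun h => ?_) fun h => ?_)
        · simp only [Test.holds_le, Expr.eval_reg, e10, n10 15 (by omega), e9_15] at h
          refine wp_emit (hfin _ rfl rfl rfl ?_ ?_)
          · rw [if_pos h]
            simp only [State.tick, State.emit, ho10, List.map_ofFn]
            congr 3
            funext a
            simp only [Function.comp_apply, Expr.eval_reg]
            rw [n10' _ (by simp only [bank]; omega) (by simp only [bank]; omega)
              (by simp only [bank]; omega), v7]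
          · simp only [State.tick, State.emit, Test.cost_le, Expr.cost_reg]
            omega
        · simp only [Test.holds_le, Expr.eval_reg, e10, n10 15 (by omega), e9_15] at h
          refine wp_skip (hfin _ rfl rfl rfl ?_ ?_)
          · rw [if_neg h]
            simp [State.tick, ho10]
          · simp only [State.tick, Test.cost_le, Expr.cost_reg]
            omega
      have htest : (Test.le (.reg 9) (.reg 10 + .const 1 / .const 2)).holds s9.reg ↔
          (L₁.map D.weight).sum - (L₀.map D.weight).sum + D.weight u ≤ 1 / 2 := by
        simp only [Test.holds_le, Expr.eval_reg, Expr.eval_add, Expr.eval_div, Expr.eval_const,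
          e9, e9_10, Int.cast_one, Int.cast_ofNat]
        constructor <;> intro h <;> linarith
      refine wp_block_cons (wp_ite (fun h => ?_) fun h => ?_)
      · refine wp_set_keeps (hK9.tick _) (M _ (by omega)) fun s10 hK10 e10 n10 t10 => ?_
        refine hcont2 s10 hK10 ?_ n10 ?_
        · rw [e10, hkp, keepProb, if_pos (htest.1 h)]
          simp [State.tick, e9_14]
        · simp only [State.tick, Test.cost_le, Expr.cost_reg, Expr.cost_add, Expr.cost_div,
            Expr.cost_const, Expr.cost_sub, Expr.cost_un, Expr.cost_mul] at t10
          omega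
      · refine wp_set_keeps (hK9.tick _) (M _ (by omega)) fun s10 hK10 e10 n10 t10 => ?_
        refine hcont2 s10 hK10 ?_ n10 ?_
        · rw [e10, hkp, keepProb, if_neg (mt htest.2 h)]
          simp [State.tick, e9_14]
        · simp only [State.tick, Test.cost_le, Expr.cost_reg, Expr.cost_add, Expr.cost_div,
            Expr.cost_const] at t10
          omega
    have hz2 : s2.reg 12 = -Real.log (s.tape 0) / 2 := by
      rw [e2]
      simp only [Expr.eval_div, Expr.eval_sub, Expr.eval_const, Expr.eval_log, Expr.eval_reg, e1]
      simp [State.tick]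
    refine wp_block_cons (wp_ite (fun h => ?_) fun h => ?_)
    · simp only [Test.holds_le, Expr.eval_div, Expr.eval_const, Expr.eval_reg, hz2] at h
      refine wp_set_keeps (hK2.tick _) (M _ (by omega)) fun s3 hK3 e3 n3 t3 =>
        hcont s3 hK3 ?_ n3 ?_
      · rw [e3, hz, stepLen, min_eq_right (by push_cast at h; exact h)]
        simp
      · simp only [State.tick, Test.cost_le, Expr.cost_reg, Expr.cost_div,
          Expr.cost_const] at t3
        omega
    · simp only [Test.holds_le, Expr.eval_div, Expr.eval_const, Expr.eval_reg, hz2] at h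
      refine wp_skip (hcont _ ((hK2.tick _).tick _) ?_ (fun _ _ => rfl) ?_)
      · change s2.reg 12 = _
        rw [hz2, hz, stepLen, min_eq_left (by push_cast at h; exact (not_le.1 h).le)]
      · simp only [State.tick, Test.cost_le, Expr.cost_reg, Expr.cost_div,
          Expr.cost_const]
        omega

theorem exists_wp_query (P : Plan n k) (hk : 0 < k) : ∃ B, ∀ (D : Data P) (X : Index) (j : ℕ)
    (s : State), (∀ i < k, D.Stage X i) → D.total < 2 ^ j → D.Ready s →
    (∀ i < k, D.Has X i s.mem) → wp P.query s fun s' => SameIndex s s' ∧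
      s'.out = s.out ++ (kept (process D.weight (D.leaves X k 0 0) s.tape)).map List.ofFn ∧
      s'.time ≤ s.time + B * (j + 1) *
        (process D.weight (D.leaves X k 0 0) s.tape).length + B := by
  obtain ⟨B, hB⟩ := exists_wp_queryLoop P
  refine ⟨B + 20, fun D X j s hX hj hs hmem => ?_⟩
  have hm := D.m_le_total hk
  have hsrc : P.src 0 < D.base := (P.src_lt 0 hk).trans_le D.le_base
  have hcap : D.base < D.cap := by
    have : 0 < (2 * k + 1) * (2 * D.total + 3) := by positivity
    unfold Data.cap; omega
  have M : ∀ r, 1 ≤ r ∧ r ≤ 19 → queryRegs r := fun r hr => Or.inl hr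
  refine wp_block_cons (wp_load ?_)
  rw [Expr.addr_eq (show (Expr.const (P.src 0 : ℕ)).eval s.reg = (P.src 0 : ℕ) by simp)]
  have hK1 : Keeps queryRegs D.cap s ((s.load 2 (P.src 0)).tick
      (1 + (Expr.const (P.src 0 : ℕ)).cost)) :=
    (Keeps.refl.load (M _ (by omega)) (hsrc.trans hcap)).tick _
  refine wp_block_cons (wp_loadArr_keeps (D := D) (j := D.m 0) hK1 (M _ (by omega))
    (hK1.sameIndex.ready hs).base ?_ (by omega) (by omega) fun s2 hK2 e2 n2 t2 => ?_)
  · simp [State.tick, State.load, hs.inp _ hsrc, D.inp_size 0 hk]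
  refine wp_block_cons (wp_set_keeps hK2 (M _ (by omega)) fun s3 hK3 e3 n3 t3 =>
    wp_block_cons ?_)
  refine (hB D X j hX hj _ [] (D.leaves X k 0 0) s3 le_rfl rfl (hK3.sameIndex.ready hs)
    (by rw [hK3.mem]; exact hmem) (by simp [e3]) ?_).mono fun s4 ⟨hS4, o4, t4⟩ =>
      wp_block_nil ⟨hK3.sameIndex.trans ⟨hS4.mem, hS4.base, hS4.off⟩, ?_, ?_⟩
  · rw [n3 _ (by omega), e2, List.nil_append, D.sum_leaves hX k 0 (by omega),
      D.tot_zero hX hk]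
    exact (hmem 0 hk).pre _ le_rfl
  · rw [hK3.tape, hK3.out] at o4
    exact o4
  · rw [hK3.tape] at t4
    simp only [State.tick, State.load, Expr.cost_const, Expr.cost_reg] at t2 t3 ⊢
    have h5 : B * (j + 1) * (process D.weight (D.leaves X k 0 0) s.tape).length ≤
      (B + 20) * (j + 1) * (process D.weight (D.leaves X k 0 0) s.tape).length := by gcongr; omega
    omega

end SubsetSamplingJoin

namespace SubsetSamplingJoin

/-! ### Tournament trees -/

section Tournament

variable {α : Type*} [LinearOrder α] {K : ℕ → α} {M : ℕ} {T : ℕ → ℕ}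

/-- In the binary tree `T` with nodes `1, 2, …`, the entry of node `x` is one of those of its
children, with the smaller key. -/
structure IsWinner (K : ℕ → α) (T : ℕ → ℕ) (x : ℕ) : Prop where
  mem : T x = T (2 * x) ∨ T x = T (2 * x + 1)
  left : K (T x) ≤ K (T (2 * x))
  right : K (T x) ≤ K (T (2 * x + 1))

theorem IsWinner.update {x y w : ℕ} (h : IsWinner K T y) (h1 : y ≠ x) (h2 : y ≠ x / 2) :
    IsWinner K (Function.update T x w) y := by
  have e1 : Function.update T x w y = T y := Function.update_of_ne h1 _ _
  have e2 : Function.update T x w (2 * y) = T (2 * y) := Function.update_of_ne (by omega) _ _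
  have e3 : Function.update T x w (2 * y + 1) = T (2 * y + 1) :=
    Function.update_of_ne (by omega) _ _
  exact ⟨by rw [e1, e2, e3]; exact h.mem, by rw [e1, e2]; exact h.left,
    by rw [e1, e3]; exact h.right⟩

theorem IsWinner.update_self {x w : ℕ} (hx : 1 ≤ x) (h1 : w = T (2 * x) ∨ w = T (2 * x + 1))
    (h2 : K w ≤ K (T (2 * x))) (h3 : K w ≤ K (T (2 * x + 1))) :
    IsWinner K (Function.update T x w) x := by
  have e2 : Function.update T x w (2 * x) = T (2 * x) := Function.update_of_ne (by omega) _ _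
  have e3 : Function.update T x w (2 * x + 1) = T (2 * x + 1) :=
    Function.update_of_ne (by omega) _ _
  constructor <;> simp only [Function.update_self, e2, e3] <;> assumption

theorem key_root_le (h : ∀ y, 1 ≤ y → y < M → IsWinner K T y) (x : ℕ) :
    1 ≤ x → x < 2 * M → K (T 1) ≤ K (T x) := by
  induction x using Nat.strong_induction_on with
  | _ x ih =>
    intro h1 h2
    rcases h1.eq_or_lt with rfl | h1
    · exact le_rfl
    · have hw := h (x / 2) (by omega) (by omega)
      refine (ih (x / 2) (by omega) (by omega) (by omega)).trans ?_
      rcases Nat.mod_two_eq_zero_or_one x with hx | hx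
      · have := hw.left
        rwa [show 2 * (x / 2) = x by omega] at this
      · have := hw.right
        rwa [show 2 * (x / 2) + 1 = x by omega] at this

theorem exists_leaf_eq (h : ∀ y, 1 ≤ y → y < M → IsWinner K T y) (d : ℕ) : ∀ x, 2 * M ≤ x + d →
    1 ≤ x → x < 2 * M → ∃ j < M, T x = T (M + j) := by
  induction d using Nat.strong_induction_on with
  | _ d ih =>
    intro x h0 h1 h2
    by_cases hx : M ≤ x
    · exact ⟨x - M, by omega, by rw [Nat.add_sub_cancel' hx]⟩
    · rcases (h x h1 (by omega)).mem with e | e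
      · rw [e]; exact ih (d - 1) (by omega) _ (by omega) (by omega) (by omega)
      · rw [e]; exact ih (d - 1) (by omega) _ (by omega) (by omega) (by omega)

/-- The entries `p 0, …, p (q - 1)` have been removed from the tournament tree and are sorted. -/
structure Extracted (K : ℕ → α) (M : ℕ) (T p : ℕ → ℕ) (q : ℕ) : Prop where
  win : ∀ y, 1 ≤ y → y < M → IsWinner K T y
  le : ∀ x, 1 ≤ x → x < 2 * M → T x ≤ M
  maps : ∀ a < q, p a < M
  inj : ∀ a < q, ∀ b < q, p a = p b → a = b
  mono : ∀ a b, a ≤ b → b < q → K (p a) ≤ K (p b)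
  rest : ∀ a < q, ∀ j < M, (∀ b < q, p b ≠ j) → K (p a) ≤ K j
  leaf : ∀ j < M, (∀ b < q, p b ≠ j) → T (M + j) = j
  gone : ∀ b < q, T (M + p b) = M

theorem Extracted.root (hK : ∀ j < M, K j < K M) {p : ℕ → ℕ} {q : ℕ} (h : Extracted K M T p q)
    (hq : q < M) : T 1 < M ∧ (∀ b < q, p b ≠ T 1) ∧
      ∀ j < M, (∀ b < q, p b ≠ j) → K (T 1) ≤ K j := by
  have hle : ∀ j < M, (∀ b < q, p b ≠ j) → K (T 1) ≤ K j := fun j hj hb => by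
    have := key_root_le h.win (M + j) (by omega) (by omega)
    rwa [h.leaf j hj hb] at this
  obtain ⟨j, hj, hjq⟩ : ∃ j < M, ∀ b < q, p b ≠ j := by
    by_contra! hcon
    have h1 : Finset.range M ⊆ (Finset.range q).image p := fun j hj => by
      obtain ⟨b, hb, e⟩ := hcon j (Finset.mem_range.1 hj)
      exact Finset.mem_image.2 ⟨b, Finset.mem_range.2 hb, e⟩
    have h2 := (Finset.card_le_card h1).trans Finset.card_image_le
    simp only [Finset.card_range] at h2
    omega
  have hne : T 1 ≠ M := fun e => by
    have := hle j hj hjq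
    rw [e] at this
    exact absurd (hK j hj) this.not_gt
  obtain ⟨j', hj', e'⟩ := exists_leaf_eq h.win (2 * M) 1 (by omega) le_rfl (by omega)
  have hj'q : ∀ b < q, p b ≠ j' := fun b hb e => hne (by rw [e', ← e, h.gone b hb])
  rw [h.leaf j' hj' hj'q] at e'
  rw [← e'] at hj' hj'q
  exact ⟨hj', hj'q, hle⟩

theorem Extracted.step (hK : ∀ j < M, K j < K M) {p T' : ℕ → ℕ} {q : ℕ}
    (h : Extracted K M T p q) (hq : q < M) (hwin : ∀ y, 1 ≤ y → y < M → IsWinner K T' y)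
    (hle : ∀ x, 1 ≤ x → x < 2 * M → T' x ≤ M)
    (hleaf : ∀ j < M, T' (M + j) = if j = T 1 then M else T (M + j)) :
    Extracted K M T' (Function.update p q (T 1)) (q + 1) := by
  obtain ⟨h1, h2, h3⟩ := h.root hK hq
  have e : ∀ a < q, Function.update p q (T 1) a = p a := fun a ha =>
    Function.update_of_ne (by omega) _ _
  have e' : Function.update p q (T 1) q = T 1 := Function.update_self ..
  have hrem : ∀ j, (∀ b < q + 1, Function.update p q (T 1) b ≠ j) →
      (∀ b < q, p b ≠ j) ∧ j ≠ T 1 := fun j hj =>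
    ⟨fun b hb => by rw [← e b hb]; exact hj b (by omega), fun hj' => hj q (by omega) (by
      rw [e', hj'])⟩
  refine ⟨hwin, hle, fun a ha => ?_, fun a ha b hb hab => ?_, fun a b hab hb => ?_,
    fun a ha j hj hb => ?_, fun j hj hb => ?_, fun b hb => ?_⟩
  · rcases (Nat.lt_succ_iff.1 ha).lt_or_eq with ha | rfl
    · rw [e a ha]; exact h.maps a ha
    · rwa [e']
  · rcases (Nat.lt_succ_iff.1 ha).lt_or_eq with ha | rfl <;>
      rcases (Nat.lt_succ_iff.1 hb).lt_or_eq with hb | rfl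
    · rw [e a ha, e b hb] at hab; exact h.inj a ha b hb hab
    · rw [e a ha, e'] at hab; exact absurd hab (h2 a ha)
    · rw [e b hb, e'] at hab; exact absurd hab.symm (h2 b hb)
    · rfl
  · rcases (Nat.lt_succ_iff.1 hb).lt_or_eq with hb | rfl
    · rw [e a (by omega), e b hb]; exact h.mono a b hab hb
    · rcases hab.lt_or_eq with hab | rfl
      · rw [e a hab, e']; exact h.rest a hab _ h1 h2
      · exact le_rfl
  · obtain ⟨h4, h5⟩ := hrem j hb
    rcases (Nat.lt_succ_iff.1 ha).lt_or_eq with ha | rfl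
    · rw [e a ha]; exact h.rest a ha j hj h4
    · rw [e']; exact h3 j hj h4
  · obtain ⟨h4, h5⟩ := hrem j hb
    rw [hleaf j hj, if_neg h5, h.leaf j hj h4]
  · rcases (Nat.lt_succ_iff.1 hb).lt_or_eq with hb | rfl
    · rw [e b hb, hleaf _ (h.maps b hb), if_neg (h2 b hb), h.gone b hb]
    · rw [e', hleaf _ h1, if_pos rfl]

end Tournament

variable {n k : ℕ}

/-! ### Programs that write to arrays -/

/-- The fragment that led from `s` to `s'` has changed only registers in `M` and the arrays in
`A`. -/
structure Edits {P : Plan n k} (D : Data P) (M A : ℕ → Prop) (s s' : State) : Prop where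
  mem : ∀ x, (∀ a j, A a → x ≠ D.cell a j) → s'.mem x = s.mem x
  top : s'.top ≤ max s.top D.cap
  reg : ∀ r, ¬ M r → s'.reg r = s.reg r

section Edits

variable {P : Plan n k} {D : Data P} {M A : ℕ → Prop} {s s' s'' : State}

theorem Edits.refl : Edits D M A s s := ⟨fun _ _ => rfl, le_max_left _ _, fun _ _ => rfl⟩

theorem Edits.trans (h : Edits D M A s s') (h' : Edits D M A s' s'') : Edits D M A s s'' :=
  ⟨fun x hx => (h'.mem x hx).trans (h.mem x hx),
    h'.top.trans (max_le h.top (le_max_right _ _)),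
    fun r hr => (h'.reg r hr).trans (h.reg r hr)⟩

theorem Edits.mono {M' A' : ℕ → Prop} (h : Edits D M A s s') (hM : ∀ r, M r → M' r)
    (hA : ∀ r, A r → A' r) : Edits D M' A' s s' :=
  ⟨fun x hx => h.mem x fun a j ha => hx a j (hA a ha), h.top,
    fun r hr => h.reg r fun hr' => hr (hM r hr')⟩

theorem Keeps.edits (h : Keeps M D.cap s s') : Edits D M A s s' :=
  ⟨fun x _ => by rw [h.mem], h.top, h.reg⟩

theorem Edits.tick (h : Edits D M A s s') (t : ℕ) : Edits D M A s (s'.tick t) :=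
  ⟨h.mem, h.top, h.reg⟩

theorem Edits.setReg {r : ℕ} (h : Edits D M A s s') (hr : M r) (x : ℝ) :
    Edits D M A s (s'.setReg r x) :=
  h.trans (Keeps.edits (Keeps.refl.setReg hr x))

theorem Edits.mem_cell (h : Edits D M A s s') {a : ℕ} (ha : a ≤ 2 * k) (hA : ∀ a, A a → a ≤ 2 * k)
    (hna : ¬ A a) (j : ℕ) : s'.mem (D.cell a j) = s.mem (D.cell a j) :=
  h.mem _ fun a' _ ha' e => hna ((D.cell_inj ha (hA a' ha') e).1 ▸ ha')

theorem Edits.ready (hs : D.Ready s) (h : Edits D M A s s') (h0 : ¬ M 0)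
    (hM : ∀ j, ¬ M (bank 3 j)) : D.Ready s' :=
  ⟨(h.reg 0 h0).trans hs.base, fun i hi => (h.reg _ (hM _)).trans (hs.off i hi),
    fun x hx => by
      rw [h.mem x fun a j _ e => by have := D.base_le_cell a j; omega]; exact hs.inp x hx⟩

theorem wp_storeArr_edits {a j : ℕ} {e x : Expr} {Q : State → Prop}
    (h0 : s.reg 0 = D.base) (he : e.eval s.reg = (j : ℕ)) (ha : a ≤ 2 * k)
    (hj : j ≤ 2 * D.total + 2) (hA : A a)
    (h : ∀ s', Edits D M A s s' → s'.reg = s.reg →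
      s'.mem = Function.update s.mem (D.cell a j) (x.eval s.reg) →
      s'.time = s.time + (e.cost + x.cost + 7) → Q s') :
    wp (.storeArr k a e x) s Q :=
  wp_storeArr h0 he (h _ ⟨fun _ hy => Function.update_of_ne (hy a j hA) _ _,
    max_le_max le_rfl (D.cell_lt_cap ha hj), fun _ _ => rfl⟩ rfl rfl rfl)

end Edits

namespace Plan

variable (P : Plan n k)

/-- Play the match at the node in register `1` of the tournament tree in array `2 * k`. The number
of rows is in register `2`. -/
noncomputable def playNode (i : ℕ) : Cmd :=
  .block [.loadArr k 5 (2 * k) (.const 2 * .reg 1),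
    .loadArr k 6 (2 * k) (.const 2 * .reg 1 + .const 1),
    P.loadCols 1 i 5 (P.key i), P.loadCols 2 i 6 (P.key i),
    .ite (.not (.and (.not (.le (.reg 2) (.reg 6)))
        (.not (.and (.not (.le (.reg 2) (.reg 5))) (lexTest 1 2 (P.key i))))))
      (.storeArr k (2 * k) (.reg 1) (.reg 5)) (.storeArr k (2 * k) (.reg 1) (.reg 6))]

/-- Replay all matches on the way from the leaf in register `1` to the root. -/
noncomputable def replay (i : ℕ) : Cmd :=
  .while (.le (.const 2) (.reg 1))
    (.seq (.set 1 (.un .floor ((.reg 1 + .const 0) / .const 2))) (P.playNode i))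

/-- Sort the rows of stage `i` by their keys. -/
noncomputable def sort (i : ℕ) : Cmd :=
  .block [.load 2 (.const (P.src i)),
    .for 1 2 (.seq (.storeArr k (2 * k) (.reg 1) (.const 0))
      (.storeArr k (2 * k) (.reg 2 + .reg 1) (.reg 1))),
    .set 1 (.reg 2 - .const 1),
    .while (.le (.const 1) (.reg 1)) (.seq (P.playNode i) (.set 1 (.reg 1 - .const 1))),
    .for 8 2 (.block [.loadArr k 9 (2 * k) (.const 1), .storeArr k (2 * i) (.reg 8) (.reg 9),
      .storeArr k (2 * k) (.reg 2 + .reg 9) (.reg 2), .set 1 (.reg 2 + .reg 9), P.replay i])]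

end Plan

/-- The key of a row; rows that do not exist come last. -/
noncomputable def Data.topKey {P : Plan n k} (D : Data P) (i t : ℕ) : WithTop (List ℝ) :=
  if t < D.m i then ((P.keyOf i (D.val i t) : List ℝ) : WithTop (List ℝ)) else ⊤

/-- The tournament tree is in memory. -/
structure Data.HasTree {P : Plan n k} (D : Data P) (i : ℕ) (T : ℕ → ℕ) (mem : ℕ → ℝ) : Prop where
  eq : ∀ x, 1 ≤ x → x < 2 * D.m i → mem (D.cell (2 * k) x) = T x
  le : ∀ x, 1 ≤ x → x < 2 * D.m i → T x ≤ D.m i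

/-- The registers changed by `playNode`. -/
def playRegs (r : ℕ) : Prop := r = 5 ∨ r = 6 ∨ (20 ≤ r ∧ (r % 4 = 1 ∨ r % 4 = 2))

theorem Data.HasTree.update {P : Plan n k} {D : Data P} {i x w : ℕ} {T : ℕ → ℕ} {mem : ℕ → ℝ}
    (h : D.HasTree i T mem) (hw : w ≤ D.m i) :
    D.HasTree i (Function.update T x w) (Function.update mem (D.cell (2 * k) x) w) := by
  refine ⟨fun y h1 h2 => ?_, fun y h1 h2 => ?_⟩
  · by_cases hy : y = x
    · subst hy; simp
    · rw [Function.update_of_ne hy, Function.update_of_ne, h.eq y h1 h2]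
      exact fun e => hy (D.cell_inj le_rfl le_rfl e).2
  · by_cases hy : y = x
    · subst hy; simpa using hw
    · rw [Function.update_of_ne hy]; exact h.le y h1 h2

set_option maxHeartbeats 1000000 in
theorem exists_wp_playNode (P : Plan n k) {i : ℕ} (hi : i < k) : ∃ B, ∀ (D : Data P) (s : State)
    (T : ℕ → ℕ) (x : ℕ), D.Ready s → D.HasTree i T s.mem → s.reg 1 = x → s.reg 2 = D.m i →
    1 ≤ x → x < D.m i → wp (P.playNode i) s fun s' => Edits D playRegs (· = 2 * k) s s' ∧
      s'.time ≤ s.time + B ∧ ∃ w, D.HasTree i (Function.update T x w) s'.mem ∧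
      IsWinner (D.topKey i) (Function.update T x w) x := by
  refine ⟨(lexTest 1 2 (P.key i)).cost + 16 * (P.key i).length + 100,
    fun D s T x hs hT h1 h2 hx hxm => ?_⟩
  have hm := D.m_le_total hi
  have hr : ∀ r, playRegs r → ¬ r = 0 ∧ ∀ j, r ≠ bank 3 j := by
    intro r hr
    unfold playRegs at hr
    exact ⟨by omega, fun j => by simp only [bank]; omega⟩
  have hready : ∀ s', Keeps playRegs D.cap s s' → D.Ready s' := fun s' h =>
    hs.of_keeps h (fun h => (hr _ h).1 rfl) fun j h => (hr _ h).2 j rfl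
  refine wp_block_cons (wp_loadArr_keeps (D := D) (j := 2 * x) (M := playRegs) Keeps.refl
    (by simp [playRegs]) hs.base (by simp [h1]) le_rfl (by omega) fun s1 K1 e1 n1 t1 => ?_)
  refine wp_block_cons (wp_loadArr_keeps (D := D) (j := 2 * x + 1) K1
    (by simp [playRegs]) (hready _ K1).base (by simp [n1, h1]) le_rfl (by omega)
    fun s2 K2 e2 n2 t2 => ?_)
  rw [hT.eq _ (by omega) (by omega)] at e1 e2
  have hl := hT.le (2 * x) (by omega) (by omega)
  have hl' := hT.le (2 * x + 1) (by omega) (by omega)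
  have e25 : s2.reg 5 = T (2 * x) := by rw [n2 _ (by omega), e1]
  refine wp_block_cons ((wp_loadCols (b := 1) hi (by omega) (by omega) hl (P.key i) s2
    (hready _ K2) e25 Plan.key_subset_sch (Finset.nodup_toList _)).mono
    fun s3 ⟨K3', v3, t3⟩ => ?_)
  have K3 : Keeps playRegs D.cap s s3 := K2.trans (K3'.mono (by
    rintro r ⟨a, _, rfl⟩; simp only [playRegs, bank]; omega))
  have n3 : ∀ r < 20, s3.reg r = s2.reg r := fun r hr => K3'.reg r (by
    rintro ⟨a, _, rfl⟩; simp only [bank] at hr; omega)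
  refine wp_block_cons ((wp_loadCols (b := 2) hi (by omega) (by omega) hl' (P.key i) s3
    (hready _ K3) (by rw [n3 _ (by omega), e2]) Plan.key_subset_sch
    (Finset.nodup_toList _)).mono fun s4 ⟨K4', v4, t4⟩ => ?_)
  have K4 : Keeps playRegs D.cap s s4 := K3.trans (K4'.mono (by
    rintro r ⟨a, _, rfl⟩; simp only [playRegs, bank]; omega))
  have n4 : ∀ r < 20, s4.reg r = s2.reg r := fun r hr => (K4'.reg r (by
    rintro ⟨a, _, rfl⟩; simp only [bank] at hr; omega)).trans (n3 r hr)
  have v3' : T (2 * x) < D.m i → ∀ a ∈ P.key i, s4.reg (bank 1 a) = D.val i (T (2 * x)) a :=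
    fun h a ha => by
      rw [K4'.reg _ (by rintro ⟨a, _, h⟩; simp only [bank] at h; omega)]; exact v3 h a ha
  have e45 : s4.reg 5 = T (2 * x) := by rw [n4 _ (by omega), e25]
  have e46 : s4.reg 6 = T (2 * x + 1) := by rw [n4 _ (by omega), e2]
  have e42 : s4.reg 2 = D.m i := by
    rw [n4 _ (by omega), n2 _ (by omega), n1 _ (by omega), h2]
  have e41 : s4.reg 1 = x := by
    rw [n4 _ (by omega), n2 _ (by omega), n1 _ (by omega), h1]
  have hlex : T (2 * x) < D.m i → T (2 * x + 1) < D.m i →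
      ((lexTest 1 2 (P.key i)).holds s4.reg ↔
        D.topKey i (T (2 * x)) ≤ D.topKey i (T (2 * x + 1))) := fun ha hb => by
    rw [lexTest_holds (v3' ha) (v4 hb), Data.topKey, Data.topKey, if_pos ha, if_pos hb,
      WithTop.coe_le_coe]
    rfl
  have htest : (Test.not (.and (.not (.le (.reg 2) (.reg 6)))
        (.not (.and (.not (.le (.reg 2) (.reg 5))) (lexTest 1 2 (P.key i)))))).holds s4.reg ↔
      D.topKey i (T (2 * x)) ≤ D.topKey i (T (2 * x + 1)) := by
    simp only [Test.holds_not, Test.holds_and, Test.holds_le, Expr.eval_reg, e45, e46, e42,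
      Nat.cast_le, not_le]
    by_cases hb : T (2 * x + 1) < D.m i
    · by_cases ha : T (2 * x) < D.m i
      · rw [hlex ha hb]; tauto
      · simp only [hb, ha, false_and, not_false_iff, and_self, not_true_eq_false, false_iff]
        simp [Data.topKey, hb, ha]
    · simp [Data.topKey, hb]
  have ht : s4.time ≤ s.time + 16 * (P.key i).length + 30 := by
    simp only [Expr.cost_add, Expr.cost_mul, Expr.cost_reg, Expr.cost_const] at t1 t2
    omega
  have E4 : Edits D playRegs (· = 2 * k) s s4 := K4.edits
  refine wp_block_cons (wp_ite (fun h => ?_) fun h => ?_)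
  · refine wp_storeArr_edits (D := D) (j := x) (M := playRegs) (hready _ K4).base
      (by simpa [State.tick] using e41) le_rfl (by omega)
      (A := (· = 2 * k)) rfl fun s5 E5 r5 m5 t5 => wp_block_nil ⟨(E4.trans ⟨E5.mem, E5.top, E5.reg⟩).tick 1,
        ?_, T (2 * x), ?_, ?_⟩
    · simp only [State.tick, Test.cost_not, Test.cost_and, Test.cost_le, Expr.cost_reg] at t5 ⊢
      omega
    · change D.HasTree i _ s5.mem
      rw [m5]
      simp only [State.tick, Expr.eval_reg, e45, K4.mem]
      exact hT.update hl
    · exact .update_self hx (Or.inl rfl) le_rfl (htest.1 h)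
  · refine wp_storeArr_edits (D := D) (j := x) (M := playRegs) (hready _ K4).base
      (by simpa [State.tick] using e41) le_rfl (by omega)
      (A := (· = 2 * k)) rfl fun s5 E5 r5 m5 t5 => wp_block_nil ⟨(E4.trans ⟨E5.mem, E5.top, E5.reg⟩).tick 1,
        ?_, T (2 * x + 1), ?_, ?_⟩
    · simp only [State.tick, Test.cost_not, Test.cost_and, Test.cost_le, Expr.cost_reg] at t5 ⊢
      omega
    · change D.HasTree i _ s5.mem
      rw [m5]
      simp only [State.tick, Expr.eval_reg, e46, K4.mem]
      exact hT.update hl'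
    · exact .update_self hx (Or.inr rfl) (not_le.1 (mt htest.2 h)).le le_rfl

end SubsetSamplingJoin

namespace SubsetSamplingJoin

variable {n k : ℕ}

/-- The registers changed by `replay`. -/
def replayRegs (r : ℕ) : Prop := playRegs r ∨ r = 1

theorem replayRegs_iff {r : ℕ} :
    replayRegs r ↔ r = 1 ∨ r = 5 ∨ r = 6 ∨ (20 ≤ r ∧ (r % 4 = 1 ∨ r % 4 = 2)) := by
  unfold replayRegs playRegs
  omega

theorem Edits.ready_replay {P : Plan n k} {D : Data P} {A : ℕ → Prop} {s s' : State}
    (hs : D.Ready s) (h : Edits D replayRegs A s s') : D.Ready s' :=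
  h.ready hs (by simp [replayRegs_iff]) fun j => by
    rw [replayRegs_iff]; simp only [bank]; omega

theorem exists_wp_replay (P : Plan n k) {i : ℕ} (hi : i < k) : ∃ B, ∀ (D : Data P) (d : ℕ)
    (s : State) (T : ℕ → ℕ) (x : ℕ), D.Ready s → D.HasTree i T s.mem → s.reg 1 = x →
    s.reg 2 = D.m i → 1 ≤ x → x < 2 * D.m i → x < 2 ^ d →
    (∀ y, 1 ≤ y → y < D.m i → (∀ e, 0 < e → y ≠ x / 2 ^ e) → IsWinner (D.topKey i) T y) →
    wp (P.replay i) s fun s' => Edits D replayRegs (· = 2 * k) s s' ∧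
      s'.time ≤ s.time + d * B + 4 ∧ ∃ T', D.HasTree i T' s'.mem ∧
      (∀ y, 1 ≤ y → y < D.m i → IsWinner (D.topKey i) T' y) ∧ ∀ y, D.m i ≤ y → T' y = T y := by
  obtain ⟨B, hB⟩ := exists_wp_playNode P hi
  refine ⟨B + 20, fun D d => ?_⟩
  induction d with
  | zero => intro s T x _ _ _ _ h1 _ h2; omega
  | succ d ih =>
    intro s T x hs hT h1 h2 hx hxm hxd hwin
    refine wp_while (fun hle => ?_) fun hlt => ⟨Edits.refl.tick _, ?_, T, hT, ?_, fun _ _ => rfl⟩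
    · have hx2 : 2 ≤ x := by
        simp only [Test.holds_le, Expr.eval_const, Expr.eval_reg, h1] at hle
        exact_mod_cast hle
      refine wp_seq (wp_set_keeps (X := D.cap) (M := replayRegs) (Keeps.refl.tick _)
        (by simp [replayRegs]) fun s1 K1 e1 n1 t1 => ?_)
      have e1' : s1.reg 1 = (x / 2 : ℕ) := by
        rw [e1]
        simp only [Expr.eval_floor, Expr.eval_div, Expr.eval_add, Expr.eval_reg,
          Expr.eval_const, State.tick, h1]
        have := floor_half x 0
        push_cast at this ⊢
        exact this
      have E1 : Edits D replayRegs (· = 2 * k) s s1 := K1.edits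
      refine (hB D s1 T (x / 2) (E1.ready_replay hs) (by rw [K1.mem]; exact hT) e1'
        (by rw [n1 _ (by omega)]; exact h2) (by omega) (by omega)).mono
        fun s2 ⟨E2, t2, w, hT2, hw⟩ => ?_
      have E2' : Edits D replayRegs (· = 2 * k) s s2 :=
        E1.trans (E2.mono (fun r => Or.inl) fun _ => id)
      refine (ih s2 _ (x / 2) (E2'.ready_replay hs) hT2
        (by rw [E2.reg 1 (by simp [playRegs]), e1'])
        (by rw [E2.reg 2 (by simp [playRegs]), n1 _ (by omega)]; exact h2) (by omega) (by omega)
        (by rw [pow_succ] at hxd; omega) fun y hy hym hye => ?_).mono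
        fun s3 ⟨E3, t3, T', hT', hw', hl⟩ => ⟨E2'.trans E3, ?_, T', hT', hw', fun y hy => ?_⟩
      · by_cases hyx : y = x / 2
        · rw [hyx]; exact hw
        · refine (hwin y hy hym fun e he hyx' => ?_).update hyx
            (by simpa using hye 1 (by omega))
          obtain ⟨e, rfl⟩ : ∃ e', e = e' + 1 := ⟨e - 1, by omega⟩
          rcases Nat.eq_zero_or_pos e with rfl | he'
          · exact hyx (by simpa using hyx')
          · exact hye e he' (by rw [hyx', Nat.div_div_eq_div_mul, pow_succ, mul_comm])
      · simp only [State.tick, Test.cost_le, Expr.cost_const, Expr.cost_reg, Expr.cost_un,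
          Expr.cost_div, Expr.cost_add] at t1
        have : (d + 1) * (B + 20) = d * (B + 20) + B + 20 := by ring
        omega
      · rw [hl y hy, Function.update_of_ne (by omega)]
    · simp only [State.tick, Test.cost_le, Expr.cost_const, Expr.cost_reg]
      omega
    · have hx1 : x = 1 := by
        simp only [Test.holds_le, Expr.eval_const, Expr.eval_reg, h1, not_le] at hlt
        have : x < 2 := by exact_mod_cast hlt
        omega
      subst hx1
      refine fun y hy hym => hwin y hy hym fun e he => ?_
      rw [Nat.div_eq_of_lt (Nat.one_lt_two_pow (by omega))]
      omega

/-- The registers changed by `sort`. -/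
def sortRegs (r : ℕ) : Prop := (1 ≤ r ∧ r ≤ 9) ∨ (20 ≤ r ∧ (r % 4 = 1 ∨ r % 4 = 2))

theorem replayRegs_le {r : ℕ} (h : replayRegs r) : sortRegs r := by
  rw [replayRegs_iff] at h
  unfold sortRegs
  omega

theorem Edits.ready_sort {P : Plan n k} {D : Data P} {A : ℕ → Prop} {s s' : State}
    (hs : D.Ready s) (h : Edits D sortRegs A s s') : D.Ready s' :=
  h.ready hs (by simp [sortRegs]) fun j => by simp only [sortRegs, bank]; omega

theorem wp_buildTree {P : Plan n k} {D : Data P} {i B : ℕ}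
    (hB : ∀ (s : State) (T : ℕ → ℕ) (x : ℕ), D.Ready s → D.HasTree i T s.mem →
      s.reg 1 = x → s.reg 2 = D.m i → 1 ≤ x → x < D.m i → wp (P.playNode i) s fun s' =>
      Edits D playRegs (· = 2 * k) s s' ∧ s'.time ≤ s.time + B ∧ ∃ w,
      D.HasTree i (Function.update T x w) s'.mem ∧
      IsWinner (D.topKey i) (Function.update T x w) x) (x : ℕ) :
    ∀ (s : State) (T : ℕ → ℕ), D.Ready s → D.HasTree i T s.mem → s.reg 1 = (x : ℝ) - 1 →
    s.reg 2 = D.m i → x ≤ D.m i → 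
    (∀ y, 1 ≤ y → y < D.m i → x ≤ y → IsWinner (D.topKey i) T y) →
    wp (.while (.le (.const 1) (.reg 1)) (.seq (P.playNode i) (.set 1 (.reg 1 - .const 1)))) s
      fun s' => Edits D replayRegs (· = 2 * k) s s' ∧ s'.time ≤ s.time + x * (B + 10) + 4 ∧
      ∃ T', D.HasTree i T' s'.mem ∧ (∀ y, 1 ≤ y → y < D.m i → IsWinner (D.topKey i) T' y) ∧
        ∀ y, D.m i ≤ y → T' y = T y := by
  induction x with
  | zero =>
    intro s T hs hT h1 h2 hx hwin
    refine wp_while (fun h => absurd h ?_) fun _ => ⟨Edits.refl.tick _, ?_, T, hT,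
      fun y h h' => hwin y h h' (by omega), fun _ _ => rfl⟩
    · simp [h1]
    · simp [State.tick]
  | succ x ih =>
    intro s T hs hT h1 h2 hx hwin
    rw [Nat.cast_succ, add_sub_cancel_right] at h1
    refine wp_while (fun h => wp_seq ?_) fun h => ⟨Edits.refl.tick _, ?_, T, hT,
      fun y h3 h4 => hwin y h3 h4 ?_, fun _ _ => rfl⟩
    · simp only [Test.holds_le, Expr.eval_const, Expr.eval_reg, h1] at h
      have hx1 : 1 ≤ x := by exact_mod_cast h
      refine (hB (s.tick _) T x ⟨hs.base, hs.off, hs.inp⟩ hT h1 h2 hx1 (by omega)).mono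
        fun s1 ⟨E1, t1, w, hT1, hw⟩ => ?_
      refine wp_set_keeps (X := D.cap) (M := replayRegs) Keeps.refl
        (by simp [replayRegs]) fun s2 K2 e2 n2 t2 => ?_
      have E2 : Edits D replayRegs (· = 2 * k) s s2 :=
        Edits.trans (Edits.trans (Edits.refl.tick _) (E1.mono (fun r => Or.inl) fun _ => id))
          K2.edits
      refine (ih s2 (Function.update T x w) (E2.ready_replay hs) (by rw [K2.mem]; exact hT1) ?_ ?_ (by omega)
        fun y hy hym hxy => ?_).mono
        fun s3 ⟨E3, t3, T', hT', hw', hl⟩ => ⟨E2.trans E3, ?_, T', hT', hw', fun y hy => ?_⟩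
      · rw [e2]
        simp [E1.reg 1 (by simp [playRegs]), State.tick, h1]
      · rw [n2 _ (by omega), E1.reg 2 (by simp [playRegs])]; exact h2
      · rcases hxy.eq_or_lt with rfl | hxy
        · exact hw
        · exact (hwin y hy hym (by omega)).update (by omega) (by omega)
      · simp only [State.tick, Test.cost_le, Expr.cost_const, Expr.cost_reg,
          Expr.cost_sub] at t1 t2
        have : (x + 1) * (B + 10) = x * (B + 10) + B + 10 := by ring
        omega
      · rw [hl y hy, Function.update_of_ne (by omega)]
    · simp only [State.tick, Test.cost_le, Expr.cost_const, Expr.cost_reg]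
      omega
    · simp only [Test.holds_le, Expr.eval_const, Expr.eval_reg, h1] at h
      have : x < 1 := by
        by_contra hx
        exact h (by exact_mod_cast not_lt.1 hx)
      omega

set_option maxHeartbeats 1000000 in
theorem exists_wp_sort (P : Plan n k) {i : ℕ} (hi : i < k) : ∃ B, ∀ (D : Data P) (s : State)
    (j : ℕ), D.Ready s → D.m i < 2 ^ j → wp (P.sort i) s fun s' =>
    Edits D sortRegs (fun a => a = 2 * i ∨ a = 2 * k) s s' ∧
    (∃ X, D.Sorted X i ∧ D.HasPerm X i s'.mem) ∧
    s'.time ≤ s.time + B * ((D.m i + 1) * (j + 1)) := by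
  obtain ⟨B₁, hB₁⟩ := exists_wp_playNode P hi
  obtain ⟨B₂, hB₂⟩ := exists_wp_replay P hi
  refine ⟨B₁ + B₂ + 200, fun D s j hs hj => ?_⟩
  set A : ℕ → Prop := fun a => a = 2 * i ∨ a = 2 * k with hA
  set m := D.m i with hmdef
  have hm := D.m_le_total hi
  have hsrc : P.src i < D.base := (P.src_lt i hi).trans_le D.le_base
  have hcap : D.base < D.cap := by
    have : 0 < (2 * k + 1) * (2 * D.total + 3) := by positivity
    unfold Data.cap; omega
  have hK : ∀ j < m, D.topKey i j < D.topKey i m := fun j hj => by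
    simp [Data.topKey, hj, ← hmdef]
  have hne : ∀ x y, D.cell (2 * i) x ≠ D.cell (2 * k) y := fun x y h => by
    have := (D.cell_inj (by omega) le_rfl h).1
    omega
  -- the number of rows
  refine wp_block_cons (wp_load ?_)
  rw [Expr.addr_eq (show (Expr.const (P.src i : ℕ)).eval s.reg = (P.src i : ℕ) by simp)]
  set s1 := (s.load 2 (P.src i)).tick (1 + (Expr.const (P.src i : ℕ)).cost) with hs1
  have E1 : Edits D sortRegs A s s1 :=
    Keeps.edits ((Keeps.refl.load (by simp [sortRegs]) (hsrc.trans hcap)).tick _)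
  have h12 : s1.reg 2 = m := by
    simp [hs1, State.tick, State.load, hs.inp _ hsrc, D.inp_size i hi, hmdef]
  have t1 : s1.time = s.time + 2 := rfl
  -- the leaves
  refine wp_block_cons (wp_for (fun q u => Edits D sortRegs A s u ∧ u.reg 2 = m ∧
    ∀ x < q, u.mem (D.cell (2 * k) x) = 0 ∧ u.mem (D.cell (2 * k) (m + x)) = x) m 30
    (fun q u t h => ⟨h.1.tick t, h.2⟩)
    ⟨E1.setReg (by simp [sortRegs]) _, by simpa [State.setReg] using h12, fun x hx => by omega⟩
    (by simpa [State.setReg] using h12)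
    (fun q hq u ⟨Eu, _, hu⟩ h1 h2 => ?_) fun s2 ⟨E2, h22, l2⟩ t2 => ?_)
  · refine wp_seq (wp_storeArr_edits (D := D) (j := q) (M := sortRegs) (A := A)
      (Eu.ready_sort hs).base (by simp [h1]) le_rfl (by omega) (Or.inr rfl)
      fun u1 E1' r1 m1 t1 => ?_)
    have Eu1 := Eu.trans E1'
    refine wp_storeArr_edits (D := D) (j := m + q) (M := sortRegs) (A := A)
      (Eu1.ready_sort hs).base (by simp [r1, h1, h2]) le_rfl (by omega) (Or.inr rfl)
      fun u' E' r' m' t' => ⟨?_, ?_, ⟨?_, ?_, ?_⟩, ?_⟩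
    · rw [r', r1, h1]
    · simp [State.setReg, r', r1, h2]
    · exact (Eu1.trans E').setReg (by simp [sortRegs]) _
    · simp [State.setReg, r', r1, h2]
    · intro x hx
      change u'.mem _ = _ ∧ u'.mem _ = _
      have hc : ∀ y z, y ≠ z → D.cell (2 * k) y ≠ D.cell (2 * k) z := fun y z h e =>
        h (D.cell_inj le_rfl le_rfl e).2
      rw [m', m1]
      constructor
      · rw [Function.update_of_ne (hc _ _ (by omega))]
        rcases (Nat.lt_succ_iff.1 hx).lt_or_eq with hx | rfl
        · rw [Function.update_of_ne (hc _ _ (by omega)), (hu x hx).1]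
        · simp
      · rcases (Nat.lt_succ_iff.1 hx).lt_or_eq with hx | rfl
        · rw [Function.update_of_ne (hc _ _ (by omega)), Function.update_of_ne (hc _ _ (by omega)),
            (hu x hx).2]
        · simp [r1, h1]
    · simp only [Expr.cost_add, Expr.cost_reg, Expr.cost_const] at t1 t'
      omega
  -- the matches
  set T₀ : ℕ → ℕ := fun x => if x < m then 0 else x - m with hT₀
  have hT2 : D.HasTree i T₀ s2.mem := by
    refine ⟨fun x h1 h2 => ?_, fun x h1 h2 => ?_⟩
    · by_cases hx : x < m
      · rw [(l2 x hx).1]; simp [hT₀, hx]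
      · have := (l2 (x - m) (by omega)).2
        rw [Nat.add_sub_cancel' (by omega)] at this
        rw [this]; simp [hT₀, hx]
    · simp only [hT₀]; split_ifs <;> omega
  refine wp_block_cons (wp_set_keeps (X := D.cap) (M := sortRegs) Keeps.refl (by simp [sortRegs])
    fun s3 K3 e3 n3 t3 => ?_)
  have E3 : Edits D sortRegs A s s3 := E2.trans K3.edits
  refine wp_block_cons ((wp_buildTree (hB₁ D) m s3 T₀ (E3.ready_sort hs)
    (by rw [K3.mem]; exact hT2) (by rw [e3]; simp [h22]) (by rw [n3 _ (by omega), h22]) le_rfl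
    fun y h1 h2 h3 => by omega).mono fun s4 ⟨E4', t4, T₁, hT4, hw4, hl4⟩ => ?_)
  have E4 : Edits D sortRegs A s s4 := E3.trans (E4'.mono (fun r => replayRegs_le) fun a => Or.inr)
  have h42 : s4.reg 2 = m := by
    rw [E4'.reg 2 (by simp [replayRegs_iff]), n3 _ (by omega), h22]
  -- the extraction
  refine wp_block_cons (wp_for (fun q u => Edits D sortRegs A s u ∧ u.reg 2 = m ∧
    ∃ T p, D.HasTree i T u.mem ∧ Extracted (D.topKey i) m T p q ∧
      ∀ x < q, u.mem (D.cell (2 * i) x) = p x) m ((j + 1) * B₂ + 60)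
    (fun q u t h => ⟨h.1.tick t, h.2⟩)
    ⟨E4.setReg (by simp [sortRegs]) _, by simpa [State.setReg] using h42, T₁, id, hT4,
      ⟨hw4, hT4.le, by simp, by simp, fun a b _ h => by omega, by simp, fun j hj _ => ?_,
        by simp⟩, by simp⟩
    (by simpa [State.setReg] using h42)
    (fun q hq u ⟨Eu, _, T, p, hT, hp, hx⟩ h1 h2 => ?_) fun s5 ⟨E5, _, T, p, _, hp, hx⟩ t5 => ?_)
  · rw [hl4 _ (by omega)]; simp [hT₀]
  · obtain ⟨g1, g2, g3⟩ := hp.root hK hq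
    refine wp_block_cons (wp_loadArr_keeps (D := D) (j := 1) (M := sortRegs) Keeps.refl
      (by simp [sortRegs]) (Eu.ready_sort hs).base (by simp) le_rfl (by omega)
      fun u1 K1 f1 n1 t1 => ?_)
    have E1 : Edits D sortRegs A s u1 := Eu.trans K1.edits
    rw [hT.eq 1 le_rfl (by omega)] at f1
    refine wp_block_cons (wp_storeArr_edits (D := D) (j := q) (M := sortRegs) (A := A)
      (E1.ready_sort hs).base (by simp [n1, h1]) (by omega) (by omega) (Or.inl rfl)
      fun u2 E2' r2 m2 t2 => ?_)
    have E2 := E1.trans E2'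
    refine wp_block_cons (wp_storeArr_edits (D := D) (j := m + T 1) (M := sortRegs) (A := A)
      (E2.ready_sort hs).base (by simp [r2, n1, h2, f1]) (by omega) (by omega) (Or.inr rfl)
      fun u3 E3' r3 m3 t3 => ?_)
    have E3 := E2.trans E3'
    have hT2 : D.HasTree i T u2.mem := ⟨fun x h3 h4 => by
      rw [m2, Function.update_of_ne (hne _ _).symm, K1.mem, hT.eq x h3 h4], hT.le⟩
    have hT3 : D.HasTree i (Function.update T (m + T 1) m) u3.mem := by
      have e : (Expr.reg 2).eval u2.reg = (m : ℕ) := by simp [r2, n1, h2]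
      rw [m3, e]
      exact hT2.update le_rfl
    refine wp_block_cons (wp_set_keeps (X := D.cap) (M := sortRegs) Keeps.refl
      (by simp [sortRegs]) fun u4 K4 f4 n4 t4 => ?_)
    have E4 : Edits D sortRegs A s u4 := E3.trans K4.edits
    have h42 : u4.reg 2 = m := by rw [n4 _ (by omega), r3, r2, n1 _ (by omega), h2]
    refine wp_block_cons ((hB₂ D (j + 1) u4 (Function.update T (m + T 1) m) (m + T 1) (E4.ready_sort hs)
      (by rw [K4.mem]; exact hT3) ?_ h42 (by omega) (by omega) (by rw [pow_succ]; omega)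
      fun y hy hym hye => ?_).mono fun u5 ⟨E5', t5, T', hT', hw', hl'⟩ => wp_block_nil ?_)
    · rw [f4]; simp [r3, r2, n1, h2, f1]
    · exact (hp.win y hy hym).update (by omega) (by simpa using hye 1 (by omega))
    have E5 : Edits D sortRegs A s u5 :=
      E4.trans (E5'.mono (fun r => replayRegs_le) fun a => Or.inr)
    have hreg : ∀ r, r = 2 ∨ r = 8 → u5.reg r = u.reg r := fun r hr => by
      rw [E5'.reg r (by rw [replayRegs_iff]; omega), n4 _ (by omega), r3, r2, n1 _ (by omega)]
    refine ⟨?_, ?_, ⟨?_, ?_, T', Function.update p q (T 1), hT', ?_, ?_⟩, ?_⟩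
    · exact (hreg 8 (by omega)).trans h1
    · simpa [State.tick, State.setReg] using (hreg 2 (by omega)).trans h2
    · exact (E5.tick 1).setReg (by simp [sortRegs]) _
    · simpa [State.tick, State.setReg] using (hreg 2 (by omega)).trans h2
    · refine hp.step hK hq hw' hT'.le fun j hj => ?_
      rw [hl' _ (by omega)]
      by_cases h : j = T 1
      · simp [h]
      · rw [Function.update_of_ne (by omega), if_neg h]
    · intro x hxq
      change u5.mem _ = _
      rw [E5'.mem _ fun a y ha => by rw [ha]; exact hne _ _, K4.mem, m3,
        Function.update_of_ne (hne _ _), m2]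
      rcases (Nat.lt_succ_iff.1 hxq).lt_or_eq with hxq | rfl
      · rw [Function.update_of_ne fun e => by
          have := (D.cell_inj (by omega) (by omega) e).2
          omega, K1.mem, hx x hxq, Function.update_of_ne (by omega)]
      · simp [f1]
    · simp only [State.tick, Expr.cost_add, Expr.cost_reg, Expr.cost_const] at t1 t2 t3 t4 ⊢
      omega
  · refine wp_block_nil ⟨E5.tick 1, ⟨⟨fun _ => p, fun _ _ => 0⟩, ⟨hp.maps, fun a ha b hb => hp.inj a ha b hb,
      fun a b hab hb => ?_⟩, ⟨hx⟩⟩, ?_⟩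
    · have := hp.mono a b hab hb
      rw [Data.topKey, Data.topKey, if_pos (hp.maps a (by omega)), if_pos (hp.maps b hb),
        WithTop.coe_le_coe] at this
      exact this
    · simp only [State.tick, Expr.cost_sub, Expr.cost_reg, Expr.cost_const] at t3 ⊢
      have e : (B₁ + B₂ + 200) * ((m + 1) * (j + 1)) = m * j * B₁ + m * j * B₂ + m * B₁ + m * B₂ +
        (j + 1) * B₁ + (j + 1) * B₂ + 200 * (m * j) + 200 * m + 200 * j + 200 := by ring
      have e2 : m * ((j + 1) * B₂ + 60 + 8) = m * j * B₂ + m * B₂ + 68 * m := by ring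
      have e3 : m * (B₁ + 10) = m * B₁ + 10 * m := by ring
      rw [e]
      rw [e2] at t5
      rw [e3] at t4
      generalize m * j * B₁ = V1 at *
      generalize m * j * B₂ = V2 at *
      generalize (j + 1) * B₁ = V3 at *
      generalize (j + 1) * B₂ = V4 at *
      generalize m * j = V5 at *
      omega

end SubsetSamplingJoin

namespace SubsetSamplingJoin

variable {n k : ℕ}

namespace Plan

variable (P : Plan n k)

/-- Multiply register `12` by the weight of the group of rows of stage `c` that match bank `0`. -/
noncomputable def mulGroup (c : ℕ) : Cmd :=
  .block [P.group c, .loadArr k 8 (2 * c + 1) (.reg 6), .loadArr k 9 (2 * c + 1) (.reg 7),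
    .set 12 (.reg 12 * (.reg 9 - .reg 8))]

/-- Compute the prefix sums of stage `i`. -/
noncomputable def prefixSums (i : ℕ) : Cmd :=
  .block [.load 17 (.const (P.src i)), .set 10 (.const 0),
    .storeArr k (2 * i + 1) (.const 0) (.reg 10),
    .for 18 17 (.block [.loadArr k 11 (2 * i) (.reg 18), P.loadCols 0 i 11 (P.sch i).toList,
      .load 12 (.reg (bank 3 (P.src i)) + (.reg 11 * .const (P.width i) +
        .const (P.sch i).card)),
      .block ((P.ch i).toList.map P.mulGroup), .set 10 (.reg 10 + .reg 12),
      .storeArr k (2 * i + 1) (.reg 18 + .const 1) (.reg 10)])]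

/-- Put the rows of stage `i` into the order of their keys; at stage `0`, the keys are empty. -/
noncomputable def order (i : ℕ) : Cmd :=
  if i = 0 then .block [.load 2 (.const (P.src 0)), .for 1 2 (.storeArr k 0 (.reg 1) (.reg 1))]
  else P.sort i

end Plan

/-- The registers changed by `mulGroup`. -/
def mulRegs (r : ℕ) : Prop := (1 ≤ r ∧ r ≤ 9) ∨ r = 12 ∨ (20 ≤ r ∧ r % 4 = 1)

/-- The registers changed by the construction of the arrays. -/
def buildRegs (r : ℕ) : Prop := r ≠ 0 ∧ ¬ (20 ≤ r ∧ r % 4 = 3)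

theorem Edits.ready_build {P : Plan n k} {D : Data P} {A : ℕ → Prop} {s s' : State}
    (hs : D.Ready s) (h : Edits D buildRegs A s s') : D.Ready s' :=
  h.ready hs (by simp [buildRegs]) fun j => by simp only [buildRegs, bank]; omega

theorem Keeps.ready_mul {P : Plan n k} {D : Data P} {X : ℕ} {s s' : State} (hs : D.Ready s)
    (h : Keeps mulRegs X s s') : D.Ready s' :=
  hs.of_keeps h (by simp [mulRegs]) fun j => by simp only [mulRegs, bank]; omega

theorem exists_wp_mulGroups (P : Plan n k) : ∀ cs : List ℕ, (∀ c ∈ cs, c < k) →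
    ∃ B, ∀ (D : Data P) (X : Index) (s : State) (v : Fin n → ℝ) (J : ℕ), D.Ready s →
    (∀ c ∈ cs, D.Sorted X c ∧ D.Has X c s.mem) →
    (∀ c ∈ cs, ∀ a ∈ P.key c, s.reg (bank 0 a) = v a) → (∀ c ∈ cs, D.m c < 2 ^ J) →
    wp (.block (cs.map P.mulGroup)) s fun s' => Keeps mulRegs D.cap s s' ∧
      s'.reg 12 = s.reg 12 * (cs.map fun c => D.grp X c v).prod ∧
      s'.time ≤ s.time + B * (J + 1) := by
  intro cs
  induction cs with
  | nil =>
    intro _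
    exact ⟨1, fun D X s v J _ _ _ _ =>
      wp_block_nil ⟨Keeps.refl.tick 1, by simp [State.tick], by simp [State.tick]⟩⟩
  | cons c cs ih =>
    intro hcs
    have hc := hcs c (by simp)
    obtain ⟨B₁, h₁⟩ := exists_wp_group P hc
    obtain ⟨B₂, h₂⟩ := ih fun c' h => hcs c' (by simp [h])
    refine ⟨B₁ + B₂ + 40, fun D X s v J hs hX hv hJ => ?_⟩
    obtain ⟨hXc, hmem⟩ := hX c (by simp)
    have hm := D.m_le_total hc
    have hlh := D.lo_le_hi (X := X) c v
    have hhm := D.hi_le (X := X) c v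
    refine wp_block_cons (wp_block_cons ((h₁ D X s v J hs hXc hmem.toHasPerm (hv c (by simp))
      (hJ c (by simp))).mono fun s1 ⟨K1', e6, e7, t1⟩ => ?_))
    have K1 : Keeps mulRegs D.cap s s1 :=
      K1'.mono fun r hr => by unfold groupRegs at hr; unfold mulRegs; omega
    refine wp_block_cons (wp_loadArr_keeps (D := D) (j := D.lo X c v) K1 (by simp [mulRegs])
      (K1.ready_mul hs).base (by simp [e6]) (by omega) (by omega) fun s2 K2 e8 n2 t2 => ?_)
    refine wp_block_cons (wp_loadArr_keeps (D := D) (j := D.hi X c v) K2 (by simp [mulRegs])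
      (K2.ready_mul hs).base (by simp [n2, e7]) (by omega) (by omega)
      fun s3 K3 e9 n3 t3 => ?_)
    refine wp_block_cons (wp_set_keeps K3 (by simp [mulRegs]) fun s4 K4 e12 n4 t4 =>
      wp_block_nil ?_)
    have K4' := K4.tick 1
    refine (h₂ D X (s4.tick 1) v J (K4'.ready_mul hs)
      (fun c' h => by rw [K4'.mem]; exact hX c' (by simp [h]))
      (fun c' h a ha => by
        rw [K4'.reg _ (by simp only [mulRegs, bank]; omega)]; exact hv c' (by simp [h]) a ha)
      fun c' h => hJ c' (by simp [h])).mono fun s5 ⟨K5, e5, t5⟩ => ⟨K4'.trans K5, ?_, ?_⟩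
    · rw [e5]
      change s4.reg 12 * _ = _
      rw [e12]
      simp only [Expr.eval_mul, Expr.eval_sub, Expr.eval_reg, e9, n3 8 (by omega),
        n3 12 (by omega), n2 12 (by omega), e8, K1'.reg 12 (by simp [groupRegs]),
        hmem.pre _ hhm, hmem.pre _ (hlh.trans hhm), List.map_cons, List.prod_cons, Data.grp]
      ring
    · simp only [State.tick, Expr.cost_reg, Expr.cost_mul, Expr.cost_sub] at t2 t3 t4 t5
      have : (B₁ + B₂ + 40) * (J + 1) = B₁ * (J + 1) + B₂ * (J + 1) + 40 * J + 40 := by ring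
      omega

namespace Data

variable {P : Plan n k} {D : Data P} {X X' : Index}

theorem lo_index_congr {i : ℕ} (h : X'.perm i = X.perm i) (v : Fin n → ℝ) :
    D.lo X' i v = D.lo X i v := by
  simp only [lo, h]

theorem hi_index_congr {i : ℕ} (h : X'.perm i = X.perm i) (v : Fin n → ℝ) :
    D.hi X' i v = D.hi X i v := by
  simp only [hi, h]

theorem grp_index_congr {i : ℕ} (h : X'.perm i = X.perm i) (h' : X'.pre i = X.pre i)
    (v : Fin n → ℝ) : D.grp X' i v = D.grp X i v := by
  simp only [grp, lo_index_congr h, hi_index_congr h, h']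

theorem Sorted.congr {i : ℕ} (hs : D.Sorted X i) (h : X'.perm i = X.perm i) : D.Sorted X' i := by
  constructor <;> rw [h]
  exacts [hs.maps, hs.inj, hs.mono]

theorem Stage.congr {i : ℕ} (hs : D.Stage X i) (hp : ∀ c, i ≤ c → X'.perm c = X.perm c)
    (hq : ∀ c, i ≤ c → X'.pre c = X.pre c) : D.Stage X' i := by
  refine ⟨hs.toSorted.congr (hp i le_rfl), ?_, fun q hq' => ?_⟩
  · rw [hq i le_rfl, hs.zero]
  · rw [hq i le_rfl, hp i le_rfl, hs.succ q hq']
    congr 2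
    exact Finset.prod_congr rfl fun c hc => (grp_index_congr (hp c (Plan.lt_of_mem_ch hc).le)
      (hq c (Plan.lt_of_mem_ch hc).le) _).symm

theorem HasPerm.congr {i : ℕ} {mem : ℕ → ℝ} (h : D.HasPerm X i mem) (hp : X'.perm i = X.perm i) :
    D.HasPerm X' i mem :=
  ⟨by rw [hp]; exact h.perm⟩

variable (D X) in
/-- The prefix sums of stage `i`. -/
noncomputable def preSum (i : ℕ) : ℕ → ℝ
  | 0 => 0
  | q + 1 => preSum i q +
      D.wt i (D.val i (X.perm i q)) * ∏ c ∈ P.ch i, D.grp X c (D.val i (X.perm i q))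

end Data

set_option maxHeartbeats 1000000 in
theorem exists_wp_prefixSums (P : Plan n k) {i : ℕ} (hi : i < k) : ∃ B, ∀ (D : Data P)
    (X : Index) (s : State) (J : ℕ), D.Ready s → D.Sorted X i → D.HasPerm X i s.mem →
    (∀ c, i < c → c < k → D.Sorted X c ∧ D.Has X c s.mem) → (∀ c ∈ P.ch i, D.m c < 2 ^ J) →
    wp (P.prefixSums i) s fun s' => Edits D buildRegs (· = 2 * i + 1) s s' ∧
      (∀ q ≤ D.m i, s'.mem (D.cell (2 * i + 1) q) = D.preSum X i q) ∧
      s'.time ≤ s.time + B * ((D.m i + 1) * (J + 1)) := by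
  obtain ⟨B, hB⟩ := exists_wp_mulGroups P (P.ch i).toList fun c hc =>
    (Plan.mem_ch.1 (Finset.mem_toList.1 hc)).1
  set w := (P.sch i).toList.length with hw
  refine ⟨B + 8 * w + 150, fun D X s J hs hX hperm hch hJ => ?_⟩
  set A : ℕ → Prop := (· = 2 * i + 1) with hA
  have hm := D.m_le_total hi
  have hsrc : P.src i < D.base := (P.src_lt i hi).trans_le D.le_base
  have hcap : D.base < D.cap := by
    have : 0 < (2 * k + 1) * (2 * D.total + 3) := by positivity
    unfold Data.cap; omega
  refine wp_block_cons (wp_load ?_)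
  rw [Expr.addr_eq (show (Expr.const (P.src i : ℕ)).eval s.reg = (P.src i : ℕ) by simp)]
  set s1 := (s.load 17 (P.src i)).tick (1 + (Expr.const (P.src i : ℕ)).cost) with hs1
  have K1 : Keeps buildRegs D.cap s s1 :=
    (Keeps.refl.load (by simp [buildRegs]) (hsrc.trans hcap)).tick _
  have h17 : s1.reg 17 = D.m i := by
    simp [hs1, State.tick, State.load, hs.inp _ hsrc, D.inp_size i hi]
  have t1 : s1.time = s.time + 2 := rfl
  refine wp_block_cons (wp_set_keeps K1 (by simp [buildRegs]) fun s2 K2 e2 n2 t2 => ?_)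
  have E2 : Edits D buildRegs A s s2 := K2.edits
  refine wp_block_cons (wp_storeArr_edits (D := D) (j := 0) (M := buildRegs) (A := A)
    (E2.ready_build hs).base (by simp) (by omega) (by omega) rfl fun s3 E3' r3 m3 t3 => ?_)
  have E3 := E2.trans E3'
  have h317 : s3.reg 17 = D.m i := by rw [r3, n2 _ (by omega), h17]
  refine wp_block_cons (wp_for (fun q u => Edits D buildRegs A s u ∧ u.reg 17 = D.m i ∧
    u.reg 10 = D.preSum X i q ∧ ∀ x ≤ q, u.mem (D.cell (2 * i + 1) x) = D.preSum X i x) (D.m i)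
    (B * (J + 1) + 8 * w + 60) (fun q u t h => ⟨h.1.tick t, h.2⟩)
    ⟨E3.setReg (by simp [buildRegs]) _, by simpa [State.setReg] using h317, ?_, ?_⟩
    (by simpa [State.setReg] using h317)
    (fun q hq u ⟨Eu, _, hu, hx⟩ h1 h2 => ?_) fun s4 ⟨E4, _, _, hx⟩ t4 => wp_block_nil ?_)
  · simp [State.setReg, r3, e2, Data.preSum]
  · intro x hx
    obtain rfl : x = 0 := by omega
    simp [State.setReg, m3, e2, Data.preSum]
  · set t := X.perm i q with ht
    have htm : t < D.m i := hX.maps q hq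
    have hready := Eu.ready_build hs
    have hKr : ∀ u', Keeps buildRegs D.cap u u' → D.Ready u' := fun u' h =>
      Edits.ready_build (A := A) hready h.edits
    have hmemA : ∀ a, a ≤ 2 * k → a ≠ 2 * i + 1 → ∀ j, u.mem (D.cell a j) = s.mem (D.cell a j) :=
      fun a ha hne j => Eu.mem_cell ha (fun a h => by simp only [hA] at h; omega) hne j
    refine wp_block_cons (wp_loadArr_keeps (D := D) (j := q) (M := buildRegs) Keeps.refl
      (by simp [buildRegs]) hready.base (by simp [h1]) (by omega) (by omega)
      fun u1 K1 f1 n1 t1 => ?_)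
    rw [hmemA _ (by omega) (by omega), hperm.perm q hq, ← ht] at f1
    refine wp_block_cons ((wp_loadCols (b := 0) hi (by omega) (by omega) htm.le
      (P.sch i).toList u1 (hKr _ K1) f1 (fun a => Finset.mem_toList.1) (Finset.nodup_toList _)).mono
      fun u2 ⟨K2', v2, t2⟩ => ?_)
    have K2 : Keeps buildRegs D.cap u u2 := K1.trans (K2'.mono (by
      rintro r ⟨a, _, rfl⟩; simp only [buildRegs, bank]; omega))
    have n2 : ∀ r < 20, u2.reg r = u1.reg r := fun r hr => K2'.reg r (by
      rintro ⟨a, _, rfl⟩; simp only [bank] at hr; omega)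
    have haddr : (Expr.reg (bank 3 (P.src i)) + (.reg 11 * .const (P.width i) +
        .const (P.sch i).card) : Expr).addr u2.reg = D.off i + t * P.width i + (P.sch i).card := by
      refine Expr.addr_eq ?_
      simp [n2, f1, (hKr _ K2).off i hi, add_assoc]
    refine wp_block_cons (wp_load ?_)
    rw [haddr]
    have hlt : D.off i + t * P.width i + (P.sch i).card < D.base := by
      have h5 := D.off_le i hi
      have h6 : (t + 1) * P.width i ≤ D.m i * P.width i := Nat.mul_le_mul_right _ htm
      have h7 : (t + 1) * P.width i = t * P.width i + P.width i := by ring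
      have h8 : P.width i = (P.sch i).card + 1 := rfl
      omega
    set u3 := (u2.load 12 (D.off i + t * P.width i + (P.sch i).card)).tick
      (1 + (Expr.reg (bank 3 (P.src i)) + (.reg 11 * .const (P.width i) +
        .const (P.sch i).card) : Expr).cost) with hu3
    have K3 : Keeps buildRegs D.cap u u3 :=
      (K2.load (by simp [buildRegs]) (hlt.trans hcap)).tick _
    have f3 : u3.reg 12 = D.wt i (D.val i t) := by
      simp only [hu3, State.tick, State.load, Function.update_self, (hKr _ K2).inp _ hlt]
      exact D.inp_wt i hi t htm
    have n3 : ∀ r, r ≠ 12 → u3.reg r = u2.reg r := fun r hr => by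
      simp [hu3, State.tick, State.load, hr]
    have t3 : u3.time = u2.time + 8 := rfl
    refine wp_block_cons ((hB D X u3 (D.val i t) J (hKr _ K3) (fun c hc => ?_)
      (fun c hc a ha => ?_) fun c hc => hJ c (Finset.mem_toList.1 hc)).mono
      fun u4 ⟨K4', f4, t4⟩ => ?_)
    · have hc := Finset.mem_toList.1 hc
      have hlt := Plan.lt_of_mem_ch hc
      have hck := (Plan.mem_ch.1 hc).1
      obtain ⟨h3, h4⟩ := hch c hlt hck
      refine ⟨h3, ⟨⟨fun x hx => ?_⟩, fun x hx => ?_⟩⟩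
      · rw [K3.mem, hmemA _ (by omega) (by omega), h4.perm x hx]
      · rw [K3.mem, hmemA _ (by omega) (by omega), h4.pre x hx]
    · obtain ⟨hck, hc0, hpar⟩ := Plan.mem_ch.1 (Finset.mem_toList.1 hc)
      rw [n3 _ (by simp only [bank]; omega)]
      exact v2 htm a (Finset.mem_toList.2 (hpar ▸ Plan.key_subset hck hc0 ha))
    have K4 : Keeps buildRegs D.cap u u4 := K3.trans (K4'.mono fun r hr => by
      unfold mulRegs at hr; unfold buildRegs; omega)
    have n4 : ∀ r, r = 10 ∨ r = 17 ∨ r = 18 → u4.reg r = u.reg r := fun r hr => by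
      rw [K4'.reg r (by unfold mulRegs; omega), n3 r (by omega), n2 r (by omega),
        n1 r (by omega)]
    refine wp_block_cons (wp_set_keeps K4 (by simp [buildRegs]) fun u5 K5 f5 n5 t5 => ?_)
    have e10 : u5.reg 10 = D.preSum X i (q + 1) := by
      rw [f5]
      simp only [Expr.eval_add, Expr.eval_reg, n4 10 (by omega), hu, f4, f3, Data.preSum, ← ht]
      rw [Finset.prod_map_toList]
    have E5 : Edits D buildRegs A s u5 := Eu.trans K5.edits
    refine wp_block_cons (wp_storeArr_edits (D := D) (j := q + 1) (M := buildRegs) (A := A)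
      (E5.ready_build hs).base (by simp [n5, n4, h1]) (by omega) (by omega) rfl
      fun u6 E6' r6 m6 t6 => wp_block_nil ⟨?_, ?_, ⟨?_, ?_, ?_, ?_⟩, ?_⟩)
    · change u6.reg 18 = _
      rw [r6, n5 _ (by omega), n4 _ (by omega), h1]
    · simp [State.tick, State.setReg, r6, n5, n4, h2]
    · exact ((E5.trans E6').tick 1).setReg (by simp [buildRegs]) _
    · simp [State.tick, State.setReg, r6, n5, n4, h2]
    · simp [State.tick, State.setReg, r6, e10]
    · intro x hxq
      change u6.mem _ = _
      rw [m6]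
      rcases hxq.lt_or_eq with hxq | rfl
      · rw [Function.update_of_ne fun e => by
          have := (D.cell_inj (by omega) (by omega) e).2
          omega, K5.mem, hx x (by omega)]
      · simp [e10]
    · simp only [State.tick, Expr.cost_add, Expr.cost_reg, Expr.cost_const] at t1 t2 t5 t6 ⊢
      omega
  · refine ⟨E4.tick 1, hx, ?_⟩
    simp only [State.tick, Expr.cost_reg, Expr.cost_const] at t2 t3 ⊢
    have e : (B + 8 * w + 150) * ((D.m i + 1) * (J + 1)) = D.m i * (B * (J + 1)) +
      D.m i * (8 * w) + B * (J + 1) + 8 * w * (D.m i * J) + 8 * w * (J + 1) +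
      150 * (D.m i * J) + 150 * D.m i + 150 * J + 150 := by ring
    have e2 : D.m i * (B * (J + 1) + 8 * w + 60 + 8) = D.m i * (B * (J + 1)) +
      D.m i * (8 * w) + 68 * D.m i := by ring
    rw [e]
    rw [e2] at t4
    omega

theorem exists_wp_order (P : Plan n k) {i : ℕ} (hi : i < k) : ∃ B, ∀ (D : Data P) (s : State)
    (J : ℕ), D.Ready s → (0 < i → D.m i < 2 ^ J) → wp (P.order i) s fun s' =>
    Edits D buildRegs (fun a => a = 2 * i ∨ a = 2 * k) s s' ∧
    (∃ X, D.Sorted X i ∧ D.HasPerm X i s'.mem) ∧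
    s'.time ≤ s.time + B * ((D.m i + 1) * (J + 1)) := by
  rcases Nat.eq_zero_or_pos i with rfl | hi0
  swap
  · obtain ⟨B, hB⟩ := exists_wp_sort P hi
    refine ⟨B, fun D s J hs hJ => ?_⟩
    rw [Plan.order, if_neg hi0.ne']
    exact (hB D s J hs (hJ hi0)).mono fun s' ⟨h1, h2, h3⟩ => ⟨h1.mono (fun r hr => by
      unfold sortRegs at hr; unfold buildRegs; omega) fun _ => id, h2, h3⟩
  refine ⟨50, fun D s J hs _ => ?_⟩
  set A : ℕ → Prop := fun a => a = 2 * 0 ∨ a = 2 * k with hA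
  have hm := D.m_le_total hi
  have hsrc : P.src 0 < D.base := (P.src_lt 0 hi).trans_le D.le_base
  have hcap : D.base < D.cap := by
    have : 0 < (2 * k + 1) * (2 * D.total + 3) := by positivity
    unfold Data.cap; omega
  rw [Plan.order, if_pos rfl]
  refine wp_block_cons (wp_load ?_)
  rw [Expr.addr_eq (show (Expr.const (P.src 0 : ℕ)).eval s.reg = (P.src 0 : ℕ) by simp)]
  set s1 := (s.load 2 (P.src 0)).tick (1 + (Expr.const (P.src 0 : ℕ)).cost) with hs1
  have E1 : Edits D buildRegs A s s1 :=
    Keeps.edits ((Keeps.refl.load (by simp [buildRegs]) (hsrc.trans hcap)).tick _)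
  have h12 : s1.reg 2 = D.m 0 := by
    simp [hs1, State.tick, State.load, hs.inp _ hsrc, D.inp_size 0 hi]
  have t1 : s1.time = s.time + 2 := rfl
  refine wp_block_cons (wp_for (fun q u => Edits D buildRegs A s u ∧ u.reg 2 = D.m 0 ∧
    ∀ x < q, u.mem (D.cell 0 x) = x) (D.m 0) 20 (fun q u t h => ⟨h.1.tick t, h.2⟩)
    ⟨E1.setReg (by simp [buildRegs]) _, by simpa [State.setReg] using h12,
      fun x hx => by omega⟩ (by simpa [State.setReg] using h12)
    (fun q hq u ⟨Eu, _, hu⟩ h1 h2 => ?_) fun s2 ⟨E2, _, l2⟩ t2 => wp_block_nil ?_)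
  · refine wp_storeArr_edits (D := D) (j := q) (M := buildRegs) (A := A)
      (Eu.ready_build hs).base (by simp [h1]) (by omega) (by omega) (Or.inl rfl)
      fun u' E' r' m' t' => ⟨?_, ?_, ⟨?_, ?_, ?_⟩, ?_⟩
    · rw [r', h1]
    · simp [State.setReg, r', h2]
    · exact (Eu.trans E').setReg (by simp [buildRegs]) _
    · simp [State.setReg, r', h2]
    · intro x hx
      change u'.mem _ = _
      rw [m']
      rcases (Nat.lt_succ_iff.1 hx).lt_or_eq with hx | rfl
      · rw [Function.update_of_ne fun e => ?_, hu x hx]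
        have := (D.cell_inj (by omega) (by omega) e).2
        omega
      · simp [h1]
    · simp only [Expr.cost_reg] at t'
      omega
  · refine ⟨E2.tick 1, ⟨⟨fun _ => id, fun _ _ => 0⟩, ⟨fun q h => h, fun q _ q' _ h => h,
      fun q q' _ _ => ?_⟩, ⟨l2⟩⟩, ?_⟩
    · have : P.key 0 = [] := List.eq_nil_iff_forall_not_mem.2 fun a ha => by
        obtain ⟨_, j, hj, _⟩ := Plan.mem_key.1 ha
        omega
      simp [Plan.keyOf, this]
    · simp only [State.tick]
      have : 50 * ((D.m 0 + 1) * (J + 1)) =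
        50 * (D.m 0 * J) + 50 * D.m 0 + 50 * J + 50 := by ring
      omega

end SubsetSamplingJoin

namespace SubsetSamplingJoin

variable {n k : ℕ}

namespace Plan

variable (P : Plan n k)

/-- Compute the arrays of the first stages, in decreasing order. -/
noncomputable def arrays : ℕ → Cmd
  | 0 => .skip
  | i + 1 => .seq (P.order i) (.seq (P.prefixSums i) (arrays i))

end Plan

/-- Compute the offsets of the relations, whose rows have the widths `w`, and the size of the
input. -/
def Cmd.layout (k : ℕ) (w : ℕ → ℕ) : ℕ → Cmd
  | 0 => .set 0 (.const k)
  | j + 1 => .seq (layout k w j) (.block [.set (bank 3 j) (.reg 0), .load 1 (.const j),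
      .set 0 (.reg 0 + .reg 1 * .const (w j))])

theorem exists_wp_arrays (P : Plan n k) : ∀ i ≤ k, ∃ B, ∀ (D : Data P) (X : Index) (s : State)
    (J : ℕ), D.Ready s → (∀ c, i ≤ c → c < k → D.Stage X c ∧ D.Has X c s.mem) →
    (∀ c, 0 < c → c < k → D.m c < 2 ^ J) → wp (P.arrays i) s fun s' =>
    Edits D buildRegs (· ≤ 2 * k) s s' ∧
    (∃ X', ∀ c < k, D.Stage X' c ∧ D.Has X' c s'.mem) ∧
    s'.time ≤ s.time + B * ((D.total + 1) * (J + 1)) := by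
  intro i
  induction i with
  | zero =>
    intro _
    refine ⟨1, fun D X s J hs hX hJ => wp_skip ⟨Edits.refl.tick 1, ⟨X, fun c hc =>
      hX c (Nat.zero_le _) hc⟩, ?_⟩⟩
    have : 0 < (D.total + 1) * (J + 1) := by positivity
    simp only [State.tick]
    omega
  | succ i ih =>
    intro hi
    obtain ⟨B₁, h₁⟩ := exists_wp_order P hi
    obtain ⟨B₂, h₂⟩ := exists_wp_prefixSums P hi
    obtain ⟨B₃, h₃⟩ := ih (by omega)
    refine ⟨B₁ + B₂ + B₃, fun D X s J hs hX hJ => ?_⟩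
    have hle : (D.m i + 1) * (J + 1) ≤ (D.total + 1) * (J + 1) :=
      Nat.mul_le_mul_right _ (by have := D.m_le_total hi; omega)
    refine wp_seq ((h₁ D s J hs fun h => hJ i h hi).mono fun s1 ⟨E1, ⟨Y, hY, hYm⟩, t1⟩ =>
      wp_seq ?_)
    set X₁ : Index := ⟨Function.update X.perm i (Y.perm i), X.pre⟩ with hX₁
    have hp : ∀ c, c ≠ i → X₁.perm c = X.perm c := fun c hc => Function.update_of_ne hc _ _
    have hpi : X₁.perm i = Y.perm i := Function.update_self ..
    have hcell : ∀ c, i < c → c < k → ∀ q, s1.mem (D.cell (2 * c) q) = s.mem (D.cell (2 * c) q) ∧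
        s1.mem (D.cell (2 * c + 1) q) = s.mem (D.cell (2 * c + 1) q) := fun c hc hck q =>
      ⟨E1.mem_cell (by omega) (by omega) (by omega) q, E1.mem_cell (by omega) (by omega)
        (by omega) q⟩
    have hH1 : ∀ c, i < c → c < k → D.Stage X₁ c ∧ D.Has X₁ c s1.mem := fun c hc hck => by
      obtain ⟨g1, g2⟩ := hX c hc hck
      refine ⟨g1.congr (fun c' h => hp c' (by omega)) fun _ _ => rfl, ⟨⟨fun q hq => ?_⟩,
        fun q hq => ?_⟩⟩
      · rw [(hcell c hc hck q).1, g2.perm q hq, hp c (by omega)]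
      · rw [(hcell c hc hck q).2, g2.pre q hq]
    have hS1 : D.Sorted X₁ i := hY.congr hpi
    have hP1 : D.HasPerm X₁ i s1.mem := hYm.congr hpi
    refine (h₂ D X₁ s1 J (E1.ready_build hs) hS1 hP1
      (fun c hc hck => ⟨(hH1 c hc hck).1.toSorted, (hH1 c hc hck).2⟩)
      fun c hc => hJ c (by have := Plan.lt_of_mem_ch hc; omega) (Plan.mem_ch.1 hc).1).mono
      fun s2 ⟨E2, hpre, t2⟩ => ?_
    set X₂ : Index := ⟨X₁.perm, Function.update X₁.pre i (D.preSum X₁ i)⟩ with hX₂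
    have hq : ∀ c, c ≠ i → X₂.pre c = X₁.pre c := fun c hc => Function.update_of_ne hc _ _
    have hqi : X₂.pre i = D.preSum X₁ i := Function.update_self ..
    have hcell2 : ∀ a, a ≤ 2 * k → a ≠ 2 * i + 1 → ∀ q,
        s2.mem (D.cell a q) = s1.mem (D.cell a q) := fun a ha hne q =>
      E2.mem_cell ha (by omega) hne q
    have E12 := (E1.mono (A' := (· ≤ 2 * k)) (fun _ => id) (by omega)).trans
      (E2.mono (A' := (· ≤ 2 * k)) (fun _ => id) (by omega))
    refine (h₃ D X₂ s2 J (E12.ready_build hs) (fun c hc hck => ?_) hJ).mono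
      fun s3 ⟨E3, hX3, t3⟩ => ⟨E12.trans E3, hX3, ?_⟩
    · rcases hc.eq_or_lt with rfl | hc
      · refine ⟨⟨hS1.congr rfl, by rw [hqi]; rfl, fun q hq' => ?_⟩, ⟨⟨fun q hq' => ?_⟩,
          fun q hq' => ?_⟩⟩
        · rw [hqi, Data.preSum]
          congr 2
          refine Finset.prod_congr rfl fun c hc =>
            (Data.grp_index_congr (X := X₁) (X' := X₂) rfl (hq c ?_) _).symm
          exact (Plan.lt_of_mem_ch hc).ne'
        · rw [hcell2 _ (by omega) (by omega), hP1.perm q hq']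
        · rw [hqi, hpre q hq']
      · obtain ⟨g1, g2⟩ := hH1 c hc hck
        refine ⟨g1.congr (fun _ _ => rfl) fun c' h => hq c' (by omega), ⟨⟨fun q hq' => ?_⟩,
          fun q hq' => ?_⟩⟩
        · rw [hcell2 _ (by omega) (by omega), g2.perm q hq']
        · rw [hcell2 _ (by omega) (by omega), g2.pre q hq', hq c (by omega)]
    · rw [add_mul, add_mul]
      have e1 := Nat.mul_le_mul_left B₁ hle
      have e2 := Nat.mul_le_mul_left B₂ hle
      omega

theorem exists_wp_layout (k : ℕ) (w : ℕ → ℕ) : ∀ j ≤ k, ∃ B, ∀ (s : State) (L : ℕ → ℕ),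
    (∀ r < k, s.mem r = L r) → wp (.layout k w j) s fun s' => s'.mem = s.mem ∧
      s'.top ≤ max s.top k ∧ s'.time ≤ s.time + B ∧
      s'.reg 0 = (k + ∑ r ∈ Finset.range j, L r * w r : ℕ) ∧
      ∀ i < j, s'.reg (bank 3 i) = (k + ∑ r ∈ Finset.range i, L r * w r : ℕ) := by
  intro j
  induction j with
  | zero =>
    intro _
    exact ⟨2, fun s L _ => wp_set ⟨rfl, le_max_left _ _, le_rfl,
      by simp [State.tick, State.setReg], fun i hi => absurd hi (by omega)⟩⟩
  | succ j ih =>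
    intro hj
    obtain ⟨B, hB⟩ := ih (by omega)
    refine ⟨B + 20, fun s L hL => wp_seq ((hB s L hL).mono
      fun s1 ⟨m1, T1, t1, z1, o1⟩ => wp_block_cons ?_)⟩
    refine wp_set (wp_block_cons (wp_load (wp_block_cons (wp_set (wp_block_nil ?_)))))
    rw [Expr.addr_eq (show (Expr.const (j : ℕ)).eval _ = (j : ℕ) by simp)]
    have h0 : bank 3 j ≠ 0 := by simp only [bank]; omega
    have h1 : bank 3 j ≠ 1 := by simp only [bank]; omega
    refine ⟨m1, ?_, ?_, ?_, fun i hi => ?_⟩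
    · change max s1.top (j + 1) ≤ _
      exact max_le T1 (le_max_of_le_right hj)
    · change s1.time + 2 + 2 + 6 + 1 ≤ _
      omega
    · rw [Finset.sum_range_succ]
      simp [State.tick, State.setReg, State.load, h0.symm, z1, m1, hL j hj]
      ring
    · have hi0 : bank 3 i ≠ 0 := by simp only [bank]; omega
      have hi1 : bank 3 i ≠ 1 := by simp only [bank]; omega
      rcases (Nat.lt_succ_iff.1 hi).lt_or_eq with hi | rfl
      · have : bank 3 i ≠ bank 3 j := by simp only [bank]; omega
        simpa [State.tick, State.setReg, State.load, hi0, hi1, this] using o1 i hi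
      · simpa [State.tick, State.setReg, State.load, hi0, hi1] using z1

/-- The program that builds the index; the rows of the `j`-th relation have the width `w j`. -/
noncomputable def Plan.build (P : Plan n k) (w : ℕ → ℕ) : Cmd := .seq (.layout k w k) (P.arrays k)

theorem exists_wp_build (P : Plan n k) (w : ℕ → ℕ) : ∃ B, ∀ (D : Data P) (s : State) (L : ℕ → ℕ)
    (J : ℕ), (∀ r < k, D.inp r = L r) → D.base = k + ∑ r ∈ Finset.range k, L r * w r →
    (∀ i < k, D.off i = k + ∑ r ∈ Finset.range (P.src i), L r * w r) →
    (∀ a < D.base, s.mem a = D.inp a) → (∀ c, 0 < c → c < k → D.m c < 2 ^ J) →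
    wp (P.build w) s fun s' => D.Ready s' ∧ (∃ X, ∀ c < k, D.Stage X c ∧ D.Has X c s'.mem) ∧
      s'.top ≤ max s.top D.cap ∧ s'.time ≤ s.time + B * ((D.total + 1) * (J + 1)) := by
  obtain ⟨B₁, h₁⟩ := exists_wp_layout k w k le_rfl
  obtain ⟨B₂, h₂⟩ := exists_wp_arrays P k le_rfl
  refine ⟨B₁ + B₂, fun D s L J hL hbase hoff hin hJ => wp_seq ((h₁ s L fun r hr => ?_).mono
    fun s1 ⟨m1, T1, t1, z1, o1⟩ => ?_)⟩
  · rw [hin r (hr.trans_le D.le_base), hL r hr]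
  have hs1 : D.Ready s1 := ⟨by rw [z1, hbase], fun i hi => by rw [o1 _ (P.src_lt i hi), hoff i hi],
    fun a ha => by rw [m1, hin a ha]⟩
  refine (h₂ D ⟨fun _ => id, fun _ _ => 0⟩ s1 J hs1 (fun c h1 h2 => by omega) hJ).mono
    fun s2 ⟨E2, hX, t2⟩ => ⟨E2.ready_build hs1, hX, E2.top.trans (max_le (T1.trans
      (max_le_max le_rfl ?_)) (le_max_right _ _)), ?_⟩
  · have := D.le_base
    unfold Data.cap; omega
  · rw [add_mul]
    have : B₁ * 1 ≤ B₁ * ((D.total + 1) * (J + 1)) :=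
      Nat.mul_le_mul_left _ (Nat.succ_le_of_lt (by positivity))
    omega

end SubsetSamplingJoin

namespace SubsetSamplingJoin

variable {n k : ℕ}

/-! ### The data of an instance -/

/-- An order of the relations with the running intersection property. -/
structure JoinOrder (S : JoinSchema n k) where
  σ : ℕ → Fin k
  par : ℕ → ℕ
  pos : 0 < k
  inj : ∀ i < k, ∀ j < k, σ i = σ j → i = j
  surj : ∀ r, ∃ i < k, σ i = r
  par_lt : ∀ i, 0 < i → i < k → par i < i
  rip : ∀ i, 0 < i → i < k → ∀ a ∈ S.schema (σ i), ∀ j < i, a ∈ S.schema (σ j) →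
    a ∈ S.schema (σ (par i))

theorem JoinSchema.Acyclic.nonempty_joinOrder {S : JoinSchema n k} (hS : S.Acyclic) :
    Nonempty (JoinOrder S) := by
  obtain ⟨σ, par, h0, h1, h2, h3, h4⟩ := hS.exists_order
  exact ⟨⟨σ, par, h0, fun i hi j hj => h1 i hi j hj, h2, h3, h4⟩⟩

namespace JoinOrder

variable {S : JoinSchema n k} (O : JoinOrder S)

/-- The plan given by an order of the relations. -/
noncomputable def plan : Plan n k where
  sch i := S.schema (O.σ i)
  par := O.par
  src i := O.σ i
  col i a := if h : a ∈ S.schema (O.σ i) then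
    (((S.schema (O.σ i)).orderIsoOfFin rfl).symm ⟨a, h⟩ : Fin _) else 0
  src_lt i _ := (O.σ i).2
  col_lt i a h := by rw [dif_pos h]; exact Fin.is_lt _
  par_lt := O.par_lt
  rip := O.rip
  cover a := by
    obtain ⟨r, hr⟩ := S.cover a
    obtain ⟨i, hi, rfl⟩ := O.surj r
    exact ⟨i, hi, hr⟩

@[to_additive]
theorem prod_range {M : Type*} [CommMonoid M] (f : Fin k → M) :
    ∏ j ∈ Finset.range k, f (O.σ j) = ∏ i, f i := by
  refine Finset.prod_nbij O.σ (fun _ _ => Finset.mem_univ _) (fun i hi j hj h => ?_)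
    (fun r _ => ?_) fun _ _ => rfl
  · exact O.inj i (by simpa using hi) j (by simpa using hj) h
  · obtain ⟨i, hi, h⟩ := O.surj r
    exact ⟨i, by simpa using hi, h⟩

end JoinOrder

/-- A tuple extended by zeros. -/
noncomputable def Tup.extend {U : Finset (Fin n)} (u : Tup U) : Fin n → ℝ :=
  fun a => if h : a ∈ U then u ⟨a, h⟩ else 0

theorem proj_eq_iff {U : Finset (Fin n)} {v : Fin n → ℝ} {u : Tup U} :
    proj U v = u ↔ ∀ a ∈ U, v a = u.extend a := by
  constructor
  · rintro rfl a ha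
    simp [Tup.extend, ha, proj]
  · intro h
    funext ⟨a, ha⟩
    simp [proj, h a ha, Tup.extend, ha]

theorem Tup.proj_extend {U : Finset (Fin n)} (u : Tup U) : proj U u.extend = u :=
  proj_eq_iff.2 fun _ _ => rfl

section FlatMap

variable {α : Type*} (g : α → List ℝ)

/-- The length of the image of the `r`-th element of a list. -/
def blockLength (l : List α) (r : ℕ) : ℕ := (l[r]?).elim 0 fun a => (g a).length

theorem length_flatMap_eq_sum (l : List α) :
    (l.flatMap g).length = ∑ r ∈ Finset.range l.length, blockLength g l r := by
  induction l with
  | nil => simp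
  | cons a l ih =>
    rw [List.flatMap_cons, List.length_append, ih, List.length_cons, Finset.sum_range_succ',
      add_comm]
    rfl

theorem getD_flatMap (l : List α) : ∀ (t : ℕ) (ht : t < l.length) (x : ℕ), x < (g l[t]).length →
    (l.flatMap g).getD (∑ r ∈ Finset.range t, blockLength g l r + x) 0 = (g l[t]).getD x 0 := by
  induction l with
  | nil => intro t ht; simp at ht
  | cons a l ih =>
    intro t ht x hx
    cases t with
    | zero =>
      have hx' : x < (g a).length := hx
      rw [List.flatMap_cons, Finset.sum_range_zero, zero_add, List.getD_append _ _ _ _ hx']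
      rfl
    | succ t =>
      have e : ∑ r ∈ Finset.range (t + 1), blockLength g (a :: l) r + x =
          (∑ r ∈ Finset.range t, blockLength g l r + x) + (g a).length := by
        rw [Finset.sum_range_succ', add_right_comm]
        rfl
      rw [List.flatMap_cons, e, List.getD_append_right _ _ _ _ (by omega), Nat.add_sub_cancel]
      exact ih t (by simpa using ht) x hx

theorem getD_flatMap_of_length_eq {w : ℕ} (l : List α) (hg : ∀ a, (g a).length = w) (t : ℕ)
    (ht : t < l.length) (x : ℕ) (hx : x < w) :
    (l.flatMap g).getD (t * w + x) 0 = (g l[t]).getD x 0 := by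
  rw [← getD_flatMap g l t ht x (by rw [hg]; exact hx)]
  congr 2
  rw [Finset.sum_congr rfl fun r hr => show blockLength g l r = w by
    have : r < l.length := (Finset.mem_range.1 hr).trans ht
    simp [blockLength, this, hg]]
  simp

end FlatMap

namespace Instance

variable {S : JoinSchema n k} (I : Instance S)

/-- The size of the `r`-th relation. -/
def relSize (r : ℕ) : ℕ := if h : r < k then (I.rel ⟨r, h⟩).length else 0

/-- The width of the rows of the `r`-th relation. -/
def _root_.SubsetSamplingJoin.JoinSchema.relWidth (S : JoinSchema n k) (r : ℕ) : ℕ :=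
  if h : r < k then (S.schema ⟨r, h⟩).card + 1 else 0

@[simp] theorem length_row (i : Fin k) (u : Tup (S.schema i)) :
    (I.row i u).length = (S.schema i).card + 1 := by
  simp [row]

theorem length_flatMap_row (i : Fin k) :
    ((I.rel i).flatMap (I.row i)).length = I.relSize i * S.relWidth i := by
  rw [length_flatMap_eq_sum, Finset.sum_congr rfl fun r hr =>
    show blockLength (I.row i) (I.rel i) r = S.relWidth i by
      simp [blockLength, Finset.mem_range.1 hr, JoinSchema.relWidth]]
  simp [relSize]

theorem blockLength_finRange {r : ℕ} (hr : r < k) :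
    blockLength (fun i => (I.rel i).flatMap (I.row i)) (List.finRange k) r =
      I.relSize r * S.relWidth r := by
  have : (List.finRange k)[r]? = some ⟨r, hr⟩ := by simp [hr]
  rw [blockLength, this]
  exact I.length_flatMap_row ⟨r, hr⟩

/-- The address of the first row of the `r`-th relation. -/
def relStart (r : ℕ) : ℕ := k + ∑ j ∈ Finset.range r, I.relSize j * S.relWidth j

theorem length_input : I.input.length = I.relStart k := by
  rw [input, List.length_append, List.length_ofFn, length_flatMap_eq_sum, relStart,
    List.length_finRange]
  congr 1
  exact Finset.sum_congr rfl fun r hr => I.blockLength_finRange (Finset.mem_range.1 hr)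

theorem getD_input_size (i : Fin k) : I.input.getD i 0 = (I.rel i).length := by
  rw [input, List.getD_append _ _ _ _ (by simp)]
  simp

theorem relStart_add_le {r : ℕ} (hr : r < k) :
    I.relStart r + I.relSize r * S.relWidth r ≤ I.relStart k := by
  unfold relStart
  rw [add_assoc, ← Finset.sum_range_succ]
  exact Nat.add_le_add_left (Finset.sum_le_sum_of_subset (Finset.range_subset_range.2 hr)) _

theorem getD_input_row (i : Fin k) {t x : ℕ} (ht : t < (I.rel i).length)
    (hx : x < (S.schema i).card + 1) :
    I.input.getD (I.relStart i + t * S.relWidth i + x) 0 = (I.row i (I.rel i)[t]).getD x 0 := by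
  have hw : S.relWidth i = (S.schema i).card + 1 := by simp [JoinSchema.relWidth]
  have h1 : t * S.relWidth i + x < ((I.rel i).flatMap (I.row i)).length := by
    rw [length_flatMap_row, show I.relSize i = (I.rel i).length by simp [relSize]]
    have : (t + 1) * S.relWidth i ≤ (I.rel i).length * S.relWidth i :=
      Nat.mul_le_mul_right _ ht
    rw [add_mul, one_mul] at this
    omega
  rw [input, List.getD_append_right _ _ _ _ (by simp [relStart]; omega)]
  have hfi : (List.finRange k)[(i : ℕ)]'(by simp) = i := by simp
  have h2 := getD_flatMap (fun i => (I.rel i).flatMap (I.row i)) (List.finRange k) i (by simp)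
    (t * S.relWidth i + x) (by rw [hfi]; exact h1)
  rw [Finset.sum_congr rfl fun r hr => I.blockLength_finRange
    ((Finset.mem_range.1 hr).trans i.2)] at h2
  have e : I.relStart i + t * S.relWidth i + x - (List.ofFn fun i =>
      ((I.rel i).length : ℝ)).length = ∑ r ∈ Finset.range (i : ℕ), I.relSize r * S.relWidth r +
      (t * S.relWidth i + x) := by
    simp only [relStart, List.length_ofFn]
    omega
  rw [e, h2]
  rw [hfi, hw]
  exact getD_flatMap_of_length_eq (I.row i) (I.rel i) (I.length_row i) t ht x hx

/-- The data of an instance for the plan given by an order of the relations. -/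
noncomputable def data (O : JoinOrder S) : Data O.plan where
  m i := (I.rel (O.σ i)).length
  val i t := ((I.rel (O.σ i)).getD t 0).extend
  wt i u := I.wt (O.σ i) (proj _ u)
  base := I.input.length
  off i := I.relStart (O.σ i)
  inp a := I.input.getD a 0
  wt_congr i u v h := by
    congr 1
    funext ⟨a, ha⟩
    exact h a ha
  wt_mem i _ t ht := by
    rw [Tup.proj_extend, List.getD_eq_getElem _ _ ht]
    exact I.wt_mem _ _ (List.getElem_mem ht)
  val_inj i _ t ht t' ht' h := by
    rw [List.getD_eq_getElem _ _ ht, List.getD_eq_getElem _ _ ht'] at h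
    have := (Tup.proj_extend _).symm.trans (proj_eq_iff.2 h)
    exact (List.Nodup.getElem_inj_iff (I.nodup _)).1 this
  le_base := by rw [length_input]; exact Nat.le_add_right _ _
  off_le i _ := by
    rw [length_input]
    refine le_trans (le_of_eq ?_) (I.relStart_add_le (O.σ i).2)
    simp [relSize, JoinSchema.relWidth, Plan.width, JoinOrder.plan]
  inp_size i _ := I.getD_input_size (O.σ i)
  inp_val i _ t ht a ha := by
    have hc : O.plan.col i a < (S.schema (O.σ i)).card := O.plan.col_lt i a ha
    have hw : O.plan.width i = S.relWidth (O.σ i) := by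
      simp [Plan.width, JoinSchema.relWidth, JoinOrder.plan]
    rw [hw, I.getD_input_row (O.σ i) ht (by omega), row, List.getD_append _ _ _ _ (by simpa),
      List.getD_eq_getElem _ _ (by simpa), List.getElem_ofFn, List.getD_eq_getElem _ _ ht]
    have ha' : a ∈ S.schema (O.σ i) := ha
    have : ((S.schema (O.σ i)).orderIsoOfFin rfl) ⟨O.plan.col i a, hc⟩ = ⟨a, ha'⟩ := by
      rw [← OrderIso.eq_symm_apply]
      exact Fin.ext (by simp only [JoinOrder.plan, dif_pos ha'])
    rw [this, Tup.extend, dif_pos ha']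
  inp_wt i _ t ht := by
    have hw : O.plan.width i = S.relWidth (O.σ i) := by
      simp [Plan.width, JoinSchema.relWidth, JoinOrder.plan]
    have hc : (O.plan.sch i).card = (S.schema (O.σ i)).card := rfl
    rw [hw, hc, I.getD_input_row (O.σ i) ht (by omega), row,
      List.getD_append_right _ _ _ _ (by simp), List.getD_eq_getElem _ _ ht, Tup.proj_extend]
    simp

variable (O : JoinOrder S)

theorem total_data : (I.data O).total = I.size := O.sum_range fun i => (I.rel i).length

theorem weight_data (u : Fin n → ℝ) : (I.data O).weight u = I.weight u :=
  O.prod_range fun i => I.wt i (proj _ u)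

theorem mem_leaves_data {X : Index} (hX : ∀ i < k, (I.data O).Stage X i) (v u : Fin n → ℝ) :
    u ∈ (I.data O).leaves X k 0 v ↔ u ∈ I.join := by
  rw [Data.mem_leaves hX k 0 (by omega), join, Set.Finite.mem_toFinset]
  constructor
  · intro h r
    obtain ⟨j, hj, rfl⟩ := O.surj r
    obtain ⟨t, ht, h⟩ := h.2 j (by omega) hj
    rw [show proj (S.schema (O.σ j)) u = _ from proj_eq_iff.2 h, List.getD_eq_getElem _ _ ht]
    exact List.getElem_mem ht
  · intro h
    refine ⟨fun j hj => by omega, fun j _ _ => ?_⟩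
    obtain ⟨t, ht, e⟩ := List.getElem_of_mem (h (O.σ j))
    exact ⟨t, ht, proj_eq_iff.1 (by rw [List.getD_eq_getElem _ _ ht, e]; rfl)⟩

end Instance

end SubsetSamplingJoin

namespace SubsetSamplingJoin

open MeasureTheory
open scoped ENNReal

/-! ### Sessions -/

section Session

variable {α : Type*} {query : Cmd} {s₀ : State} {p : α → ℝ} {L : List α} {enc : α → List ℝ}
  {A B : ℕ}

theorem exists_session
    (hq : ∀ s, SameIndex s₀ s → wp query s fun s' => SameIndex s s' ∧
      s'.out = s.out ++ (kept (process p L s.tape)).map enc ∧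
      s'.time ≤ s.time + A * (process p L s.tape).length + B) (ω : ℕ → Tape) (i : ℕ) :
    ∃ s, session query s₀ ω i = some s ∧ SameIndex s₀ s := by
  induction i with
  | zero => exact ⟨s₀, rfl, rfl, rfl, fun _ => rfl⟩
  | succ i ih =>
    obtain ⟨s, h1, h2⟩ := ih
    have h3 : SameIndex s₀ (s.fresh (ω i)) := ⟨h2.mem, h2.base, h2.off⟩
    obtain ⟨s', h4, h5, _⟩ := (hq _ h3).run
    exact ⟨s', by rw [session, h1]; exact h4, h3.trans h5⟩

theorem exists_session_succ
    (hq : ∀ s, SameIndex s₀ s → wp query s fun s' => SameIndex s s' ∧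
      s'.out = s.out ++ (kept (process p L s.tape)).map enc ∧
      s'.time ≤ s.time + A * (process p L s.tape).length + B) (ω : ℕ → Tape) (i : ℕ) :
    ∃ s, session query s₀ ω (i + 1) = some s ∧ s.out = (kept (process p L (ω i))).map enc ∧
      s.time ≤ A * (process p L (ω i)).length + B := by
  obtain ⟨s, h1, h2⟩ := exists_session hq ω i
  have h3 : SameIndex s₀ (s.fresh (ω i)) := ⟨h2.mem, h2.base, h2.off⟩
  obtain ⟨s', h4, _, h5, h6⟩ := (hq _ h3).run
  refine ⟨s', by rw [session, h1]; exact h4, ?_, ?_⟩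
  · simpa [State.fresh] using h5
  · simpa [State.fresh] using h6

theorem eq_filter_of_sublist {l L : List α} {Y : α → Prop} [DecidablePred Y] (h : l.Sublist L)
    (hL : L.Nodup) (hY : ∀ u ∈ L, u ∈ l ↔ Y u) : l = L.filter (fun u => Y u) := by
  have h1 : l.filter (fun u => Y u) = l :=
    List.filter_eq_self.2 fun u hu => by simpa using (hY u (h.subset hu)).1 hu
  have h2 : l.Sublist (L.filter (fun u => Y u)) := by
    have := h.filter (fun u => decide (Y u))
    rwa [h1] at this
  refine h2.eq_of_length (List.Perm.length_eq ((List.perm_ext_iff_of_nodup (h.nodup hL)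
    (hL.filter _)).2 fun u => ?_))
  simp only [List.mem_filter, decide_eq_true_eq]
  exact ⟨fun hu => ⟨h.subset hu, (hY u (h.subset hu)).1 hu⟩, fun hu => (hY u hu.1).2 hu.2⟩

theorem lintegral_queryTime_le
    (hq : ∀ s, SameIndex s₀ s → wp query s fun s' => SameIndex s s' ∧
      s'.out = s.out ++ (kept (process p L s.tape)).map enc ∧
      s'.time ≤ s.time + A * (process p L s.tape).length + B)
    (hp : ∀ u ∈ L, p u ∈ Set.Icc (0 : ℝ) 1) (i : ℕ) :
    ∫⁻ ω, queryTime query s₀ ω i ∂sessionMeasure ≤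
      ENNReal.ofReal (A * (4 * (L.map p).sum) + B) := by
  have hmeas : Measurable fun τ => ((process p L τ).length : ℝ≥0∞) := by
    let _ : MeasurableSpace (List (α × Prop)) := ⊤
    exact (measurable_from_top (f := fun l : List (α × Prop) => (l.length : ℝ≥0∞))).comp
      (measurable_process p L)
  have h0 : 0 ≤ (L.map p).sum := sum_map_nonneg fun u hu => (hp u hu).1
  calc ∫⁻ ω, queryTime query s₀ ω i ∂sessionMeasure
      ≤ ∫⁻ ω, (A * ((process p L (ω i)).length : ℝ≥0∞) + B) ∂sessionMeasure := by
        refine lintegral_mono fun ω => ?_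
        obtain ⟨s, h1, _, h2⟩ := exists_session_succ hq ω i
        simp only [queryTime, h1]
        exact_mod_cast h2
    _ = A * ∫⁻ τ, ((process p L τ).length : ℝ≥0∞) ∂tapeMeasure + B := by
        have hpres : MeasurePreserving (fun ω : ℕ → Tape => ω i) sessionMeasure tapeMeasure :=
          measurePreserving_eval_infinitePi (fun _ : ℕ => tapeMeasure) i
        rw [hpres.lintegral_comp (f := fun τ => A * ((process p L τ).length : ℝ≥0∞) + B)
          ((hmeas.const_mul _).add_const _), lintegral_add_right _ measurable_const,
          lintegral_const_mul _ hmeas]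
        simp
    _ ≤ A * ENNReal.ofReal (4 * (L.map p).sum) + B := by
        gcongr
        exact lintegral_process_length_le p L hp
    _ = _ := by
        rw [ENNReal.ofReal_add (by positivity) (by positivity),
          ENNReal.ofReal_mul (p := (A : ℝ)) (by positivity), ENNReal.ofReal_natCast, ENNReal.ofReal_natCast]

end Session

variable {n k : ℕ} {S : JoinSchema n k} {I : Instance S} {query : Cmd} {s₀ : State}
  {L : List (Fin n → ℝ)} {A B : ℕ}

theorem returns_iff [DecidableEq (Fin n → ℝ)]
    (hq : ∀ s, SameIndex s₀ s → wp query s fun s' => SameIndex s s' ∧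
      s'.out = s.out ++ (kept (process I.weight L s.tape)).map List.ofFn ∧
      s'.time ≤ s.time + A * (process I.weight L s.tape).length + B)
    (hL : L.Nodup) (hmem : ∀ u, u ∈ L ↔ u ∈ I.join) {Y : Finset (Fin n → ℝ)} (hY : Y ⊆ I.join)
    (ω : ℕ → Tape) (i : ℕ) : Returns query s₀ ω i Y ↔
      kept (process I.weight L (ω i)) = L.filter (fun u => u ∈ Y) := by
  obtain ⟨s, h1, h2, _⟩ := exists_session_succ hq ω i
  have hsub := kept_hits_sublist I.weight L 0 (stepLen (ω i 0)) (ω i).tail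
  constructor
  · rintro ⟨s', h1', l, hl, hlY, ho⟩
    obtain rfl : s = s' := by
      rw [h1] at h1'
      exact Option.some.inj h1'
    have : kept (process I.weight L (ω i)) = l :=
      List.map_injective_iff.2 List.ofFn_injective (h2.symm.trans ho)
    rw [this]
    rw [← process, this] at hsub
    exact eq_filter_of_sublist hsub hL fun u _ => hlY u
  · intro h
    refine ⟨s, h1, L.filter (fun u => u ∈ Y), hL.filter _, fun u => ?_, by rw [h2, h]⟩
    simp only [List.mem_filter, decide_eq_true_eq, hmem]
    exact ⟨fun h => h.2, fun h => ⟨hY h, h⟩⟩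

theorem prod_eq_sampleProb (hL : L.Nodup) (hmem : ∀ u, u ∈ L ↔ u ∈ I.join)
    [DecidableEq (Fin n → ℝ)] {Y : Finset (Fin n → ℝ)} (hY : Y ⊆ I.join) :
    (L.map fun u => if u ∈ Y then I.weight u else 1 - I.weight u).prod = I.sampleProb Y := by
  have hj : L.toFinset = I.join := by
    ext u
    rw [List.mem_toFinset, hmem]
  rw [← List.prod_toFinset _ hL, hj, Finset.prod_ite, Instance.sampleProb]
  congr 1
  · exact Finset.prod_congr (by ext u; simpa using fun h => hY h) fun _ _ => rfl
  · exact Finset.prod_congr (by ext u; simp) fun _ _ => rfl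

theorem sessionMeasure_returns
    (hq : ∀ s, SameIndex s₀ s → wp query s fun s' => SameIndex s s' ∧
      s'.out = s.out ++ (kept (process I.weight L s.tape)).map List.ofFn ∧
      s'.time ≤ s.time + A * (process I.weight L s.tape).length + B)
    (hL : L.Nodup) (hmem : ∀ u, u ∈ L ↔ u ∈ I.join)
    (hp : ∀ u ∈ L, I.weight u ∈ Set.Icc (0 : ℝ) 1) {m : ℕ} {Y : Fin m → Finset (Fin n → ℝ)}
    (hY : ∀ i, Y i ⊆ I.join) :
    sessionMeasure {ω | ∀ i : Fin m, Returns query s₀ ω i (Y i)} =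
      ENNReal.ofReal (∏ i, I.sampleProb (Y i)) := by
  classical
  set t : ℕ → Set Tape := fun j => if h : j < m then
    {τ | kept (process I.weight L τ) = L.filter (fun u => u ∈ Y ⟨j, h⟩)} else Set.univ with ht
  have hset : {ω : ℕ → Tape | ∀ i : Fin m, Returns query s₀ ω i (Y i)} =
      Set.pi (Finset.range m) t := by
    ext ω
    simp only [Set.mem_ofPred_eq, Set.mem_pi, Finset.coe_range, Set.mem_Iio]
    constructor
    · intro h j hj
      simp only [ht, dif_pos hj]
      exact (returns_iff hq hL hmem (hY _) ω j).1 (h ⟨j, hj⟩)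
    · intro h j
      have := h j j.2
      simp only [ht, dif_pos j.2] at this
      exact (returns_iff hq hL hmem (hY _) ω j).2 this
  rw [hset, sessionMeasure, Measure.infinitePi_pi _ fun j hj => ?_]
  · rw [Finset.prod_range, ENNReal.ofReal_prod_of_nonneg fun i _ => ?_]
    · refine Finset.prod_congr rfl fun i _ => ?_
      simp only [ht, dif_pos i.2, Fin.eta]
      have := tapeMeasure_process_kept I.weight (fun u => u ∈ Y i) L hL hp
      rw [← prod_eq_sampleProb hL hmem (hY i)]
      convert this
    · rw [← prod_eq_sampleProb hL hmem (hY i)]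
      refine List.prod_nonneg fun x hx => ?_
      obtain ⟨u, hu, rfl⟩ := List.mem_map.1 hx
      have := hp u hu
      split_ifs
      · exact this.1
      · exact sub_nonneg.2 this.2
  · simp only [ht, dif_pos (Finset.mem_range.1 hj)]
    exact measurableSet_process I.weight L fun h => kept h = _

end SubsetSamplingJoin

namespace SubsetSamplingJoin

variable {n k : ℕ} {S : JoinSchema n k}

namespace Instance

variable (I : Instance S)

theorem size_eq_sum_relSize : I.size = ∑ r ∈ Finset.range k, I.relSize r := by
  rw [Finset.sum_range]
  simp [size, relSize]

theorem length_input_le : I.input.length ≤ k + I.size * (n + 1) := by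
  rw [length_input, relStart, size_eq_sum_relSize, Finset.sum_mul]
  refine Nat.add_le_add_left (Finset.sum_le_sum fun r hr => Nat.mul_le_mul_left _ ?_) _
  rw [JoinSchema.relWidth, dif_pos (Finset.mem_range.1 hr)]
  have : (S.schema ⟨r, Finset.mem_range.1 hr⟩).card ≤ n := by
    simpa using Finset.card_le_univ (S.schema ⟨r, Finset.mem_range.1 hr⟩)
  omega

theorem weight_mem {u : Fin n → ℝ} (hu : u ∈ I.join) : I.weight u ∈ Set.Icc (0 : ℝ) 1 := by
  have h : ∀ i, I.wt i (proj (S.schema i) u) ∈ Set.Icc (0 : ℝ) 1 := fun i =>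
    I.wt_mem i _ ((Set.Finite.mem_toFinset _).1 hu i)
  exact ⟨Finset.prod_nonneg fun i _ => (h i).1,
    Finset.prod_le_one (fun i _ => (h i).1) fun i _ => (h i).2⟩

theorem mu_nonneg : 0 ≤ I.mu := Finset.sum_nonneg fun _ hu => (I.weight_mem hu).1

theorem mu_le_one (h : I.size ≤ 1) : I.mu ≤ 1 := by
  have hcard : I.join.card ≤ 1 := Finset.card_le_one.2 fun u hu v hv => by
    funext a
    obtain ⟨i, hi⟩ := S.cover a
    have hlen : (I.rel i).length ≤ 1 :=
      (Finset.single_le_sum (f := fun i => (I.rel i).length) (fun _ _ => Nat.zero_le _)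
        (Finset.mem_univ i)).trans h
    obtain ⟨x, hx, e⟩ := List.getElem_of_mem ((Set.Finite.mem_toFinset _).1 hu i)
    obtain ⟨y, hy, e'⟩ := List.getElem_of_mem ((Set.Finite.mem_toFinset _).1 hv i)
    obtain rfl : x = y := by omega
    exact congrFun (e.symm.trans e') ⟨a, hi⟩
  calc I.mu ≤ ∑ _u ∈ I.join, (1 : ℝ) := Finset.sum_le_sum fun u hu => (I.weight_mem hu).2
    _ = I.join.card := by simp
    _ ≤ 1 := by exact_mod_cast hcard

theorem sum_map_weight {L : List (Fin n → ℝ)} (hL : L.Nodup) (hmem : ∀ u, u ∈ L ↔ u ∈ I.join) :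
    (L.map I.weight).sum = I.mu := by
  classical
  have hj : L.toFinset = I.join := by
    ext u
    rw [List.mem_toFinset, hmem]
  rw [← List.sum_toFinset _ hL, hj, mu]

end Instance

theorem one_le_logb {N : ℕ} (hN : 2 ≤ N) : 1 ≤ Real.logb 2 N := by
  rw [Real.le_logb_iff_rpow_le (by norm_num) (by positivity)]
  simpa using (by exact_mod_cast hN : (2 : ℝ) ≤ N)

theorem natLog_add_two_le {N : ℕ} (hN : 2 ≤ N) :
    ((Nat.log 2 N + 1 + 1 : ℕ) : ℝ) ≤ 3 * Real.logb 2 N := by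
  have h1 := one_le_logb hN
  have h2 : (Nat.log 2 N : ℝ) ≤ Real.logb 2 N := Real.natLog_le_logb N 2
  push_cast
  linarith

/-- For one schema, the theorem holds with all sufficiently large constants. -/
theorem exists_index (S : JoinSchema n k) : ∃ K : ℝ, ∀ C ≥ K, S.Acyclic →
    ∃ build query : Cmd, ∀ (I : Instance S) (τ : Tape), ∃ D : State,
      build.run (I.initial τ) = some D ∧
      (2 ≤ I.size →
        (D.time : ℝ) ≤ C * (I.size * Real.logb 2 I.size ^ (k - 1)) ∧
        (D.top : ℝ) ≤ C * (I.size * Real.logb 2 I.size ^ (k - 1))) ∧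
      (∀ (m : ℕ) (Y : Fin m → Finset (Fin n → ℝ)), (∀ i, Y i ⊆ I.join) →
        sessionMeasure {ω | ∀ i : Fin m, Returns query D ω i (Y i)} =
          ENNReal.ofReal (∏ i, I.sampleProb (Y i))) ∧
      (∀ i : ℕ, ∫⁻ ω, queryTime query D ω i ∂sessionMeasure ≤
        ENNReal.ofReal (C * (1 + I.mu * Real.logb 2 I.size))) := by
  by_cases hS : S.Acyclic
  swap
  · exact ⟨0, fun _ _ h => absurd h hS⟩
  obtain ⟨O⟩ := hS.nonempty_joinOrder
  obtain ⟨B₁, h₁⟩ := exists_wp_build O.plan S.relWidth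
  obtain ⟨B₂, h₂⟩ := exists_wp_query O.plan O.pos
  set K₀ : ℕ := k + (n + 1) + (2 * k + 1) * 4 + (n + 1) with hK₀
  refine ⟨6 * B₁ + 12 * B₂ + K₀, fun C hC _ => ⟨O.plan.build S.relWidth, O.plan.query,
    fun I τ => ?_⟩⟩
  set E := I.data O with hE
  set N := I.size with hN
  have htot : E.total = N := I.total_data O
  set j := Nat.log 2 N + 1 with hj
  have hNj : N < 2 ^ j := Nat.lt_pow_succ_log_self (by norm_num) N
  set J := if k = 1 then 0 else j with hJ
  obtain ⟨D, hrun, hready, ⟨X, hX⟩, htop, htime⟩ := (h₁ E (I.initial τ) I.relSize J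
    (fun r hr => by
      have e : I.relSize r = (I.rel ⟨r, hr⟩).length := by simp [Instance.relSize, hr]
      rw [e]
      exact I.getD_input_size ⟨r, hr⟩)
    I.length_input (fun i _ => rfl) (fun a _ => rfl) fun c h0 hc => by
      rw [hJ, if_neg (by omega)]
      have := E.m_le_total hc
      omega).run
  have hX1 : ∀ i < k, E.Stage X i := fun i hi => (hX i hi).1
  set L := E.leaves X k 0 0 with hL
  have hnd : L.Nodup := Data.nodup_leaves hX1 k 0 (by omega) 0
  have hmem : ∀ u, u ∈ L ↔ u ∈ I.join := fun u => I.mem_leaves_data O hX1 0 u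
  have hw : E.weight = I.weight := funext fun u => I.weight_data O u
  have hp : ∀ u ∈ L, I.weight u ∈ Set.Icc (0 : ℝ) 1 := fun u hu => I.weight_mem ((hmem u).1 hu)
  have hq : ∀ s, SameIndex D s → wp O.plan.query s fun s' => SameIndex s s' ∧
      s'.out = s.out ++ (kept (process I.weight L s.tape)).map List.ofFn ∧
      s'.time ≤ s.time + B₂ * (j + 1) * (process I.weight L s.tape).length + B₂ := fun s hs => by
    rw [← hw]
    exact h₂ E X j s hX1 (htot ▸ hNj) (hs.ready hready) fun i hi => by
      rw [hs.mem]; exact (hX i hi).2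
  have hB₁ : (0 : ℝ) ≤ B₁ := Nat.cast_nonneg _
  have hB₂ : (0 : ℝ) ≤ B₂ := Nat.cast_nonneg _
  have hK0 : (0 : ℝ) ≤ K₀ := Nat.cast_nonneg _
  refine ⟨D, hrun, fun h2 => ?_, fun m Y hY => sessionMeasure_returns hq hnd hmem hp hY,
    fun i => (lintegral_queryTime_le hq hp i).trans (ENNReal.ofReal_le_ofReal ?_)⟩
  · have hlog := one_le_logb h2
    have hpow : 1 ≤ Real.logb 2 N ^ (k - 1) := one_le_pow₀ hlog
    have hN0 : (2 : ℝ) ≤ N := by exact_mod_cast h2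
    have hbig : 0 ≤ N * Real.logb 2 N ^ (k - 1) := by positivity
    constructor
    · have hJ1 : ((J + 1 : ℕ) : ℝ) ≤ 3 * Real.logb 2 N ^ (k - 1) := by
        rw [hJ]
        split_ifs with h
        · simp [h]
        · refine (natLog_add_two_le h2).trans ?_
          have h3 : Real.logb 2 N ^ 1 ≤ Real.logb 2 N ^ (k - 1) :=
            pow_le_pow_right₀ hlog (by have := O.pos; omega)
          rw [pow_one] at h3
          linarith
      have h3 : (D.time : ℝ) ≤ B₁ * ((N + 1) * ((J + 1 : ℕ) : ℝ)) := by
        rw [htot] at htime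
        have : D.time ≤ B₁ * ((N + 1) * (J + 1)) := by
          simpa [Instance.initial] using htime
        exact_mod_cast this
      calc (D.time : ℝ) ≤ B₁ * ((N + 1) * ((J + 1 : ℕ) : ℝ)) := h3
        _ ≤ B₁ * ((2 * N) * (3 * Real.logb 2 N ^ (k - 1))) := by gcongr; linarith
        _ = 6 * B₁ * (N * Real.logb 2 N ^ (k - 1)) := by ring
        _ ≤ C * (N * Real.logb 2 N ^ (k - 1)) := by gcongr; linarith
    · have h3 : D.top ≤ K₀ * N := by
        have h4 : I.input.length ≤ k + N * (n + 1) := I.length_input_le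
        have h5 : D.top ≤ max I.input.length E.cap := htop
        have h6 : E.cap = I.input.length + (2 * k + 1) * (2 * N + 3) + (n + 1) := by
          rw [Data.cap, htot]; rfl
        have h7 : (2 * k + 1) * (2 * N + 3) ≤ (2 * k + 1) * (4 * N) :=
          Nat.mul_le_mul_left _ (by omega)
        have h8 : K₀ * N = k * N + N * (n + 1) + (2 * k + 1) * (4 * N) + (n + 1) * N := by
          rw [hK₀]; ring
        have h9 : k * 1 ≤ k * N := Nat.mul_le_mul_left _ (by omega)
        have h10 : (n + 1) * 1 ≤ (n + 1) * N := Nat.mul_le_mul_left _ (by omega)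
        omega
      calc (D.top : ℝ) ≤ K₀ * N := by exact_mod_cast h3
        _ ≤ C * N := by gcongr; linarith
        _ ≤ C * (N * Real.logb 2 N ^ (k - 1)) := by
          have hC0 : 0 ≤ C := by linarith
          gcongr
          exact le_mul_of_one_le_right (by positivity) hpow
  · rw [I.sum_map_weight hnd hmem]
    have hmu := I.mu_nonneg
    rcases Nat.lt_or_ge N 2 with h2 | h2
    · have hmu1 := I.mu_le_one (by omega)
      have hlog : 0 ≤ Real.logb 2 N := by
        rcases Nat.eq_zero_or_pos N with h | h
        · simp [h]
        · exact Real.logb_nonneg (by norm_num) (by exact_mod_cast h)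
      have hj1 : j = 1 := by
        rw [hj, Nat.log_of_lt h2]
      have h3 : 0 ≤ I.mu * Real.logb 2 N := by positivity
      calc ((B₂ * (j + 1) : ℕ) : ℝ) * (4 * I.mu) + B₂ = B₂ * (8 * I.mu) + B₂ := by
            rw [hj1]; push_cast; ring
        _ ≤ B₂ * (8 * 1) + B₂ := by gcongr
        _ ≤ C := by linarith
        _ ≤ C * (1 + I.mu * Real.logb 2 N) :=
          le_mul_of_one_le_right (by linarith) (by linarith)
    · have h3 := natLog_add_two_le h2
      calc ((B₂ * (j + 1) : ℕ) : ℝ) * (4 * I.mu) + B₂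
          = B₂ * (((j + 1 : ℕ) : ℝ) * (4 * I.mu) + 1) := by push_cast; ring
        _ ≤ B₂ * ((3 * Real.logb 2 N) * (4 * I.mu) + 1) := by gcongr
        _ ≤ B₂ * (12 * (1 + I.mu * Real.logb 2 N)) := by
          have := one_le_logb h2
          gcongr
          linarith
        _ = 12 * B₂ * (1 + I.mu * Real.logb 2 N) := by ring
        _ ≤ C * (1 + I.mu * Real.logb 2 N) := by
          have := one_le_logb h2
          gcongr
          linarith

instance : Finite (JoinSchema n k) :=
  Finite.of_injective (fun S : JoinSchema n k => S.schema) fun S S' h => by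
    cases S; cases S'; congr

end SubsetSamplingJoin

theorem theorem3p1 (n k : ℕ) :
    ∃ C : ℝ, ∀ S : SubsetSamplingJoin.JoinSchema n k, S.Acyclic →
      ∃ build query : SubsetSamplingJoin.Cmd,
        ∀ (I : SubsetSamplingJoin.Instance S) (τ : SubsetSamplingJoin.Tape),
          ∃ D : SubsetSamplingJoin.State,
            -- construction of the index, in the worst case
            build.run (I.initial τ) = some D ∧
            (2 ≤ I.size →
              (D.time : ℝ) ≤ C * (I.size * Real.logb 2 I.size ^ (k - 1)) ∧
              (D.top : ℝ) ≤ C * (I.size * Real.logb 2 I.size ^ (k - 1))) ∧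
            -- the answers to successive queries are independent subset samples
            (∀ (m : ℕ) (Y : Fin m → Finset (Fin n → ℝ)), (∀ i, Y i ⊆ I.join) →
              SubsetSamplingJoin.sessionMeasure
                  {ω | ∀ i : Fin m, SubsetSamplingJoin.Returns query D ω i (Y i)} =
                ENNReal.ofReal (∏ i, I.sampleProb (Y i))) ∧
            -- expected time of each query
            (∀ i : ℕ,
              ∫⁻ ω, SubsetSamplingJoin.queryTime query D ω i
                  ∂SubsetSamplingJoin.sessionMeasure ≤
                ENNReal.ofReal (C * (1 + I.mu * Real.logb 2 I.size))) := by
  choose K hK using fun S : SubsetSamplingJoin.JoinSchema n k =>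
    SubsetSamplingJoin.exists_index S
  obtain ⟨C, hC⟩ := Finite.exists_le K
  exact ⟨C, fun S hS => hK S C (hC S) hS⟩
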